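/- For real $x$ let $\|x\|$ be the distance from $x$ to the nearest integer. For irrational $\alpha$ and real $\gamma$ put $$M(\alpha,\gamma)=\liminf_{|n|\to\infty}|n|\,\|n\alpha-\gamma\|\quad(n\in\mathbb Z),\qquad \rho(\alpha)=\sup_{\gamma\notin\mathbb Z+\alpha\mathbb Z}M(\alpha,\gamma).$$ The negative continued fraction expansion of $\alpha$ has the partial quotients $a_{n+1}=\lceil 1/\alpha_n\rceil$ ($n\ge 0$), where $\alpha_0=\{\alpha\}$ is the fractional part of $\alpha$ and $\alpha_{n+1}=\lceil 1/\alpha_n\rceil-1/\alpha_n$. Put $D_n=\alpha_0\alpha_1\cdots\alpha_n$ and $$\gamma^*=\gamma^*(\alpha)=\sum_{i=1}^\infty \tfrac12\,(a_i-2+t_i)\,D_{i-1},$$ where $t_i=0$ if $a_i$ is even and $t_i=(-1)^{j+1}$ if $a_i$ is the $j$-th odd partial quotient. For odd $R\ge 5$ let $$\beta=\tfrac12\Bigl(R+1-\sqrt{(R+1)^2-4}\Bigr),\qquad \delta=\frac1{R-\beta},\qquad C_1(R)=\frac{\left(1-2\delta+\frac{2\delta\beta}{1+\beta}\right)(1-\beta)}{4(1-\delta\beta)}.$$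 (1) Let $R\ge5$ be odd and, for each $l\ge 0$, let $\alpha=\alpha^{(l)}$ be an irrational number whose negative continued fraction expansion is (eventually) periodic with period $R,\underbrace{R+1,\dots,R+1}_{l}$. Then $$\lim_{l\to\infty}\rho(\alpha)=C_1(R).$$ Moreover $\gamma^*$ is not the optimal $\gamma$: $\limsup_{l\to\infty}M(\alpha,\gamma^*)<C_1(R)=\lim_{l\to\infty}\rho(\alpha)$, and hence $M(\alpha,\gamma^*)<\rho(\alpha)$ for all sufficiently large $l$. (2) For odd $R\ge 5$, $$C_1(R)=\frac14\left(1-\frac3R+\frac6{R^2}+O(R^{-3})\right)$$ with an absolute implied constant. -/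

import Mathlib

open Filter Topology

noncomputable section

namespace InhomApprox

/-- Distance from `x` to the nearest integer. -/
def distInt (x : ℝ) : ℝ := |x - round x|

/-- `M(α, γ) = liminf_{|n| → ∞} |n| ‖nα - γ‖`, where `n` runs through all integers
(`cofinite` on `ℤ` is `|n| → ∞`). The liminf is taken in the extended reals, so that it is
the true liminf without any boundedness proviso. -/
def M (α γ : ℝ) : EReal :=
  liminf (fun n : ℤ => ((|(n : ℝ)| * distInt (n * α - γ) : ℝ) : EReal)) cofinite

/-- `ρ(α) = sup { M(α, γ) : γ ∉ ℤ + αℤ }`. -/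
def rho (α : ℝ) : EReal :=
  sSup {x : EReal | ∃ γ : ℝ, (¬ ∃ m n : ℤ, γ = m + n * α) ∧ x = M α γ}

/-- The remainders `α_n` of the negative (round-up) continued fraction algorithm:
`α_0 = {α}` and `α_{n+1} = ⌈1/α_n⌉ - 1/α_n`. -/
def negCFRem (α : ℝ) : ℕ → ℝ
  | 0 => Int.fract α
  | n + 1 => (⌈1 / negCFRem α n⌉ : ℝ) - 1 / negCFRem α n

/-- The partial quotients of the negative continued fraction expansion
`α = ⌊α⌋ + 1/(a_1 - 1/(a_2 - 1/(a_3 - ⋯)))`; the indices are shifted by one, that is,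
`negCFDigit α n = a_{n+1} = ⌈1/α_n⌉`. -/
def negCFDigit (α : ℝ) (n : ℕ) : ℤ := ⌈1 / negCFRem α n⌉

/-- From some point on, the partial quotients of the negative continued fraction expansion
of `α` are the block `R, R+1, …, R+1` (with `l` copies of `R+1`), repeated for ever. -/
def HasNegCFPeriod (R l : ℕ) (α : ℝ) : Prop :=
  ∃ N : ℕ, ∀ i : ℕ, negCFDigit α (N + i) = if (l + 1) ∣ i then (R : ℤ) else (R : ℤ) + 1

/-- `D_n = α_0 α_1 ⋯ α_n`. -/
def negCFD (α : ℝ) (n : ℕ) : ℝ := ∏ j ∈ Finset.range (n + 1), negCFRem α j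

/-- The number of odd partial quotients among `a_1, …, a_{n+1}`. -/
def oddCount (α : ℝ) (n : ℕ) : ℕ :=
  ((Finset.range (n + 1)).filter (fun m => Odd (negCFDigit α m))).card

/-- `tStar α n = t_{n+1}`, where `t_i = 0` if `a_i` is even, and `t_i = (-1)^(j+1)` if `a_i` is
the `j`-th odd partial quotient. -/
def tStar (α : ℝ) (n : ℕ) : ℤ :=
  if Even (negCFDigit α n) then 0 else (-1) ^ (oddCount α n + 1)

/-- `γ* = ∑_{i ≥ 1} ½ (a_i - 2 + t_i) D_{i-1}`. -/
def gammaStar (α : ℝ) : ℝ :=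
  ∑' n : ℕ, (1 / 2 : ℝ) * ((negCFDigit α n : ℝ) - 2 + (tStar α n : ℝ)) * negCFD α n

/-- For odd `R`, the value `β` of the purely periodic expansion with all partial quotients
`R + 1`. -/
def beta (R : ℕ) : ℝ := (1 / 2) * (((R : ℝ) + 1) - √(((R : ℝ) + 1) ^ 2 - 4))

/-- For odd `R`, the value `δ` of the expansion with first partial quotient `R`, all the others
being `R + 1`. -/
def delta (R : ℕ) : ℝ := 1 / ((R : ℝ) - beta R)

/-- `(1 - 2δ + 2δβ/(1+β)) (1 - β) / (4 (1 - δβ))`. -/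
def limitValue (R : ℕ) : ℝ :=
  (1 - 2 * delta R + 2 * delta R * beta R / (1 + beta R)) * (1 - beta R) /
    (4 * (1 - delta R * beta R))

end InhomApprox

end

/-! Put v_k = (q_k, E_k), where q_k is a convergent denominator and E_k = α_0⋯α_{k-1}. Two
consecutive v_k form a basis of the unimodular lattice of pairs (n, nα - m), and M(α, γ) is a liminf
of |XZ| over the translate of this lattice by (0, -γ). Signed digits t_k, congruent to the partial
quotients mod 2, describe for every k a cell of this translate with edges v_k, v_{k+1} and centre
(S_k, -T_k)/2; the centre moves by t_k v_{k+1}/2. With x = q_k/q_{k+1}, y = α_k, s = S_k/q_{k+1}, τ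
= T_k/E_k, the products |XZ| at the vertices are `prodA` and `prodB` at ±(s, τ), in absolute value,
divided by 4(1 - xy). Two of them bound M from above for every γ (`eventually_lt_prodA`, with chains
from `exists_boundedChain`). If every cell has a vertex in each quadrant, all four bound M from
below (`DividedChain.le_M`).

As l grows, the digits R become isolated. Compactness along an ultrafilter (`exists_limitSystem`)
replaces the chains by one bi-infinite system with at most one digit R, in which x and y are
explicit near R. Write m = 4 C₁(R).

Upper bound: if c < M for some c > C₁ and infinitely many l, there is a limit system around a digit
R whose `prodA` values at ±(s, τ) all exceed m(1 - xy) in absolute value. Its cells are divided, so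
AM-GM makes s + τ small; with parity this forces t_j + t_{j+1} = 0 away from R. Hence s_0 and τ_1
are explicit in t_{-1}, t_1, only six shapes of (t_{-1}, t_0, t_1) survive, and each contradicts a
vertex inequality (`CellSystem.false`).

Lower bound: the digits …, 0, 0, 1, -2, 2, -2, … around R have all products at least m(1 - xy), with
equality next to R (`SingleSystem.goodCell`). Letting the side carrying the ±2 alternate from block
to block realises this at every R simultaneously.

The digits of γ* are 0 on both sides of R, which gives the strictly smaller product (1 - β)(1 - 2δ).
For part (2), R and C₁ are both rational functions of β. -/

noncomputable section

namespace InhomApprox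

/-! ### Convergents, lattice bases and chains of cells. -/

section

/-- `E_k = α_0 ⋯ α_{k-1}`. -/
def cfE (α : ℝ) (k : ℕ) : ℝ := ∏ j ∈ Finset.range k, negCFRem α j

/-- The denominators of the convergents of the negative continued fraction. -/
def cfQ (α : ℝ) : ℕ → ℝ
  | 0 => 0
  | 1 => 1
  | k + 2 => negCFDigit α k * cfQ α (k + 1) - cfQ α k

lemma negCFRem_irrational {α : ℝ} (h : Irrational α) (k : ℕ) :
    Irrational (negCFRem α k) ∧ 0 < negCFRem α k ∧ negCFRem α k < 1 := by
  induction k with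
  | zero =>
    have h1 : Irrational (negCFRem α 0) := by
      have : negCFRem α 0 = α - (⌊α⌋ : ℤ) := rfl
      rw [this]; exact h.sub_intCast _
    refine ⟨h1, lt_of_le_of_ne (Int.fract_nonneg α) ?_, Int.fract_lt_one α⟩
    intro h0
    exact h1.ne_zero (by simpa [negCFRem] using h0.symm)
  | succ k ih =>
    obtain ⟨h1, h2, h3⟩ := ih
    have hi : Irrational (1 / negCFRem α k) := by
      rw [one_div]; exact h1.inv
    have h4 : Irrational (negCFRem α (k + 1)) := hi.intCast_sub _
    have h5 := Int.le_ceil (1 / negCFRem α k)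
    have h6 := Int.ceil_lt_add_one (1 / negCFRem α k)
    have e : negCFRem α (k + 1) = (⌈1 / negCFRem α k⌉ : ℝ) - 1 / negCFRem α k := rfl
    refine ⟨h4, lt_of_le_of_ne (by rw [e]; linarith) (h4.ne_zero.symm), by rw [e]; linarith⟩

lemma negCFRem_pos {α : ℝ} (h : Irrational α) (k : ℕ) : 0 < negCFRem α k :=
  (negCFRem_irrational h k).2.1

lemma negCFRem_lt_one {α : ℝ} (h : Irrational α) (k : ℕ) : negCFRem α k < 1 :=
  (negCFRem_irrational h k).2.2

lemma negCFRem_succ (α : ℝ) (k : ℕ) :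
    negCFRem α (k + 1) = negCFDigit α k - 1 / negCFRem α k := rfl

lemma negCFRem_mul {α : ℝ} (h : Irrational α) (k : ℕ) :
    negCFRem α k * (negCFDigit α k - negCFRem α (k + 1)) = 1 := by
  rw [negCFRem_succ]
  have := (negCFRem_pos h k).ne'
  field_simp
  ring

lemma two_le_negCFDigit {α : ℝ} (h : Irrational α) (k : ℕ) : 2 ≤ negCFDigit α k := by
  have h1 : (1 : ℝ) < 1 / negCFRem α k := by
    rw [lt_div_iff₀ (negCFRem_pos h k)]; linarith [negCFRem_lt_one h k]
  have h2 : (1 : ℝ) < negCFDigit α k := h1.trans_le (Int.le_ceil _)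
  have : (1 : ℤ) < negCFDigit α k := by exact_mod_cast h2
  omega

lemma two_le_negCFDigit_real {α : ℝ} (h : Irrational α) (k : ℕ) :
    (2 : ℝ) ≤ negCFDigit α k := by exact_mod_cast two_le_negCFDigit h k

@[simp] lemma cfE_zero (α : ℝ) : cfE α 0 = 1 := by simp [cfE]

lemma cfE_succ (α : ℝ) (k : ℕ) : cfE α (k + 1) = cfE α k * negCFRem α k := by
  simp [cfE, Finset.prod_range_succ]

lemma cfE_pos {α : ℝ} (h : Irrational α) (k : ℕ) : 0 < cfE α k :=
  Finset.prod_pos fun j _ => negCFRem_pos h j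

lemma cfE_succ_lt {α : ℝ} (h : Irrational α) (k : ℕ) : cfE α (k + 1) < cfE α k := by
  rw [cfE_succ]
  nlinarith [cfE_pos h k, negCFRem_lt_one h k]

lemma cfE_antitone {α : ℝ} (h : Irrational α) : Antitone (cfE α) :=
  antitone_nat_of_succ_le fun k => (cfE_succ_lt h k).le

lemma cfE_rec {α : ℝ} (h : Irrational α) (k : ℕ) :
    cfE α (k + 2) = negCFDigit α k * cfE α (k + 1) - cfE α k := by
  rw [cfE_succ α (k + 1), cfE_succ α k]
  linear_combination (-cfE α k) * negCFRem_mul h k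

@[simp] lemma cfQ_zero (α : ℝ) : cfQ α 0 = 0 := rfl
@[simp] lemma cfQ_one (α : ℝ) : cfQ α 1 = 1 := rfl
lemma cfQ_rec (α : ℝ) (k : ℕ) :
    cfQ α (k + 2) = negCFDigit α k * cfQ α (k + 1) - cfQ α k := rfl

lemma cfQ_growth {α : ℝ} (h : Irrational α) (k : ℕ) :
    (k : ℝ) ≤ cfQ α k ∧ cfQ α k + 1 ≤ cfQ α (k + 1) := by
  induction k with
  | zero => simp
  | succ k ih =>
    obtain ⟨h1, h2⟩ := ih
    have := two_le_negCFDigit_real h k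
    have h0 : (0 : ℝ) ≤ k := Nat.cast_nonneg k
    refine ⟨by push_cast; linarith, ?_⟩
    rw [show k + 1 + 1 = k + 2 from rfl, cfQ_rec]
    nlinarith

lemma cfQ_nonneg {α : ℝ} (h : Irrational α) (k : ℕ) : 0 ≤ cfQ α k :=
  (Nat.cast_nonneg k).trans (cfQ_growth h k).1

lemma cfQ_succ_pos {α : ℝ} (h : Irrational α) (k : ℕ) : 0 < cfQ α (k + 1) := by
  linarith [cfQ_nonneg h k, (cfQ_growth h k).2]

/-- Unimodularity of the k-th basis: both sequences satisfy the same recurrence, so the determinant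
is constant. -/
lemma cf_det {α : ℝ} (h : Irrational α) (k : ℕ) :
    cfQ α (k + 1) * cfE α k - cfQ α k * cfE α (k + 1) = 1 := by
  induction k with
  | zero => simp
  | succ k ih =>
    rw [show k + 1 + 1 = k + 2 from rfl, cfQ_rec, cfE_rec h]
    linear_combination ih

/-- `x_k = q_k / q_{k+1}`. -/
def cfX (α : ℝ) (k : ℕ) : ℝ := cfQ α k / cfQ α (k + 1)

lemma cfX_mul {α : ℝ} (h : Irrational α) (k : ℕ) :
    cfX α (k + 1) * (negCFDigit α k - cfX α k) = 1 := by
  have h1 := (cfQ_succ_pos h k).ne'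
  have h2 := (cfQ_succ_pos h (k + 1)).ne'
  unfold cfX
  rw [show k + 1 + 1 = k + 2 from rfl] at *
  field_simp
  rw [cfQ_rec]
  ring

lemma cfX_nonneg {α : ℝ} (h : Irrational α) (k : ℕ) : 0 ≤ cfX α k :=
  div_nonneg (cfQ_nonneg h k) (cfQ_nonneg h _)

lemma cfX_lt_one {α : ℝ} (h : Irrational α) (k : ℕ) : cfX α k < 1 := by
  rw [cfX, div_lt_one (cfQ_succ_pos h k)]
  linarith [(cfQ_growth h k).2]

/-- Normalising the coordinates by q_{k+1} and E_k therefore costs exactly the factor 1 - xy, which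
is why the thresholds below all have the form m(1 - xy). -/
lemma cf_det_norm {α : ℝ} (h : Irrational α) (k : ℕ) :
    cfQ α (k + 1) * cfE α k * (1 - cfX α k * negCFRem α k) = 1 := by
  have h1 := (cfQ_succ_pos h k).ne'
  have h2 := cf_det h k
  rw [cfE_succ] at h2
  have : cfX α k * cfQ α (k + 1) = cfQ α k := by unfold cfX; field_simp
  linear_combination h2 - cfE α k * negCFRem α k * this

/-- The point `(X, Z)` has the coordinates `i + 1/2`, `j + 1/2` in the `k`-th basis of the lattice
of the pairs `(n, nα - m)`, relative to the centre `(S_k, -T_k) / 2`. -/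
def GridPt (α : ℝ) (S T : ℕ → ℝ) (k : ℕ) (i j : ℤ) (X Z : ℝ) : Prop :=
  X = (S k + (2 * i + 1) * cfQ α (k + 1) + (2 * j + 1) * cfQ α k) / 2 ∧
  Z = (-T k + (2 * i + 1) * cfE α (k + 1) + (2 * j + 1) * cfE α k) / 2

/-- The digits `t_k` move the centre `(S_k, -T_k) / 2` from one cell to the next one. -/
structure CellChain (α : ℝ) (t : ℕ → ℤ) (S T : ℕ → ℝ) : Prop where
  S_succ : ∀ k, S (k + 1) = S k + t k * cfQ α (k + 1)
  T_succ : ∀ k, T k = t k * cfE α (k + 1) + T (k + 1)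
  parity : ∀ k, Even (negCFDigit α k - t k)

/-- Substitute v_k = a_k v_{k+1} - v_{k+2}. The coefficient of v_{k+2} is the negative of the old
coefficient of v_k, and the parity of a_k - t_k keeps the new coefficient of v_{k+1} half an odd
integer. -/
lemma CellChain.gridPt_succ {α : ℝ} (hα : Irrational α) {t : ℕ → ℤ} {S T : ℕ → ℝ}
    (h : CellChain α t S T) {k : ℕ} {i j : ℤ} {X Z : ℝ} (hg : GridPt α S T k i j X Z) :
    ∃ j', GridPt α S T (k + 1) (-j - 1) j' X Z := by
  obtain ⟨b, hb⟩ := h.parity k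
  obtain ⟨h1, h2⟩ := hg
  have hb' : (negCFDigit α k : ℝ) - t k = b + b := by exact_mod_cast hb
  refine ⟨i + j * negCFDigit α k + b, ?_, ?_⟩
  · rw [h1, h.S_succ, show k + 1 + 1 = k + 2 from rfl, cfQ_rec]
    push_cast
    linear_combination cfQ α (k + 1) / 2 * hb'
  · rw [h2, h.T_succ, show k + 1 + 1 = k + 2 from rfl, cfE_rec hα]
    push_cast
    linear_combination cfE α (k + 1) / 2 * hb'

lemma CellChain.gridPt_pred {α : ℝ} (hα : Irrational α) {t : ℕ → ℤ} {S T : ℕ → ℝ}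
    (h : CellChain α t S T) {k : ℕ} {i j : ℤ} {X Z : ℝ} (hg : GridPt α S T (k + 1) i j X Z) :
    ∃ i', GridPt α S T k i' (-i - 1) X Z := by
  obtain ⟨b, hb⟩ := h.parity k
  obtain ⟨h1, h2⟩ := hg
  have hb' : (negCFDigit α k : ℝ) - t k = b + b := by exact_mod_cast hb
  refine ⟨j + (i + 1) * negCFDigit α k - b, ?_, ?_⟩
  · rw [h1, h.S_succ, show k + 1 + 1 = k + 2 from rfl, cfQ_rec]
    push_cast
    linear_combination -cfQ α (k + 1) / 2 * hb'
  · rw [h2, h.T_succ k, show k + 1 + 1 = k + 2 from rfl, cfE_rec hα]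
    push_cast
    linear_combination -cfE α (k + 1) / 2 * hb'

lemma CellChain.gridPt_zero {α : ℝ} (hα : Irrational α) {t : ℕ → ℤ} {S T : ℕ → ℝ}
    (h : CellChain α t S T) {X Z : ℝ} (k : ℕ) :
    ∀ i j : ℤ, GridPt α S T k i j X Z → ∃ i' j', GridPt α S T 0 i' j' X Z := by
  induction k with
  | zero => intro i j hg; exact ⟨i, j, hg⟩
  | succ k ih =>
    intro i j hg
    obtain ⟨i', h'⟩ := h.gridPt_pred hα hg
    exact ih _ _ h'

lemma CellChain.gridPt_all {α : ℝ} (hα : Irrational α) {t : ℕ → ℤ} {S T : ℕ → ℝ}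
    (h : CellChain α t S T) {X Z : ℝ} {i j : ℤ} (hg : GridPt α S T 0 i j X Z) (k : ℕ) :
    ∃ i' j', GridPt α S T k i' j' X Z := by
  induction k with
  | zero => exact ⟨i, j, hg⟩
  | succ k ih =>
    obtain ⟨i', j', h'⟩ := ih
    obtain ⟨j'', h''⟩ := h.gridPt_succ hα h'
    exact ⟨_, _, h''⟩

lemma GridPt.det {α : ℝ} (hα : Irrational α) {S T : ℕ → ℝ} {k : ℕ} {i j : ℤ} {X Z : ℝ}
    (hg : GridPt α S T k i j X Z) :
    (2 * i + 1 : ℝ) = cfE α k * (2 * X - S k) - cfQ α k * (2 * Z + T k) ∧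
    (2 * j + 1 : ℝ) = cfQ α (k + 1) * (2 * Z + T k) - cfE α (k + 1) * (2 * X - S k) := by
  obtain ⟨h1, h2⟩ := hg
  have := cf_det hα k
  rw [h1, h2]
  constructor
  · linear_combination (-(2 * i + 1)) * this
  · linear_combination (-(2 * j + 1)) * this

lemma GridPt.unique {α : ℝ} (hα : Irrational α) {S T : ℕ → ℝ} {k : ℕ} {i j i' j' : ℤ} {X Z : ℝ}
    (hg : GridPt α S T k i j X Z) (hg' : GridPt α S T k i' j' X Z) : i = i' ∧ j = j' := by
  have h1 := hg.det hα
  have h2 := hg'.det hα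
  have e1 : (i : ℝ) = i' := by linarith [h1.1, h2.1]
  have e2 : (j : ℝ) = j' := by linarith [h1.2, h2.2]
  exact ⟨by exact_mod_cast e1, by exact_mod_cast e2⟩

/-- A chain belongs to `γ` if its grid is that of the pairs `(n, nα - m - γ)`. -/
structure Represents (α γ : ℝ) (S T : ℕ → ℝ) : Prop where
  S_zero : S 0 = -1
  value : ∃ m : ℤ, γ = (1 - Int.fract α) / 2 + T 0 / 2 + m

lemma Represents.exists_of_gridPt {α γ : ℝ} {S T : ℕ → ℝ}
    (h : Represents α γ S T) {i j : ℤ} {X Z : ℝ} (hg : GridPt α S T 0 i j X Z) :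
    ∃ m : ℤ, X = i ∧ Z = i * α - γ - m := by
  obtain ⟨m, hm⟩ := h.value
  obtain ⟨h1, h2⟩ := hg
  have hf : Int.fract α = α - ⌊α⌋ := rfl
  have e : negCFRem α 0 = Int.fract α := rfl
  refine ⟨i * ⌊α⌋ - j - m - 1, ?_, ?_⟩
  · rw [h1, h.S_zero]; simp
  · rw [h2, hm, cfE_succ, e]; push_cast; rw [cfE_zero, hf]; ring

lemma Represents.gridPt {α γ : ℝ} {S T : ℕ → ℝ} (h : Represents α γ S T) (n m : ℤ) :
    ∃ j, GridPt α S T 0 n j n (n * α - γ - m) := by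
  obtain ⟨m', hm⟩ := h.value
  have hf : Int.fract α = α - ⌊α⌋ := rfl
  have e : negCFRem α 0 = Int.fract α := rfl
  refine ⟨n * ⌊α⌋ - m - m' - 1, ?_, ?_⟩
  · rw [h.S_zero]; simp
  · rw [hm, cfE_succ, e]; push_cast; rw [cfE_zero, hf]; ring

lemma distInt_le (x : ℝ) (m : ℤ) : distInt x ≤ |x - m| := round_le x m

lemma distInt_pos {x : ℝ} (h : ∀ m : ℤ, x ≠ m) : 0 < distInt x :=
  abs_pos.mpr (sub_ne_zero.mpr (h _))

lemma negCFRem_lt_half {α : ℝ} (hα : Irrational α) {k : ℕ} (h : 3 ≤ negCFDigit α k) :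
    negCFRem α k < 1 / 2 := by
  have h1 := negCFRem_mul hα k
  have h2 := negCFRem_lt_one hα (k + 1)
  have h3 := negCFRem_pos hα k
  have h4 : (3 : ℝ) ≤ negCFDigit α k := by exact_mod_cast h
  nlinarith

lemma cfE_tendsto {α : ℝ} (hα : Irrational α) (h : ∀ᶠ k in atTop, 3 ≤ negCFDigit α k) :
    Tendsto (cfE α) atTop (𝓝 0) := by
  obtain ⟨N, hN⟩ := eventually_atTop.1 h
  have h1 : ∀ i, cfE α (i + N) ≤ (1 / 2 : ℝ) ^ i * cfE α N := by
    intro i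
    induction i with
    | zero => simp
    | succ i ih =>
      rw [show i + 1 + N = (i + N) + 1 by ring, cfE_succ, pow_succ]
      have h2 := negCFRem_lt_half hα (hN (i + N) (by omega))
      have h3 := cfE_pos hα (i + N)
      nlinarith
  rw [← tendsto_add_atTop_iff_nat N]
  refine squeeze_zero (fun i => (cfE_pos hα _).le) h1 ?_
  have := (tendsto_pow_atTop_nhds_zero_of_lt_one (r := (1 / 2 : ℝ)) (by norm_num)
    (by norm_num)).mul_const (cfE α N)
  simpa using this

/-- The normalised first coordinate of the centre. -/
def nS (α : ℝ) (S : ℕ → ℝ) (k : ℕ) : ℝ := S k / cfQ α (k + 1)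

/-- The normalised second coordinate of the centre. -/
def nT (α : ℝ) (T : ℕ → ℝ) (k : ℕ) : ℝ := T k / cfE α k

/-- The products at two opposite vertices of a cell. -/
def prodA (x y s τ : ℝ) : ℝ := (1 - x + s) * (1 - y + τ)

/-- The products at the other two vertices of a cell. -/
def prodB (x y s τ : ℝ) : ℝ := (1 + x + s) * (1 + y - τ)

lemma nS_mul {α : ℝ} (hα : Irrational α) (S : ℕ → ℝ) (k : ℕ) :
    nS α S k * cfQ α (k + 1) = S k := by
  have := (cfQ_succ_pos hα k).ne'
  unfold nS; field_simp

lemma nT_mul {α : ℝ} (hα : Irrational α) (T : ℕ → ℝ) (k : ℕ) :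
    nT α T k * cfE α k = T k := by
  have := (cfE_pos hα k).ne'
  unfold nT; field_simp

lemma cfX_mul_cfQ {α : ℝ} (hα : Irrational α) (k : ℕ) :
    cfX α k * cfQ α (k + 1) = cfQ α k := by
  have := (cfQ_succ_pos hα k).ne'
  unfold cfX; field_simp

lemma one_sub_cfX_mul_pos {α : ℝ} (hα : Irrational α) (k : ℕ) :
    0 < 1 - cfX α k * negCFRem α k := by
  nlinarith [cfX_nonneg hα k, cfX_lt_one hα k, negCFRem_pos hα k, negCFRem_lt_one hα k]

lemma vertex_prodA {α : ℝ} (hα : Irrational α) (S T : ℕ → ℝ) (k : ℕ) :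
    (cfQ α (k + 1) - cfQ α k + S k) * (cfE α k - cfE α (k + 1) + T k) *
      (1 - cfX α k * negCFRem α k) =
      prodA (cfX α k) (negCFRem α k) (nS α S k) (nT α T k) := by
  have h1 := cf_det_norm hα k
  have e1 : cfQ α (k + 1) - cfQ α k + S k = cfQ α (k + 1) * (1 - cfX α k + nS α S k) := by
    linear_combination cfX_mul_cfQ hα k - nS_mul hα S k
  have e2 : cfE α k - cfE α (k + 1) + T k = cfE α k * (1 - negCFRem α k + nT α T k) := by
    rw [cfE_succ]; linear_combination - nT_mul hα T k
  rw [e1, e2, prodA]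
  linear_combination (1 - cfX α k + nS α S k) * (1 - negCFRem α k + nT α T k) * h1

lemma vertex_prodB {α : ℝ} (hα : Irrational α) (S T : ℕ → ℝ) (k : ℕ) :
    (cfQ α (k + 1) + cfQ α k + S k) * (cfE α k + cfE α (k + 1) - T k) *
      (1 - cfX α k * negCFRem α k) =
      prodB (cfX α k) (negCFRem α k) (nS α S k) (nT α T k) := by
  have h1 := cf_det_norm hα k
  have e1 : cfQ α (k + 1) + cfQ α k + S k = cfQ α (k + 1) * (1 + cfX α k + nS α S k) := by
    linear_combination - cfX_mul_cfQ hα k - nS_mul hα S k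
  have e2 : cfE α k + cfE α (k + 1) - T k = cfE α k * (1 + negCFRem α k - nT α T k) := by
    rw [cfE_succ]; linear_combination nT_mul hα T k
  rw [e1, e2, prodB]
  linear_combination (1 + cfX α k + nS α S k) * (1 + negCFRem α k - nT α T k) * h1

lemma nS_neg (α : ℝ) (S : ℕ → ℝ) (k : ℕ) : nS α (fun k => -S k) k = -nS α S k := by
  simp [nS, neg_div]

lemma nT_neg (α : ℝ) (S : ℕ → ℝ) (k : ℕ) : nT α (fun k => -S k) k = -nT α S k := by
  simp [nT, neg_div]

/-- If `c < M(α, γ)`, then far away in any chain of cells for `γ` two of the four vertex products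
are larger than `c`. -/
lemma eventually_lt_prodA {α γ c : ℝ} (hα : Irrational α)
    (h3 : ∀ᶠ k in atTop, 3 ≤ negCFDigit α k) {t : ℕ → ℤ} {S T : ℕ → ℝ}
    (hc : CellChain α t S T) (hr : Represents α γ S T)
    (hT : ∀ k, |T k| ≤ cfE α k + cfE α (k + 1)) (hγ : ¬ ∃ m n : ℤ, γ = m + n * α)
    (hM : (c : EReal) < M α γ) :
    ∀ᶠ k in atTop,
      4 * c * (1 - cfX α k * negCFRem α k) <
        |prodA (cfX α k) (negCFRem α k) (nS α S k) (nT α T k)| ∧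
      4 * c * (1 - cfX α k * negCFRem α k) <
        |prodA (cfX α k) (negCFRem α k) (-nS α S k) (-nT α T k)| := by
  have h1 := Filter.eventually_lt_of_lt_liminf hM
  rw [Filter.eventually_cofinite] at h1
  set F := {n : ℤ | ¬ ((c : EReal) < ((|(n : ℝ)| * distInt (n * α - γ) : ℝ) : EReal))} with hF
  -- The finitely many n violating the bound keep a positive distance from γ, since γ is not a
  -- lattice point. Vertices with height at most 2E_k eventually avoid them.
  have h2 : ∀ᶠ k in atTop, ∀ n ∈ F, 2 * cfE α k < distInt (n * α - γ) := by
    rw [Filter.eventually_all_finite h1]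
    intro n _
    have hp : 0 < distInt (n * α - γ) := by
      apply distInt_pos
      intro m hm
      exact hγ ⟨-m, n, by push_cast; linarith⟩
    have := (cfE_tendsto hα h3).const_mul 2
    rw [mul_zero] at this
    exact this.eventually_lt_const hp
  have key : ∀ k, (∀ n ∈ F, 2 * cfE α k < distInt (n * α - γ)) → ∀ i j X Z,
      GridPt α S T k i j X Z → |Z| ≤ 2 * cfE α k → c < |X * Z| := by
    intro k hk i j X Z hg hZ
    obtain ⟨i', j', h0⟩ := hc.gridPt_zero hα k i j hg
    obtain ⟨m, hX, hZ'⟩ := hr.exists_of_gridPt h0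
    have hd : distInt (i' * α - γ) ≤ |Z| := by rw [hZ']; exact distInt_le _ _
    have hn : i' ∉ F := by
      intro hi
      have := hk i' hi
      linarith
    rw [hF, Set.mem_ofPred_eq, not_not, EReal.coe_lt_coe_iff] at hn
    rw [abs_mul, hX]
    exact hn.trans_le (mul_le_mul_of_nonneg_left hd (abs_nonneg _))
  filter_upwards [h2] with k hk
  have hE := cfE_succ_lt hα k
  have hE0 := cfE_pos hα (k + 1)
  have hTk := abs_le.1 (hT k)
  have hpos := one_sub_cfX_mul_pos hα k
  constructor
  -- The coordinates (0, -1) and (-1, 0) give the two vertices whose products are `prodA` at (s, τ)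
  -- and at (-s, -τ).
  · have := key k hk 0 (-1) _ _ ⟨rfl, rfl⟩ (by rw [abs_le]; push_cast; constructor <;> linarith)
    rw [← vertex_prodA hα, abs_mul, abs_of_pos hpos]
    apply mul_lt_mul_of_pos_right _ hpos
    have e : ∀ u v : ℝ, |u / 2 * (v / 2)| = |u * v| / 4 := by
      intro u v
      rw [show u / 2 * (v / 2) = u * v / 4 by ring, abs_div]; norm_num
    rw [e, abs_mul, ← abs_neg (-T k + _ + _), ← abs_mul] at this
    push_cast at this
    ring_nf at this ⊢
    linarith
  · have := key k hk (-1) 0 _ _ ⟨rfl, rfl⟩ (by rw [abs_le]; push_cast; constructor <;> linarith)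
    have e3 := vertex_prodA hα (fun k => -S k) (fun k => -T k) k
    rw [nS_neg, nT_neg] at e3
    rw [← e3, abs_mul, abs_of_pos hpos]
    apply mul_lt_mul_of_pos_right _ hpos
    have e : ∀ u v : ℝ, |u / 2 * (v / 2)| = |u * v| / 4 := by
      intro u v
      rw [show u / 2 * (v / 2) = u * v / 4 by ring, abs_div]; norm_num
    rw [e, abs_mul, ← abs_neg (S k + _ + _), ← abs_mul] at this
    push_cast at this
    ring_nf at this ⊢
    linarith

/-- A chain of divided cells: each cell has one vertex in each quadrant. -/
structure DividedChain (α : ℝ) (t : ℕ → ℤ) (S T : ℕ → ℝ) : Prop extends CellChain α t S T where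
  S_zero : |S 0| = 1
  t_le : ∀ k, |t k| ≤ negCFDigit α k - 2
  t_lt : ∀ᶠ k in atTop, |t k| < negCFDigit α k - 2
  S_le : ∀ k, |S k| ≤ cfQ α (k + 1) - cfQ α k
  T_lt : ∀ k, |T k| < cfE α k - cfE α (k + 1)

lemma DividedChain.neg {α : ℝ} {t : ℕ → ℤ} {S T : ℕ → ℝ} (h : DividedChain α t S T) :
    DividedChain α (fun k => -t k) (fun k => -S k) (fun k => -T k) where
  S_succ k := by push_cast; linear_combination -h.S_succ k
  T_succ k := by push_cast; linear_combination -h.T_succ k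
  parity k := by
    have := h.parity k
    rw [Int.even_sub] at *
    simpa using this
  S_zero := by simpa using h.S_zero
  t_le := by simpa using h.t_le
  t_lt := by simpa using h.t_lt
  S_le := by simpa using h.S_le
  T_lt := by simpa using h.T_lt

lemma GridPt.neg {α : ℝ} {S T : ℕ → ℝ} {k : ℕ} {i j : ℤ} {X Z : ℝ}
    (hg : GridPt α S T k i j X Z) :
    GridPt α (fun k => -S k) (fun k => -T k) k (-i - 1) (-j - 1) (-X) (-Z) := by
  obtain ⟨h1, h2⟩ := hg
  constructor
  · rw [h1]; push_cast; ring
  · rw [h2]; push_cast; ring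

end

/-! ### Divided cells: vertex products bound M from below. -/

section

/-- These are the linear forms giving the coordinates of the origin in the k-th basis, so the origin
lies in the cell. The right-hand sides are the determinant of the basis. -/
lemma sub_lt_one_of_divided {α : ℝ} (hα : Irrational α) {t : ℕ → ℤ} {S T : ℕ → ℝ}
    (h : DividedChain α t S T) (k : ℕ) :
    cfQ α (k + 1) * |T k| + cfE α (k + 1) * |S k| < 1 ∧
    cfE α k * |S k| + cfQ α k * |T k| ≤ 1 := by
  have h1 := cf_det hα k
  have h2 := h.S_le k
  have h3 := h.T_lt k
  have h4 := cfQ_succ_pos hα k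
  have h5 := cfE_pos hα (k + 1)
  have h6 := cfE_pos hα k
  have h7 := cfQ_nonneg hα k
  constructor <;> nlinarith

/-- A divided chain does not belong to a lattice point. -/
lemma DividedChain.not_lattice {α γ : ℝ} (hα : Irrational α)
    (h3 : ∀ᶠ k in atTop, 3 ≤ negCFDigit α k) {t : ℕ → ℤ} {S T : ℕ → ℝ}
    (h : DividedChain α t S T) (hr : Represents α γ S T) : ¬ ∃ m n : ℤ, γ = m + n * α := by
  rintro ⟨m, n, hmn⟩
  obtain ⟨j0, hg0⟩ := hr.gridPt n (-m)
  have hZ : (n * α - γ - (-m : ℤ) : ℝ) = 0 := by rw [hmn]; push_cast; ring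
  rw [hZ] at hg0
  have hlim := (cfE_tendsto hα h3).const_mul (2 * |(n : ℝ)|)
  rw [mul_zero] at hlim
  -- A lattice point γ would give a grid point (n, 0). Once 2|n|E_k < 1 its coordinates lie in {0,
  -- -1}, so it is a vertex of the k-th cell; but a divided cell has no vertex on the axis Z = 0.
  obtain ⟨k, hk⟩ := (hlim.eventually_lt_const one_pos).exists
  obtain ⟨i, j, hg⟩ := h.toCellChain.gridPt_all hα hg0 k
  obtain ⟨d1, d2⟩ := hg.det hα
  obtain ⟨b1, b2⟩ := sub_lt_one_of_divided hα h k
  have hE := cfE_pos hα k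
  have hE' := cfE_pos hα (k + 1)
  have hEE := cfE_succ_lt hα k
  have hQ := cfQ_nonneg hα k
  have hQ' := cfQ_succ_pos hα k
  have hn := abs_nonneg (n : ℝ)
  obtain ⟨s1, s2⟩ := abs_le.1 (le_refl |S k|)
  obtain ⟨t1, t2⟩ := abs_le.1 (le_refl |T k|)
  obtain ⟨n1, n2⟩ := abs_le.1 (le_refl |(n : ℝ)|)
  have i1 : (2 * i + 1 : ℝ) < 3 := by
    rw [d1]
    nlinarith [mul_le_mul_of_nonneg_left s1 hE.le, mul_le_mul_of_nonneg_left t1 hQ,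
      mul_le_mul_of_nonneg_left n2 hE.le]
  have i2 : (-3 : ℝ) < 2 * i + 1 := by
    rw [d1]
    nlinarith [mul_le_mul_of_nonneg_left s2 hE.le, mul_le_mul_of_nonneg_left t2 hQ,
      mul_le_mul_of_nonneg_left n1 hE.le]
  have hk' : 2 * |(n : ℝ)| * cfE α (k + 1) < 1 := by nlinarith
  have j1 : (2 * j + 1 : ℝ) < 3 := by
    rw [d2]
    nlinarith [mul_le_mul_of_nonneg_left s2 hE'.le, mul_le_mul_of_nonneg_left t2 hQ'.le,
      mul_le_mul_of_nonneg_left n1 hE'.le]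
  have j2 : (-3 : ℝ) < 2 * j + 1 := by
    rw [d2]
    nlinarith [mul_le_mul_of_nonneg_left s1 hE'.le, mul_le_mul_of_nonneg_left t1 hQ'.le,
      mul_le_mul_of_nonneg_left n2 hE'.le]
  have i1' : 2 * i + 1 < 3 := by exact_mod_cast i1
  have i2' : -3 < 2 * i + 1 := by exact_mod_cast i2
  have j1' : 2 * j + 1 < 3 := by exact_mod_cast j1
  have j2' : -3 < 2 * j + 1 := by exact_mod_cast j2
  have hi : i = 0 ∨ i = -1 := by omega
  have hj : j = 0 ∨ j = -1 := by omega
  have hT := abs_lt.1 (h.T_lt k)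
  have hz := hg.2
  rcases hi with rfl | rfl <;> rcases hj with rfl | rfl <;> push_cast at hz <;> linarith

/-- The vertex products of all cells from `K` on are at least `c`. -/
def VertexBound (α : ℝ) (S T : ℕ → ℝ) (c : ℝ) (K : ℕ) : Prop :=
  ∀ k, K ≤ k →
    4 * c * (1 - cfX α k * negCFRem α k) ≤ prodA (cfX α k) (negCFRem α k) (nS α S k) (nT α T k) ∧
    4 * c * (1 - cfX α k * negCFRem α k) ≤ prodB (cfX α k) (negCFRem α k) (nS α S k) (nT α T k)

/-- Follow the coordinates (I_k, J_k) of a first-quadrant point through the bases, using I_{k+1} =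
-J_k - 1. At some k both are nonnegative, since otherwise q_{k+1}Z would stay bounded. There the
point dominates the upper right vertex of the cell in both coordinates. -/
lemma DividedChain.le_mul_of_pos {α c : ℝ} (hα : Irrational α) {t : ℕ → ℤ} {S T : ℕ → ℝ}
    (h : DividedChain α t S T) {K : ℕ} (hK : VertexBound α S T c K) {X Z : ℝ} {i j : ℤ}
    (hg : GridPt α S T 0 i j X Z) (hX : 1 < X) (hXK : |c| / cfE α K < X) (hZ : 0 < Z) :
    c ≤ X * Z := by
  choose I J hIJ using h.toCellChain.gridPt_all hα hg
  have hI : ∀ k, I (k + 1) = -J k - 1 := by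
    intro k
    obtain ⟨j', hj'⟩ := h.toCellChain.gridPt_succ hα (hIJ k)
    exact ((hIJ (k + 1)).unique hα hj').1
  have hI0 : 0 ≤ I 0 := by
    have h1 := (hIJ 0).1
    have h2 : S 0 ≤ 1 := (le_abs_self _).trans h.S_zero.le
    simp only [zero_add, cfQ_one, cfQ_zero] at h1
    have h3 : (-1 : ℝ) < I 0 := by linarith
    have : -1 < I 0 := by exact_mod_cast h3
    omega
  have hex : ∃ k, 0 ≤ I k ∧ 0 ≤ J k := by
    by_contra hcon
    push Not at hcon
    have hall : ∀ k, 0 ≤ I k := by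
      intro k
      induction k with
      | zero => exact hI0
      | succ k ih => have := hcon k ih; rw [hI]; omega
    obtain ⟨k, hk⟩ := exists_nat_gt (X / Z)
    rw [div_lt_iff₀ hZ] at hk
    have hj : J k ≤ -1 := by have := hcon k (hall k); omega
    have hj' : (J k : ℝ) ≤ -1 := by exact_mod_cast hj
    have d := ((hIJ k).det hα).2
    have b := (sub_lt_one_of_divided hα h k).1
    have hQ := (cfQ_growth hα k)
    have hE' := cfE_pos hα (k + 1)
    have hE1 : cfE α (k + 1) ≤ 1 := by
      have := cfE_antitone hα (Nat.zero_le (k + 1)); simpa using this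
    obtain ⟨s1, s2⟩ := abs_le.1 (le_refl |S k|)
    obtain ⟨t1, t2⟩ := abs_le.1 (le_refl |T k|)
    have m1 := mul_le_mul_of_nonneg_left s1 hE'.le
    have m2 := mul_le_mul_of_nonneg_left t1 (cfQ_succ_pos hα k).le
    have m3 : cfE α (k + 1) * X ≤ X := by nlinarith
    have m4 : k * Z ≤ cfQ α (k + 1) * Z := by nlinarith
    linarith
  obtain ⟨k, hi, hj⟩ := hex
  have hi' : (0 : ℝ) ≤ I k := by exact_mod_cast hi
  have hj' : (0 : ℝ) ≤ J k := by exact_mod_cast hj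
  obtain ⟨e1, e2⟩ := hIJ k
  have hQ := cfQ_nonneg hα k
  have hQ' := cfQ_succ_pos hα k
  have hE := cfE_pos hα k
  have hE' := cfE_pos hα (k + 1)
  have hS := abs_le.1 (h.S_le k)
  have hT := abs_lt.1 (h.T_lt k)
  have f1 : (cfQ α (k + 1) + cfQ α k + S k) / 2 ≤ X := by
    rw [e1]
    nlinarith [mul_nonneg hi' hQ'.le, mul_nonneg hj' hQ]
  have f2 : (cfE α k + cfE α (k + 1) - T k) / 2 ≤ Z := by
    rw [e2]
    nlinarith [mul_nonneg hi' hE'.le, mul_nonneg hj' hE.le]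
  rcases le_or_gt K k with hk | hk
  · have hb := (hK k hk).2
    rw [← vertex_prodB hα] at hb
    have := le_of_mul_le_mul_right hb (one_sub_cfX_mul_pos hα k)
    have : (cfQ α (k + 1) + cfQ α k + S k) / 2 * ((cfE α k + cfE α (k + 1) - T k) / 2) ≤ X * Z :=
      mul_le_mul f1 f2 (by linarith) (by linarith)
    linarith
  -- No vertex bound is available before K, but then Z ≥ E_K, and X > |c|/E_K suffices.
  · have hEK : cfE α K ≤ cfE α (k + 1) := cfE_antitone hα hk
    have hEK0 := cfE_pos hα K
    rw [div_lt_iff₀ hEK0] at hXK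
    have : cfE α K ≤ Z := by linarith
    nlinarith [le_abs_self c]

/-- The product of an increasing and a decreasing affine function is concave, hence at least c
between two points where it is. -/
lemma concave_segment {a b A B c μ : ℝ} (h0 : c ≤ a * b) (h1 : c ≤ (a + A) * (b - B))
    (hA : 0 ≤ A) (hB : 0 ≤ B) (hμ : 0 ≤ μ) (hμ1 : μ ≤ 1) :
    c ≤ (a + μ * A) * (b - μ * B) := by
  have e : (a + μ * A) * (b - μ * B) =
    (1 - μ) * (a * b) + μ * ((a + A) * (b - B)) + μ * (1 - μ) * (A * B) := by ring
  rw [e]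
  have := mul_nonneg (mul_nonneg hμ (sub_nonneg.2 hμ1)) (mul_nonneg hA hB)
  nlinarith [mul_le_mul_of_nonneg_left h0 (sub_nonneg.2 hμ1), mul_le_mul_of_nonneg_left h1 hμ]

/-- The lower right vertex of the `k`-th cell, with the sign of the second coordinate changed. -/
def lowerVertex (α : ℝ) (S T : ℕ → ℝ) (k : ℕ) : ℝ × ℝ :=
  ((cfQ α (k + 1) - cfQ α k + S k) / 2, (cfE α k - cfE α (k + 1) + T k) / 2)

/-- Successive lower right vertices differ by a nonnegative multiple of v_{k+1}, so they trace a
polygonal path through the fourth quadrant. -/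
lemma lowerVertex_succ {α : ℝ} (hα : Irrational α) {t : ℕ → ℤ} {S T : ℕ → ℝ}
    (h : CellChain α t S T) (k : ℕ) :
    (lowerVertex α S T (k + 1)).1 =
      (lowerVertex α S T k).1 + (t k + negCFDigit α k - 2) / 2 * cfQ α (k + 1) ∧
    (lowerVertex α S T (k + 1)).2 =
      (lowerVertex α S T k).2 - (t k + negCFDigit α k - 2) / 2 * cfE α (k + 1) := by
  simp only [lowerVertex]
  rw [show k + 1 + 1 = k + 2 from rfl, cfQ_rec, cfE_rec hα, h.S_succ, h.T_succ k]
  constructor <;> ring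

lemma DividedChain.step_nonneg {α : ℝ} {t : ℕ → ℤ} {S T : ℕ → ℝ}
    (h : DividedChain α t S T) (k : ℕ) : (0 : ℝ) ≤ (t k + negCFDigit α k - 2) / 2 := by
  have := (abs_le.1 (h.t_le k)).1
  have : (-(negCFDigit α k - 2 : ℤ) : ℝ) ≤ t k := by exact_mod_cast this
  push_cast at this
  linarith

/-- This is where the strict bound |t_k| < a_k - 2 is needed: it makes each late step at least
v_{k+1}/2. -/
lemma DividedChain.lowerVertex_unbounded {α : ℝ} (hα : Irrational α) {t : ℕ → ℤ} {S T : ℕ → ℝ}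
    (h : DividedChain α t S T) (X : ℝ) : ∃ k, X < (lowerVertex α S T k).1 := by
  obtain ⟨N, hN⟩ := eventually_atTop.1 h.t_lt
  have key : ∀ i : ℕ, (lowerVertex α S T N).1 + i / 2 ≤ (lowerVertex α S T (N + i)).1 := by
    intro i
    induction i with
    | zero => simp
    | succ i ih =>
      rw [← add_assoc, (lowerVertex_succ hα h.toCellChain _).1]
      have h1 := (abs_lt.1 (hN (N + i) (by omega))).1
      have h2 : -(negCFDigit α (N + i) - 2) + 1 ≤ t (N + i) := h1
      have h3 : (-(negCFDigit α (N + i) - 2 : ℤ) + 1 : ℝ) ≤ t (N + i) := by exact_mod_cast h2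
      have h4 := cfQ_growth hα (N + i)
      have h5 := cfQ_nonneg hα (N + i)
      push_cast at h3 ⊢
      nlinarith
  obtain ⟨i, hi⟩ := exists_nat_gt (2 * (X - (lowerVertex α S T N).1))
  exact ⟨N + i, by linarith [key i]⟩

/-- If j were nonnegative, Z ≤ 0 would require i + 1 + j < 0 because E_{k+1} < E_k; since q_k <
q_{k+1}, this would make X negative. -/
lemma DividedChain.lower_quadrant {α : ℝ} (hα : Irrational α) {t : ℕ → ℤ} {S T : ℕ → ℝ}
    (h : DividedChain α t S T) {k : ℕ} {X Z : ℝ} {i j : ℤ}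
    (hg : GridPt α S T k i j X Z) (hX : 0 < X) (hZ : Z ≤ 0) : j ≤ -1 := by
  by_contra hj
  have hj0 : 0 ≤ j := by omega
  have hj' : (0 : ℝ) ≤ j := by exact_mod_cast hj0
  obtain ⟨e1, e2⟩ := hg
  have hQ := cfQ_nonneg hα k
  have hQ' := cfQ_succ_pos hα k
  have hE := cfE_pos hα k
  have hE' := cfE_pos hα (k + 1)
  have hS := abs_le.1 (h.S_le k)
  have hT := abs_lt.1 (h.T_lt k)
  have hQQ := (cfQ_growth hα k).2
  have hEE := cfE_succ_lt hα k
  have a1 : 0 < (i + 1) * cfQ α (k + 1) + j * cfQ α k := by linarith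
  have a2 : (i + 1) * cfE α (k + 1) + j * cfE α k < 0 := by linarith
  have a3 : (i + 1 + j : ℝ) < 0 := by
    by_contra hc
    push Not at hc
    have := mul_nonneg hc hE'.le
    nlinarith
  have := mul_neg_of_neg_of_pos a3 hQ'
  nlinarith

/-- A fourth-quadrant point lies on or beyond the polygonal path of lower right vertices. On each
side of the path the product is concave, so the bounds at its two end vertices suffice. -/
lemma DividedChain.le_mul_of_nonpos {α c : ℝ} (hα : Irrational α) {t : ℕ → ℤ} {S T : ℕ → ℝ}
    (h : DividedChain α t S T) {K : ℕ} (hK : VertexBound α S T c K) {X Z : ℝ} {i j : ℤ}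
    (hg : GridPt α S T 0 i j X Z) (hX : 0 < X) (hXK : (lowerVertex α S T K).1 ≤ X) (hZ : Z ≤ 0) :
    c ≤ X * (-Z) := by
  have hmono : Monotone fun k => (lowerVertex α S T k).1 := by
    apply monotone_nat_of_le_succ
    intro k
    rw [(lowerVertex_succ hα h.toCellChain _).1]
    nlinarith [h.step_nonneg k, cfQ_succ_pos hα k]
  have hex := h.lowerVertex_unbounded hα X
  classical
  obtain ⟨k, hkX, hKk, hkX'⟩ : ∃ k, (lowerVertex α S T k).1 ≤ X ∧ K ≤ k ∧
      X < (lowerVertex α S T (k + 1)).1 := by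
    have hf := Nat.find_spec hex
    have hlt : K < Nat.find hex := by
      by_contra hc
      push Not at hc
      have : (lowerVertex α S T (Nat.find hex)).1 ≤ (lowerVertex α S T K).1 := hmono hc
      linarith
    obtain ⟨k, hk⟩ : ∃ k, Nat.find hex = k + 1 := ⟨Nat.find hex - 1, by omega⟩
    refine ⟨k, ?_, by omega, hk ▸ hf⟩
    have := Nat.find_min hex (m := k) (by omega)
    linarith
  obtain ⟨i', j', hg'⟩ := h.toCellChain.gridPt_all hα hg k
  have hj := h.lower_quadrant hα hg' hX hZ
  have hj' : (j' : ℝ) ≤ -1 := by exact_mod_cast hj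
  have d := (hg'.det hα).2
  have hdet := cf_det hα k
  have hQ' := cfQ_succ_pos hα k
  have hE' := cfE_pos hα (k + 1)
  have hprod : ∀ k, K ≤ k → c ≤ (lowerVertex α S T k).1 * (lowerVertex α S T k).2 := by
    intro k hk
    have hb := (hK k hk).1
    rw [← vertex_prodA hα] at hb
    have := le_of_mul_le_mul_right hb (one_sub_cfX_mul_pos hα k)
    simp only [lowerVertex]
    linarith
  have p0 := hprod k hKk
  have p1 := hprod (k + 1) (by omega)
  obtain ⟨s1, s2⟩ := lowerVertex_succ hα h.toCellChain k
  set u := (t k + negCFDigit α k - 2 : ℝ) / 2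
  rw [s1, s2] at p1
  rw [s1] at hkX'
  have hu : 0 < u * cfQ α (k + 1) := by linarith
  have hu0 : 0 < u := pos_of_mul_pos_left hu hQ'.le
  set μ := (X - (lowerVertex α S T k).1) / (u * cfQ α (k + 1)) with hμ
  have hμ0 : 0 ≤ μ := div_nonneg (by linarith) hu.le
  have hμ1 : μ ≤ 1 := by rw [hμ, div_le_one hu]; linarith
  have hμe : μ * (u * cfQ α (k + 1)) = X - (lowerVertex α S T k).1 := by
    rw [hμ]; field_simp
  have key := concave_segment p0 p1 hu.le (mul_pos hu0 hE').le hμ0 hμ1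
  have eX : (lowerVertex α S T k).1 + μ * (u * cfQ α (k + 1)) = X := by rw [hμe]; ring
  rw [eX] at key
  refine key.trans (mul_le_mul_of_nonneg_left ?_ hX.le)
  -- The coordinate bound j ≤ -1 says that the point is on the far side of the line through the
  -- lower right vertex in direction v_{k+1}.
  have hline : cfQ α (k + 1) * (Z + (lowerVertex α S T k).2) ≤
      cfE α (k + 1) * (X - (lowerVertex α S T k).1) := by
    simp only [lowerVertex]
    linarith
  rw [← hμe] at hline
  have : cfQ α (k + 1) * (Z + (lowerVertex α S T k).2) ≤
    cfQ α (k + 1) * (μ * (u * cfE α (k + 1))) := by linarith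
  have := le_of_mul_le_mul_left this hQ'
  linarith

lemma DividedChain.exists_le_mul {α c : ℝ} (hα : Irrational α) {t : ℕ → ℤ} {S T : ℕ → ℝ}
    (h : DividedChain α t S T) {K : ℕ} (hK : VertexBound α S T c K) :
    ∃ N : ℝ, ∀ (X Z : ℝ) (i j : ℤ), GridPt α S T 0 i j X Z → N < X → c ≤ X * |Z| := by
  refine ⟨max 1 (max (|c| / cfE α K) (lowerVertex α S T K).1), fun X Z i j hg hN => ?_⟩
  obtain ⟨h1, h2⟩ := max_lt_iff.1 hN
  obtain ⟨h2, h3⟩ := max_lt_iff.1 h2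
  rcases le_or_gt Z 0 with hZ | hZ
  · rw [abs_of_nonpos hZ]
    exact h.le_mul_of_nonpos hα hK hg (by linarith) h3.le hZ
  · rw [abs_of_pos hZ]
    exact h.le_mul_of_pos hα hK hg h1 h2 hZ

/-- If the vertex products of a divided chain for `γ` are eventually at least `c`, then
`c ≤ M(α, γ)`. -/
lemma DividedChain.le_M {α γ c : ℝ} (hα : Irrational α) {t : ℕ → ℤ} {S T : ℕ → ℝ}
    (h : DividedChain α t S T) (hr : Represents α γ S T) {K : ℕ} (hK : VertexBound α S T c K)
    (hK' : VertexBound α (fun k => -S k) (fun k => -T k) c K) :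
    (c : EReal) ≤ M α γ := by
  obtain ⟨N, hN⟩ := h.exists_le_mul hα hK
  obtain ⟨N', hN'⟩ := h.neg.exists_le_mul hα hK'
  apply Filter.le_liminf_of_le
  · isBoundedDefault
  rw [Filter.eventually_cofinite]
  refine (Set.finite_Icc (-⌈N'⌉) ⌈N⌉).subset ?_
  intro n hn
  by_contra hout
  apply hn
  rw [EReal.coe_le_coe_iff]
  obtain ⟨j, hg⟩ := hr.gridPt n (round (n * α - γ))
  rw [Set.mem_Icc, not_and_or, not_le, not_le] at hout
  rcases hout with hout | hout
  · have h1 : (n : ℝ) < ((-⌈N'⌉ : ℤ) : ℝ) := by exact_mod_cast hout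
    push_cast at h1
    have h2 : N' < -(n : ℝ) := by linarith [Int.le_ceil N']
    have := hN' _ _ _ _ hg.neg h2
    rw [abs_neg] at this
    refine this.trans (mul_le_mul_of_nonneg_right (neg_le_abs _) (abs_nonneg _))
  · have h1 : (⌈N⌉ : ℝ) < n := by exact_mod_cast hout
    have h2 : N < n := (Int.le_ceil N).trans_lt h1
    exact (hN _ _ _ _ hg h2).trans (mul_le_mul_of_nonneg_right (le_abs_self _) (abs_nonneg _))

end

/-! ### Chains from the greedy expansion of γ and from prescribed digits. -/

section

/-- A chain of cells in which centres and digits have a size comparable to that of the cells. -/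
structure BoundedChain (α : ℝ) (t : ℕ → ℤ) (S T : ℕ → ℝ) : Prop extends CellChain α t S T where
  t_le : ∀ k, |t k| ≤ negCFDigit α k
  S_ge : ∀ k, -(cfQ α (k + 1) - cfQ α k) ≤ S k
  S_le : ∀ k, S k ≤ cfQ α (k + 1) + cfQ α k
  T_ge : ∀ k, -(cfE α k - cfE α (k + 1)) ≤ T k
  T_le : ∀ k, T k ≤ cfE α k + cfE α (k + 1)

lemma DividedChain.boundedChain {α : ℝ} (hα : Irrational α) {t : ℕ → ℤ} {S T : ℕ → ℝ}
    (h : DividedChain α t S T) : BoundedChain α t S T where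
  toCellChain := h.toCellChain
  t_le k := (h.t_le k).trans (by omega)
  S_ge k := (abs_le.1 (h.S_le k)).1
  S_le k := (abs_le.1 (h.S_le k)).2.trans (by linarith [cfQ_nonneg hα k])
  T_ge k := (abs_lt.1 (h.T_lt k)).1.le
  T_le k := (abs_lt.1 (h.T_lt k)).2.le.trans (by linarith [cfE_pos hα (k + 1)])

/-- The remainders of the greedy expansion of `γ` in the `E_k`. -/
def greedyRem (α γ : ℝ) : ℕ → ℝ
  | 0 => Int.fract γ
  | k + 1 => Int.fract (greedyRem α γ k / negCFRem α k)

/-- The digits of the greedy expansion of `γ`. -/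
def greedyDigit (α γ : ℝ) (k : ℕ) : ℤ := ⌊greedyRem α γ k / negCFRem α k⌋

/-- The integers with the same digits in the denominators. -/
def greedyInt (α γ : ℝ) : ℕ → ℝ
  | 0 => 0
  | k + 1 => greedyInt α γ k + greedyDigit α γ k * cfQ α (k + 1)

lemma greedyRem_mem (α γ : ℝ) (k : ℕ) : 0 ≤ greedyRem α γ k ∧ greedyRem α γ k < 1 := by
  cases k <;> exact ⟨Int.fract_nonneg _, Int.fract_lt_one _⟩

lemma greedyRem_eq {α : ℝ} (hα : Irrational α) (γ : ℝ) (k : ℕ) :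
    greedyRem α γ k = negCFRem α k * (greedyDigit α γ k + greedyRem α γ (k + 1)) := by
  have h : (greedyDigit α γ k : ℝ) + greedyRem α γ (k + 1) = greedyRem α γ k / negCFRem α k :=
    Int.floor_add_fract _
  rw [h]
  have := (negCFRem_pos hα k).ne'
  field_simp

lemma greedyDigit_nonneg {α : ℝ} (hα : Irrational α) (γ : ℝ) (k : ℕ) : 0 ≤ greedyDigit α γ k :=
  Int.floor_nonneg.2 (div_nonneg (greedyRem_mem α γ k).1 (negCFRem_pos hα k).le)

lemma greedyDigit_le {α : ℝ} (hα : Irrational α) (γ : ℝ) (k : ℕ) :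
    greedyDigit α γ k ≤ negCFDigit α k - 1 := by
  have h1 := greedyRem_eq hα γ k
  have h2 := negCFRem_mul hα k
  have h3 := (greedyRem_mem α γ k).2
  have h4 := (greedyRem_mem α γ (k + 1)).1
  have h5 := negCFRem_pos hα (k + 1)
  have h6 := negCFRem_pos hα k
  have : (greedyDigit α γ k : ℝ) < negCFDigit α k := by
    by_contra hc
    push Not at hc
    nlinarith
  have : greedyDigit α γ k < negCFDigit α k := by exact_mod_cast this
  omega

lemma greedyInt_nonneg {α : ℝ} (hα : Irrational α) (γ : ℝ) (k : ℕ) : 0 ≤ greedyInt α γ k := by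
  induction k with
  | zero => exact le_rfl
  | succ k ih =>
    have : (0 : ℝ) ≤ greedyDigit α γ k := by exact_mod_cast greedyDigit_nonneg hα γ k
    exact add_nonneg ih (mul_nonneg this (cfQ_succ_pos hα k).le)

/-- The second clause is the Ostrowski-type admissibility that makes the induction close: a digit
a_k - 1 forces the remainder above 1 - α_k, hence forces the preceding integer below q_{k+1} - q_k.
Only then is the new integer below q_{k+2}. -/
lemma greedyInt_lt {α : ℝ} (hα : Irrational α) (γ : ℝ) (k : ℕ) :
    greedyInt α γ k < cfQ α (k + 1) ∧
    (cfQ α (k + 1) - cfQ α k ≤ greedyInt α γ k → greedyRem α γ k < 1 - negCFRem α k) := by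
  induction k with
  | zero => simp [greedyInt]
  | succ k ih =>
    obtain ⟨h1, h2⟩ := ih
    have hg := greedyRem_eq hα γ k
    have hm := negCFRem_mul hα k
    have hy := negCFRem_pos hα k
    have hq := cfQ_growth hα k
    have hq0 := cfQ_succ_pos hα k
    have e : greedyInt α γ (k + 1) = greedyInt α γ k + greedyDigit α γ k * cfQ α (k + 1) := rfl
    have eq : cfQ α (k + 1 + 1) = negCFDigit α k * cfQ α (k + 1) - cfQ α k := rfl
    rcases (greedyDigit_le hα γ k).lt_or_eq with hb | hb
    · have hb1 : greedyDigit α γ k ≤ negCFDigit α k - 2 := by omega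
      have hb2 : (greedyDigit α γ k : ℝ) ≤ negCFDigit α k - 2 := by exact_mod_cast hb1
      have hb3 := mul_le_mul_of_nonneg_right hb2 hq0.le
      refine ⟨by rw [e, eq]; linarith, fun hge => ?_⟩
      rw [e, eq] at hge
      have h4 := h2 (by linarith)
      rcases hb1.lt_or_eq with hb4 | hb4
      · exfalso
        have hb5 : greedyDigit α γ k ≤ negCFDigit α k - 3 := by omega
        have hb6 : (greedyDigit α γ k : ℝ) ≤ negCFDigit α k - 3 := by exact_mod_cast hb5
        have hb7 := mul_le_mul_of_nonneg_right hb6 hq0.le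
        linarith [cfQ_nonneg hα k]
      · have hb5 : (greedyDigit α γ k : ℝ) = negCFDigit α k - 2 := by exact_mod_cast hb4
        rw [hb5] at hg
        by_contra hc
        push Not at hc
        nlinarith
    · have hb1 : (greedyDigit α γ k : ℝ) = negCFDigit α k - 1 := by exact_mod_cast hb
      rw [hb1] at hg
      have h5 := (greedyRem_mem α γ (k + 1)).1
      have h6 := (greedyRem_mem α γ k).2
      have h7 := negCFRem_pos hα (k + 1)
      have h8 : greedyInt α γ k < cfQ α (k + 1) - cfQ α k := by
        by_contra hc
        push Not at hc
        have := h2 hc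
        nlinarith
      refine ⟨by rw [e, eq, hb1]; linarith, fun _ => ?_⟩
      by_contra hc
      push Not at hc
      nlinarith

/-- Every `γ` has a bounded chain of cells. -/
lemma exists_boundedChain {α : ℝ} (hα : Irrational α) (γ : ℝ) :
    ∃ t S T, BoundedChain α t S T ∧ Represents α γ S T := by
  -- The centres are chosen so that the lower right vertex of the k-th cell has X equal to the
  -- greedy integer and -Z equal to the greedy remainder times E_k.
  refine ⟨fun k => 2 * greedyDigit α γ k - negCFDigit α k + 2,
    fun k => 2 * greedyInt α γ k - cfQ α (k + 1) + cfQ α k,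
    fun k => (2 * greedyRem α γ k - 1 + negCFRem α k) * cfE α k, ⟨⟨?_, ?_, ?_⟩, ?_, ?_, ?_, ?_, ?_⟩,
    ?_, ?_⟩
  · intro k
    rw [show k + 1 + 1 = k + 2 from rfl, cfQ_rec, greedyInt]
    push_cast; ring
  · intro k
    have h1 := greedyRem_eq hα γ k
    have h2 := negCFRem_mul hα k
    rw [cfE_succ]
    push_cast
    linear_combination 2 * cfE α k * h1 + cfE α k * h2
  · intro k
    exact ⟨negCFDigit α k - greedyDigit α γ k - 1, by ring⟩
  · intro k
    have h1 := greedyDigit_le hα γ k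
    have h2 := greedyDigit_nonneg hα γ k
    have h3 := two_le_negCFDigit hα k
    rw [abs_le]
    constructor <;> linarith
  · intro k
    have := greedyInt_nonneg hα γ k
    linarith
  · intro k
    have := (greedyInt_lt hα γ k).1
    linarith
  · intro k
    have h1 := (greedyRem_mem α γ k).1
    have h2 := cfE_pos hα k
    rw [cfE_succ]
    nlinarith [mul_nonneg h1 h2.le]
  · intro k
    have h1 := (greedyRem_mem α γ k).2
    have h2 := cfE_pos hα k
    rw [cfE_succ]
    nlinarith [mul_pos (sub_pos.2 h1) h2]
  · simp [greedyInt]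
  · refine ⟨⌊γ⌋, ?_⟩
    have : negCFRem α 0 = Int.fract α := rfl
    rw [cfE_zero, this, show greedyRem α γ 0 = Int.fract γ from rfl]
    linarith [Int.floor_add_fract γ]

/-- The series telescopes: (a_k - 2)E_{k+1} = (E_k - E_{k+1}) - (E_{k+1} - E_{k+2}). -/
lemma hasSum_digit {α : ℝ} (hα : Irrational α) (h3 : ∀ᶠ k in atTop, 3 ≤ negCFDigit α k) (k : ℕ) :
    HasSum (fun i => ((negCFDigit α (k + i) : ℝ) - 2) * cfE α (k + i + 1))
      (cfE α k - cfE α (k + 1)) := by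
  rw [hasSum_iff_tendsto_nat_of_nonneg]
  · have h1 : ∀ n, ∑ i ∈ Finset.range n, ((negCFDigit α (k + i) : ℝ) - 2) * cfE α (k + i + 1) =
        (cfE α k - cfE α (k + 1)) - (cfE α (n + k) - cfE α (n + (k + 1))) := by
      intro n
      induction n with
      | zero => simp
      | succ n ih =>
        rw [Finset.sum_range_succ, ih]
        have := cfE_rec hα (k + n)
        rw [show n + 1 + (k + 1) = k + n + 2 by ring, show n + 1 + k = k + n + 1 by ring,
          show n + (k + 1) = k + n + 1 by ring, show n + k = k + n by ring, this]
        ring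
    simp only [h1]
    have e := cfE_tendsto hα h3
    have := ((tendsto_add_atTop_iff_nat k).2 e).sub ((tendsto_add_atTop_iff_nat (k + 1)).2 e)
    have := this.const_sub (cfE α k - cfE α (k + 1))
    simpa using this
  · intro i
    exact mul_nonneg (by linarith [two_le_negCFDigit_real hα (k + i)]) (cfE_pos hα _).le

/-- The sums `∑_{i ≥ k} t_i E_{i+1}`. -/
def tailSum (α : ℝ) (t : ℕ → ℤ) (k : ℕ) : ℝ := ∑' i, (t (k + i) : ℝ) * cfE α (k + i + 1)

/-- The sums `-1 + ∑_{i < k} t_i q_{i+1}`. -/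
def headSum (α : ℝ) (t : ℕ → ℤ) (k : ℕ) : ℝ :=
  -1 + ∑ i ∈ Finset.range k, (t i : ℝ) * cfQ α (i + 1)

lemma norm_digit_le {α : ℝ} (hα : Irrational α) {t : ℕ → ℤ}
    (ht : ∀ k, |t k| ≤ negCFDigit α k - 2) (k : ℕ) :
    ‖(t k : ℝ) * cfE α (k + 1)‖ ≤ ((negCFDigit α k : ℝ) - 2) * cfE α (k + 1) := by
  rw [Real.norm_eq_abs, abs_mul, abs_of_pos (cfE_pos hα _)]
  refine mul_le_mul_of_nonneg_right ?_ (cfE_pos hα _).le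
  exact_mod_cast ht k

lemma summable_digit {α : ℝ} (hα : Irrational α) (h3 : ∀ᶠ k in atTop, 3 ≤ negCFDigit α k)
    {t : ℕ → ℤ} (ht : ∀ k, |t k| ≤ negCFDigit α k - 2) (k : ℕ) :
    Summable fun i => (t (k + i) : ℝ) * cfE α (k + i + 1) :=
  Summable.of_norm_bounded (hasSum_digit hα h3 k).summable fun _ => norm_digit_le hα ht _

lemma abs_tailSum_le {α : ℝ} (hα : Irrational α) (h3 : ∀ᶠ k in atTop, 3 ≤ negCFDigit α k)
    {t : ℕ → ℤ} (ht : ∀ k, |t k| ≤ negCFDigit α k - 2) (k : ℕ) :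
    |tailSum α t k| ≤ cfE α k - cfE α (k + 1) :=
  tsum_of_norm_bounded (hasSum_digit hα h3 k) fun _ => norm_digit_le hα ht _

lemma tailSum_succ {α : ℝ} (hα : Irrational α) (h3 : ∀ᶠ k in atTop, 3 ≤ negCFDigit α k)
    {t : ℕ → ℤ} (ht : ∀ k, |t k| ≤ negCFDigit α k - 2) (k : ℕ) :
    tailSum α t k = t k * cfE α (k + 1) + tailSum α t (k + 1) := by
  unfold tailSum
  rw [(summable_digit hα h3 ht k).tsum_eq_zero_add]
  simp only [add_zero]
  congr 2
  funext i
  rw [show k + (i + 1) = k + 1 + i by ring]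

/-- The extreme digits ±(a_k - 2) telescope to ±(q_{k+1} - q_k) and ±(E_k - E_{k+1}), so digits of
this size keep every cell divided. -/
lemma dividedChain_of_digits {α : ℝ} (hα : Irrational α) (h3 : ∀ᶠ k in atTop, 3 ≤ negCFDigit α k)
    {t : ℕ → ℤ} (ht : ∀ k, |t k| ≤ negCFDigit α k - 2)
    (ht' : ∀ᶠ k in atTop, |t k| < negCFDigit α k - 2)
    (hp : ∀ k, Even (negCFDigit α k - t k)) :
    DividedChain α t (headSum α t) (tailSum α t) where
  S_succ k := by simp [headSum, Finset.sum_range_succ, add_assoc]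
  T_succ := tailSum_succ hα h3 ht
  parity := hp
  S_zero := by simp [headSum]
  t_le := ht
  t_lt := ht'
  S_le k := by
    have key : ∀ k, |headSum α t k| ≤ cfQ α (k + 1) - cfQ α k := by
      intro k
      induction k with
      | zero => simp [headSum]
      | succ k ih =>
        have e : headSum α t (k + 1) = headSum α t k + t k * cfQ α (k + 1) := by
          simp [headSum, Finset.sum_range_succ, add_assoc]
        rw [e, show k + 1 + 1 = k + 2 from rfl, cfQ_rec]
        have h1 := abs_add_le (headSum α t k) (t k * cfQ α (k + 1))
        have h2 : |(t k : ℝ)| ≤ (negCFDigit α k : ℝ) - 2 := by exact_mod_cast ht k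
        rw [abs_mul, abs_of_pos (cfQ_succ_pos hα k)] at h1
        have := mul_le_mul_of_nonneg_right h2 (cfQ_succ_pos hα k).le
        linarith
    exact key k
  T_lt k := by
    have step : ∀ k, |t k| * cfE α (k + 1) + |tailSum α t (k + 1)| <
        ((negCFDigit α k : ℝ) - 2) * cfE α (k + 1) + (cfE α (k + 1) - cfE α (k + 2)) →
        |tailSum α t k| < cfE α k - cfE α (k + 1) := by
      intro k hk
      rw [tailSum_succ hα h3 ht k]
      have h1 := abs_add_le (t k * cfE α (k + 1)) (tailSum α t (k + 1))
      rw [abs_mul, abs_of_pos (cfE_pos hα (k + 1))] at h1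
      have := cfE_rec hα k
      push_cast at hk
      linarith
    -- One strict digit inequality far out makes the bound for T strict there, and strictness passes
    -- back to all smaller indices.
    have down : ∀ n k, |tailSum α t (k + n)| < cfE α (k + n) - cfE α (k + n + 1) →
        |tailSum α t k| < cfE α k - cfE α (k + 1) := by
      intro n
      induction n with
      | zero => intro k hk; exact hk
      | succ n ih =>
        intro k hk
        apply step
        have h1 := ih (k + 1) (by rw [show k + 1 + n = k + (n + 1) by ring]; exact hk)
        have h2 : |(t k : ℝ)| ≤ (negCFDigit α k : ℝ) - 2 := by exact_mod_cast ht k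
        have := mul_le_mul_of_nonneg_right h2 (cfE_pos hα (k + 1)).le
        push_cast
        linarith
    obtain ⟨N, hN⟩ := eventually_atTop.1 ht'
    refine down N k (step _ ?_)
    have h1 : |(t (k + N) : ℝ)| < (negCFDigit α (k + N) : ℝ) - 2 := by
      exact_mod_cast hN (k + N) (by omega)
    have := mul_lt_mul_of_pos_right h1 (cfE_pos hα (k + N + 1))
    have := abs_tailSum_le hα h3 ht (k + N + 1)
    push_cast
    rw [show k + N + 2 = k + N + 1 + 1 from rfl]
    linarith

lemma represents_of_digits (α : ℝ) (t : ℕ → ℤ) :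
    Represents α ((1 - Int.fract α) / 2 + tailSum α t 0 / 2) (headSum α t) (tailSum α t) where
  S_zero := by simp [headSum]
  value := ⟨0, by simp⟩

lemma abs_tStar_le (α : ℝ) (k : ℕ) : |tStar α k| ≤ 1 := by
  unfold tStar
  split_ifs <;> simp [abs_pow]

lemma even_sub_tStar (α : ℝ) (k : ℕ) : Even (negCFDigit α k - tStar α k) := by
  unfold tStar
  split_ifs with h
  · simpa using h
  · rw [Int.even_sub]
    have : ¬ Even ((-1 : ℤ) ^ (oddCount α k + 1)) := by
      rw [Int.even_pow]; simp
    tauto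

lemma abs_le_sub_two_of_parity {a t : ℤ} (ha : 2 ≤ a) (ht : |t| ≤ 1) (hp : Even (a - t)) :
    |t| ≤ a - 2 := by
  obtain ⟨b, hb⟩ := hp
  rw [abs_le] at *
  omega

/-- The part of the series with a_i - 2 telescopes to 1 - α_0, which shows that γ* is represented by
the chain with digits t_i. -/
lemma gammaStar_eq {α : ℝ} (hα : Irrational α) (h3 : ∀ᶠ k in atTop, 3 ≤ negCFDigit α k) :
    gammaStar α = (1 - Int.fract α) / 2 + tailSum α (tStar α) 0 / 2 := by
  have ht : ∀ k, |tStar α k| ≤ negCFDigit α k - 2 := fun k =>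
    abs_le_sub_two_of_parity (two_le_negCFDigit hα k) (abs_tStar_le α k) (even_sub_tStar α k)
  have h1 := (hasSum_digit hα h3 0)
  have h2 := (summable_digit hα h3 ht 0).hasSum
  have h4 := (h1.add h2).mul_left (1 / 2)
  have e : gammaStar α = ∑' i, 1 / 2 * (((negCFDigit α (0 + i) : ℝ) - 2) * cfE α (0 + i + 1) +
      (tStar α (0 + i) : ℝ) * cfE α (0 + i + 1)) := by
    unfold gammaStar
    congr 1
    funext i
    rw [zero_add, show negCFD α i = cfE α (i + 1) from rfl]
    ring
  rw [e, h4.tsum_eq, cfE_succ, cfE_zero, show negCFRem α 0 = Int.fract α from rfl]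
  unfold tailSum
  ring

end

/-! ### Constants at R, and bi-infinite limit systems. -/

section

/-- The numbers attached to `R`: `β`, `δ`, and `m = 4 C₁(R)`. -/
structure IsBeta (R : ℤ) (β δ m : ℝ) : Prop where
  pos : 0 < β
  -- The extreme case is R = 5, where β = 3 - 2√2; all numerical estimates below rest on this bound.
  le : β ≤ 0.1716
  beta_eq : β * (R + 1 - β) = 1
  delta_eq : δ * (1 - β) = β
  m_eq : m * (1 + β) * (1 - β - β ^ 2) = (1 - 2 * β - β ^ 2) * (1 - β)

namespace IsBeta

variable {R : ℤ} {β δ m : ℝ}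

lemma delta_mul (h : IsBeta R β δ m) : δ * (R - β) = 1 := by
  have h1 := h.delta_eq
  have h2 := h.beta_eq
  have h3 := h.pos
  have : δ * (R - β) * β = 1 * β := by linear_combination δ * h2 + h1
  exact mul_right_cancel₀ h3.ne' this

lemma R_ge (h : IsBeta R β δ m) : 5 ≤ R := by
  have h2 := h.beta_eq
  have h3 := h.pos
  have h4 := h.le
  have : (4 : ℝ) < R := by
    by_contra hc
    push Not at hc
    nlinarith
  have : 4 < R := by exact_mod_cast this
  omega

lemma beta_lt_delta (h : IsBeta R β δ m) : β < δ := by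
  have h1 := h.delta_eq
  have h3 := h.pos
  have h4 := h.le
  have : 0 < δ := by
    by_contra hc
    push Not at hc
    nlinarith
  nlinarith

lemma delta_le (h : IsBeta R β δ m) : δ ≤ 0.2072 := by
  have h1 := h.delta_eq
  have h3 := h.pos
  have h4 := h.le
  nlinarith

/-- This evaluates the threshold m(1 - xy) at the two cells adjacent to R, where x and y are β and δ
in some order. -/
lemma mu_eq (h : IsBeta R β δ m) : m * (1 - δ * β) * (1 + β) = 1 - 2 * β - β ^ 2 := by
  have h1 := h.delta_eq
  have h2 := h.m_eq
  have h4 := h.le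
  have : m * (1 - δ * β) * (1 + β) * (1 - β) = (1 - 2 * β - β ^ 2) * (1 - β) := by
    linear_combination h2 - m * (1 + β) * β * h1
  exact mul_right_cancel₀ (by linarith) this

lemma m_pos (h : IsBeta R β δ m) : 0 < m := by
  have h2 := h.m_eq
  have h3 := h.pos
  have h4 := h.le
  have a1 : 0 < 1 - β - β ^ 2 := by nlinarith
  have a2 : 0 < (1 - 2 * β - β ^ 2) * (1 - β) := by
    apply mul_pos <;> nlinarith
  by_contra hc
  push Not at hc
  have : m * (1 + β) * (1 - β - β ^ 2) ≤ 0 :=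
    mul_nonpos_of_nonpos_of_nonneg (mul_nonpos_of_nonpos_of_nonneg hc (by linarith)) a1.le
  linarith

lemma m_lt_one_sub (h : IsBeta R β δ m) : m < 1 - β := by
  have h2 := h.m_eq
  have h3 := h.pos
  have h4 := h.le
  by_contra hc
  push Not at hc
  have a1 : 0 < (1 + β) * (1 - β - β ^ 2) := by
    apply mul_pos <;> nlinarith
  have a2 : (1 - β) * ((1 + β) * (1 - β - β ^ 2)) ≤ m * ((1 + β) * (1 - β - β ^ 2)) :=
    mul_le_mul_of_nonneg_right hc a1.le
  have a3 : (1 + β) * (1 - β - β ^ 2) ≤ (1 - 2 * β - β ^ 2) := by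
    have : 0 < 1 - β := by linarith
    nlinarith
  nlinarith

/-- The lower bound for `m (1 - x y)` behind `|s + τ| ≤ 9/8 β`. -/
lemma amgm_bound (h : IsBeta R β δ m) {x y : ℝ} (hx : β ≤ x) (hy : β ≤ y) (hx' : x ≤ 1 / 4)
    (hy' : y ≤ 1 / 4) : (2 - x - y - 9 / 8 * β) ^ 2 ≤ 4 * (m * (1 - x * y)) := by
  have h2 := h.m_eq
  have h3 := h.pos
  have h4 := h.le
  have h5 := h.m_pos
  have h6 := h.m_lt_one_sub
  -- The case x = y = β is the critical one. Raising y and then x lowers the left side faster than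
  -- the right.
  have base : (2 - β - β - 9 / 8 * β) ^ 2 ≤ 4 * (m * (1 - β * β)) := by
    have a1 : 0 < 1 - β - β ^ 2 := by nlinarith
    refine le_of_mul_le_mul_right ?_ a1
    have e : 4 * (m * (1 - β * β)) * (1 - β - β ^ 2) =
      4 * (1 - β) ^ 2 * (1 - 2 * β - β ^ 2) := by linear_combination 4 * (1 - β) * h2
    rw [e]
    have : 0 ≤ β * (0.5 - 2.265625 * β - 2.734375 * β ^ 2 + 5.765625 * β ^ 3) := by
      apply mul_nonneg h3.le
      nlinarith [pow_pos h3 3]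
    linarith
  have s1 : (2 - β - y - 9 / 8 * β) ^ 2 ≤ 4 * (m * (1 - β * y)) := by
    nlinarith [mul_nonneg (sub_nonneg.2 hy)
      (by nlinarith : 0 ≤ -4 * m * β + (2 - β - y - 9 / 8 * β) + (2 - β - β - 9 / 8 * β))]
  nlinarith [mul_nonneg (sub_nonneg.2 hx)
      (by nlinarith : 0 ≤ -4 * m * y + (2 - x - y - 9 / 8 * β) + (2 - β - y - 9 / 8 * β))]

end IsBeta

/-- By AM-GM a product of two nonnegative factors is at most a quarter of the square of their sum,
and the sums here are 2 - x - y ± (s + τ). -/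
lemma abs_add_le_of_prodA {β m x y s τ : ℝ} (hm : (2 - x - y - 9 / 8 * β) ^ 2 ≤ 4 * (m * (1 - x * y)))
    (h0 : 0 ≤ 2 - x - y - 9 / 8 * β)
    (hs : |s| ≤ 1 - x) (hτ : |τ| ≤ 1 - y)
    (hA : m * (1 - x * y) < prodA x y s τ) (hB : m * (1 - x * y) < prodA x y (-s) (-τ)) :
    |s + τ| ≤ 9 / 8 * β := by
  unfold prodA at hA hB
  rw [abs_le] at *
  constructor
  · by_contra hc
    push Not at hc
    nlinarith [sq_nonneg ((1 - x + s) - (1 - y + τ))]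
  · by_contra hc
    push Not at hc
    nlinarith [sq_nonneg ((1 - x - s) - (1 - y - τ))]

/-- A limit of chains of cells: the digits `a`, `t` and the normalised coordinates are indexed by
all integers. -/
structure LimitSystem (a t : ℤ → ℤ) (x y s τ : ℤ → ℝ) : Prop where
  x_rec : ∀ j, x (j + 1) * (a j - x j) = 1
  y_rec : ∀ j, y j * (a j - y (j + 1)) = 1
  s_rec : ∀ j, s (j + 1) = x (j + 1) * (t j + s j)
  τ_rec : ∀ j, τ j = y j * (t j + τ (j + 1))
  parity : ∀ j, Even (a j - t j)
  x_mem : ∀ j, 0 ≤ x j ∧ x j ≤ 1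
  y_mem : ∀ j, 0 ≤ y j ∧ y j ≤ 1
  s_abs : ∀ j, |s j| ≤ 2
  τ_abs : ∀ j, |τ j| ≤ 2

namespace LimitSystem

variable {a t : ℤ → ℤ} {x y s τ : ℤ → ℝ}

/-- Reversing the digits exchanges past and future, hence x with y and s with τ. Cell j sits between
the digits j - 1 and j, so cells are reflected by j ↦ 1 - j while digits are reflected by j ↦ -j. -/
lemma reflect (h : LimitSystem a t x y s τ) :
    LimitSystem (fun j => a (-j)) (fun j => t (-j)) (fun j => y (1 - j)) (fun j => x (1 - j))
      (fun j => τ (1 - j)) (fun j => s (1 - j)) where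
  x_rec j := by
    have := h.y_rec (-j)
    rw [show -j + 1 = 1 - j by ring] at this
    rwa [show 1 - (j + 1) = -j by ring]
  y_rec j := by
    have := h.x_rec (-j)
    rw [show -j + 1 = 1 - j by ring] at this
    rwa [show 1 - (j + 1) = -j by ring]
  s_rec j := by
    have := h.τ_rec (-j)
    rw [show -j + 1 = 1 - j by ring] at this
    rwa [show 1 - (j + 1) = -j by ring]
  τ_rec j := by
    have := h.s_rec (-j)
    rw [show -j + 1 = 1 - j by ring] at this
    rwa [show 1 - (j + 1) = -j by ring]
  parity j := h.parity _
  x_mem j := h.y_mem _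
  y_mem j := h.x_mem _
  s_abs j := h.τ_abs _
  τ_abs j := h.s_abs _

lemma neg (h : LimitSystem a t x y s τ) :
    LimitSystem a (fun j => -t j) x y (fun j => -s j) (fun j => -τ j) where
  x_rec := h.x_rec
  y_rec := h.y_rec
  s_rec j := by rw [h.s_rec]; push_cast; ring
  τ_rec j := by rw [h.τ_rec]; push_cast; ring
  parity j := by
    have := h.parity j
    rw [Int.even_sub] at *
    simpa using this
  x_mem := h.x_mem
  y_mem := h.y_mem
  s_abs j := by rw [abs_neg]; exact h.s_abs j
  τ_abs j := by rw [abs_neg]; exact h.τ_abs j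

lemma shift (h : LimitSystem a t x y s τ) (p : ℤ) :
    LimitSystem (fun j => a (j + p)) (fun j => t (j + p)) (fun j => x (j + p)) (fun j => y (j + p))
      (fun j => s (j + p)) (fun j => τ (j + p)) where
  x_rec j := by have := h.x_rec (j + p); rwa [add_right_comm] at this
  y_rec j := by have := h.y_rec (j + p); rwa [add_right_comm] at this
  s_rec j := by have := h.s_rec (j + p); rwa [add_right_comm] at this
  τ_rec j := by have := h.τ_rec (j + p); rwa [add_right_comm] at this
  parity j := h.parity _
  x_mem j := h.x_mem _
  y_mem j := h.y_mem _
  s_abs j := h.s_abs _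
  τ_abs j := h.τ_abs _

end LimitSystem

/-- Uniqueness of bounded solutions of the recurrences: iterate towards infinity, where boundedness
beats the factor 2⁻ⁿ. -/
lemma eq_zero_of_contraction {f : ℕ → ℝ} {B : ℝ} (hB : ∀ n, |f n| ≤ B)
    (hf : ∀ n, |f n| ≤ 1 / 2 * |f (n + 1)|) : f 0 = 0 := by
  have h1 : ∀ n, |f 0| ≤ (1 / 2) ^ n * |f n| := by
    intro n
    induction n with
    | zero => simp
    | succ n ih =>
      refine ih.trans ?_
      rw [pow_succ, mul_assoc]
      exact mul_le_mul_of_nonneg_left (hf n) (by positivity)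
  have h2 : ∀ n, |f 0| ≤ (1 / 2) ^ n * B := fun n =>
    (h1 n).trans (mul_le_mul_of_nonneg_left (hB n) (by positivity))
  have h3 := (tendsto_pow_atTop_nhds_zero_of_lt_one (r := (1 / 2 : ℝ)) (by norm_num)
    (by norm_num)).mul_const B
  rw [zero_mul] at h3
  have := ge_of_tendsto' h3 h2
  exact abs_nonpos_iff.1 this

namespace LimitSystem

variable {a t : ℤ → ℤ} {x y s τ : ℤ → ℝ} {R : ℤ} {β δ m : ℝ}

lemma y_pos (h : LimitSystem a t x y s τ) (j : ℤ) : 0 < y j := by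
  rcases (h.y_mem j).1.lt_or_eq with h1 | h1
  · exact h1
  · have := h.y_rec j
    rw [← h1, zero_mul] at this
    linarith

lemma y_le (h : LimitSystem a t x y s τ) (j : ℤ) (ha : 5 ≤ a j) : y j ≤ 1 / 4 := by
  have h1 := h.y_rec j
  have h2 := (h.y_mem (j + 1)).2
  have h3 := h.y_pos j
  have h4 : (5 : ℝ) ≤ a j := by exact_mod_cast ha
  nlinarith

/-- β is the fixed point of the recurrence, and deviations satisfy y_j - β = y_j β (y_{j+1} - β), a
contraction. -/
lemma y_eq_beta (hβ : IsBeta R β δ m) (h : LimitSystem a t x y s τ) {j : ℤ}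
    (ha : ∀ i, j ≤ i → a i = R + 1) : y j = β := by
  have key : (fun n : ℕ => y (j + n) - β) 0 = 0 := by
    apply eq_zero_of_contraction (f := fun n : ℕ => y (j + n) - β) (B := 1)
    · intro n
      have := h.y_mem (j + n)
      have h1 := hβ.pos
      have h2 := hβ.le
      rw [abs_le]; constructor <;> linarith
    · intro n
      have h1 := h.y_rec (j + n)
      have h2 := hβ.beta_eq
      have ha' := ha (j + n) (by omega)
      have h3 := h.y_le (j + n) (by rw [ha']; have := hβ.R_ge; omega)
      have h4 := h.y_pos (j + n)
      rw [ha'] at h1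
      push_cast at h1 ⊢
      rw [add_assoc] at h1
      have e : y (j + n) - β = y (j + n) * β * (y (j + (n + 1)) - β) := by
        linear_combination β * h1 - y (j + n) * h2
      have h6 := hβ.pos
      have h7 := hβ.le
      rw [e, abs_mul, abs_of_pos (mul_pos h4 hβ.pos)]
      refine mul_le_mul_of_nonneg_right ?_ (abs_nonneg _)
      nlinarith
  simpa [sub_eq_zero] using key

/-- For alternating digits t_j β/(1 + β) solves the recurrence, and the difference of two solutions
contracts by β. -/
lemma τ_eq (hβ : IsBeta R β δ m) (h : LimitSystem a t x y s τ) {j : ℤ}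
    (ha : ∀ i, j ≤ i → a i = R + 1) (ht : ∀ i, j ≤ i → t i + t (i + 1) = 0) :
    τ j = t j * (β / (1 + β)) := by
  have h6 := hβ.pos
  have h7 := hβ.le
  have hb : 0 < β / (1 + β) := by positivity
  have hb' : β / (1 + β) * (1 + β) = β := by field_simp
  have habs : ∀ n : ℕ, |(t (j + n) : ℝ)| = |(t j : ℝ)| := by
    intro n
    induction n with
    | zero => simp
    | succ n ih =>
      have := ht (j + n) (by omega)
      have e : t (j + n + 1) = -t (j + n) := by omega
      push_cast
      rw [← add_assoc, e, ← ih]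
      push_cast
      rw [abs_neg]
  have key : (fun n : ℕ => τ (j + n) - t (j + n) * (β / (1 + β))) 0 = 0 := by
    apply eq_zero_of_contraction (f := fun n : ℕ => τ (j + n) - t (j + n) * (β / (1 + β)))
      (B := 2 + |(t j : ℝ)| * (β / (1 + β)))
    · intro n
      refine (abs_sub _ _).trans ?_
      rw [abs_mul, habs n, abs_of_pos hb]
      linarith [h.τ_abs (j + n)]
    · intro n
      have hy : y (j + n) = β := h.y_eq_beta hβ fun i hi => ha i (by omega)
      have h1 := h.τ_rec (j + n)
      have h2 := ht (j + n) (by omega)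
      have h2' : (t (j + n) : ℝ) + t (j + n + 1) = 0 := by exact_mod_cast h2
      push_cast
      rw [← add_assoc]
      have e : τ (j + n) - t (j + n) * (β / (1 + β)) =
          β * (τ (j + n + 1) - t (j + n + 1) * (β / (1 + β))) := by
        rw [h1, hy]
        linear_combination (- t (j + n)) * hb' + β * (β / (1 + β)) * h2'
      rw [e, abs_mul, abs_of_pos hβ.pos]
      exact mul_le_mul_of_nonneg_right (by linarith) (abs_nonneg _)
  simpa [sub_eq_zero] using key

lemma x_pos (h : LimitSystem a t x y s τ) (j : ℤ) : 0 < x j := by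
  have := h.reflect.y_pos (1 - j); simpa using this

lemma x_le (h : LimitSystem a t x y s τ) (j : ℤ) (ha : 5 ≤ a (j - 1)) : x j ≤ 1 / 4 := by
  have := h.reflect.y_le (1 - j) (by simpa using ha); simpa using this

lemma x_eq_beta (hβ : IsBeta R β δ m) (h : LimitSystem a t x y s τ) {j : ℤ}
    (ha : ∀ i, i < j → a i = R + 1) : x j = β := by
  have := h.reflect.y_eq_beta hβ (j := 1 - j) fun i hi => ha _ (by omega)
  simpa using this

lemma s_eq (hβ : IsBeta R β δ m) (h : LimitSystem a t x y s τ) {j : ℤ}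
    (ha : ∀ i, i < j → a i = R + 1) (ht : ∀ i, i < j - 1 → t i + t (i + 1) = 0) :
    s j = t (j - 1) * (β / (1 + β)) := by
  have := h.reflect.τ_eq hβ (j := 1 - j) (fun i hi => ha _ (by omega)) (by
    intro i hi
    have := ht (-(i + 1)) (by omega)
    rw [show -(i + 1) + 1 = -i by ring] at this
    omega)
  simpa using this

end LimitSystem

/-- A limit system with exactly one digit `R`, at the index zero. -/
structure SingleSystem (R : ℤ) (a t : ℤ → ℤ) (x y s τ : ℤ → ℝ) : Prop
    extends LimitSystem a t x y s τ where
  a_zero : a 0 = R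
  a_ne : ∀ j, j ≠ 0 → a j = R + 1

namespace SingleSystem

variable {a t : ℤ → ℤ} {x y s τ : ℤ → ℝ} {R : ℤ} {β δ m : ℝ}

lemma reflect (h : SingleSystem R a t x y s τ) :
    SingleSystem R (fun j => a (-j)) (fun j => t (-j)) (fun j => y (1 - j)) (fun j => x (1 - j))
      (fun j => τ (1 - j)) (fun j => s (1 - j)) where
  toLimitSystem := h.toLimitSystem.reflect
  a_zero := by simpa using h.a_zero
  a_ne j hj := h.a_ne _ (by omega)

lemma neg (h : SingleSystem R a t x y s τ) :
    SingleSystem R a (fun j => -t j) x y (fun j => -s j) (fun j => -τ j) where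
  toLimitSystem := h.toLimitSystem.neg
  a_zero := h.a_zero
  a_ne := h.a_ne

lemma y_eq_beta (hβ : IsBeta R β δ m) (h : SingleSystem R a t x y s τ) {j : ℤ} (hj : 1 ≤ j) :
    y j = β :=
  h.toLimitSystem.y_eq_beta hβ fun i hi => h.a_ne i (by omega)

lemma x_eq_beta (hβ : IsBeta R β δ m) (h : SingleSystem R a t x y s τ) {j : ℤ} (hj : j ≤ 0) :
    x j = β :=
  h.toLimitSystem.x_eq_beta hβ fun i hi => h.a_ne i (by omega)

lemma x_one (hβ : IsBeta R β δ m) (h : SingleSystem R a t x y s τ) : x 1 = δ := by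
  have h1 := h.x_rec 0
  rw [h.a_zero, h.x_eq_beta hβ le_rfl, zero_add] at h1
  have h2 := hβ.delta_mul
  have : (R - β : ℝ) ≠ 0 := by
    intro h0
    rw [h0, mul_zero] at h2
    linarith
  exact mul_right_cancel₀ this (h1.trans h2.symm)

lemma y_zero (hβ : IsBeta R β δ m) (h : SingleSystem R a t x y s τ) : y 0 = δ := by
  have := h.reflect.x_one hβ
  simpa using this

/-- The perturbation x_1 - β = δ - β = β²/(1 - β) is multiplied by x_{j+1}β at each step. Its first
image satisfies (x_2 - β)(1 - β - β³) = β⁴, and 1 - β - β³ ≥ 4/5 gives the constant 5/4. -/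
lemma x_near (hβ : IsBeta R β δ m) (h : SingleSystem R a t x y s τ) (n : ℕ) :
    β ≤ x (2 + n) ∧ x (2 + n) ≤ β + 5 / 4 * β ^ 4 := by
  have h6 := hβ.pos
  have h7 := hβ.le
  have step : ∀ j : ℤ, 1 ≤ j → x (j + 1) - β = x (j + 1) * β * (x j - β) := by
    intro j hj
    have h1 := h.x_rec j
    rw [h.a_ne j (by omega)] at h1
    push_cast at h1
    linear_combination β * h1 - x (j + 1) * hβ.beta_eq
  have hR := hβ.R_ge
  induction n with
  | zero =>
    have h1 := step 1 le_rfl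
    rw [h.x_one hβ] at h1
    simp only [Nat.cast_zero, add_zero] at *
    rw [show (1 + 1 : ℤ) = 2 from rfl] at h1
    have h2 := h.x_pos 2
    have h3 := hβ.beta_lt_delta
    have h4 : (δ - β) * (1 - β) = β ^ 2 := by linear_combination hβ.delta_eq
    have h5 : (x 2 - β) * (1 - β) = x 2 * β ^ 3 := by
      linear_combination (1 - β) * h1 + x 2 * β * h4
    constructor
    · have : 0 ≤ x 2 * β * (δ - β) := by
        have := sub_pos.2 h3; positivity
      linarith
    · have h8 : 0 < 1 - β - β ^ 3 := by nlinarith [pow_pos h6 2]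
      have h9 : (x 2 - β) * (1 - β - β ^ 3) = β ^ 4 := by linear_combination h5
      have h10 : (4 / 5 : ℝ) ≤ 1 - β - β ^ 3 := by nlinarith [pow_pos h6 2]
      have h11 : 0 < x 2 - β := by
        by_contra hc
        push Not at hc
        nlinarith [pow_pos h6 4]
      nlinarith
  | succ n ih =>
    have h1 := step (2 + n) (by omega)
    push_cast
    rw [← add_assoc]
    have h2 := h.x_pos (2 + n + 1)
    have h3 := h.x_le (2 + n + 1) (by rw [h.a_ne _ (by omega)]; omega)
    have h4 : 0 ≤ x (2 + n) - β := by linarith [ih.1]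
    have h5 : 0 < x (2 + n + 1) * β := by positivity
    have h8 : x (2 + n + 1) * β ≤ 1 := by nlinarith
    constructor
    · nlinarith
    · nlinarith [ih.2]

lemma x_near' (hβ : IsBeta R β δ m) (h : SingleSystem R a t x y s τ) {j : ℤ} (hj : j ≠ 1) :
    β ≤ x j ∧ x j ≤ β + 5 / 4 * β ^ 4 := by
  rcases lt_or_gt_of_ne hj with h1 | h1
  · rw [h.x_eq_beta hβ (by omega)]
    have := hβ.pos
    exact ⟨le_rfl, by nlinarith [pow_pos this 4]⟩
  · obtain ⟨n, hn⟩ : ∃ n : ℕ, j = 2 + n := ⟨(j - 2).toNat, by omega⟩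
    rw [hn]; exact h.x_near hβ n

lemma quartic_small (hβ : IsBeta R β δ m) : β + 5 / 4 * β ^ 4 ≤ δ := by
  have h6 := hβ.pos
  have h7 := hβ.le
  have h1 : β + β ^ 2 ≤ δ := by
    have := hβ.beta_lt_delta
    nlinarith [hβ.delta_eq]
  have : β ^ 2 ≤ 1 / 4 := by nlinarith
  nlinarith [pow_pos h6 2]

lemma x_bounds (hβ : IsBeta R β δ m) (h : SingleSystem R a t x y s τ) (j : ℤ) :
    β ≤ x j ∧ x j ≤ δ := by
  by_cases hj : j = 1
  · subst hj; rw [h.x_one hβ]; exact ⟨hβ.beta_lt_delta.le, le_rfl⟩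
  · have := h.x_near' hβ hj
    exact ⟨this.1, this.2.trans (quartic_small hβ)⟩

lemma y_bounds (hβ : IsBeta R β δ m) (h : SingleSystem R a t x y s τ) (j : ℤ) :
    β ≤ y j ∧ y j ≤ δ := by
  have := h.reflect.x_bounds hβ (1 - j)
  simpa using this

end SingleSystem

end

/-! ### Upper bound in the limit: cells are divided and digits alternate. -/

section

lemma prodA_swap (x y s τ : ℝ) : prodA y x τ s = prodA x y s τ := by
  unfold prodA; ring

lemma prodB_swap (x y s τ : ℝ) : prodB y x τ s = prodB x y (-s) (-τ) := by
  unfold prodB; ring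

/-- A bounded chain gives only s ≤ 1 + x. If s > 1 - x, the factor 1 - x - s has absolute value at
most 2x, while the other product forces 1 - y + τ > M/2 and so bounds 1 - y - τ; the product at (-s,
-τ) is then too small. -/
lemma abs_le_of_prodA {M x y s τ : ℝ} (hy' : y ≤ 1 / 4) (hM1 : M ≤ 1)
    (hs1 : -(1 - x) ≤ s) (hs2 : s ≤ 1 + x) (hτ1 : -(1 - y) ≤ τ) (hτ2 : τ ≤ 1 + y)
    (hx0 : 0 < x) (hx1 : x < 1)
    (hA : M < |prodA x y s τ|) (hB : M < |prodA x y (-s) (-τ)|) (hlt : x * (4 - 4 * y - M) < M) :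
    |s| ≤ 1 - x := by
  rw [abs_le]
  refine ⟨hs1, ?_⟩
  by_contra hc
  push Not at hc
  unfold prodA at hA hB
  rw [abs_of_nonneg (mul_nonneg (by linarith) (by linarith))] at hA
  rw [abs_mul, abs_of_neg (by linarith : 1 - x + -s < 0)] at hB
  have h1 : M < 2 * (1 - y + τ) := by nlinarith
  have h2 : |1 - y + -τ| ≤ 2 - 2 * y - M / 2 := by
    rw [abs_le]; constructor <;> linarith
  have h3 : -(1 - x + -s) * |1 - y + -τ| ≤ 2 * x * (2 - 2 * y - M / 2) :=
    mul_le_mul (by linarith) h2 (abs_nonneg _) (by linarith)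
  linarith

/-- A system with a single digit `R` in which every cell has large vertex products. -/
structure CellSystem (R : ℤ) (m : ℝ) (a t : ℤ → ℤ) (x y s τ : ℤ → ℝ) : Prop
    extends SingleSystem R a t x y s τ where
  s_le : ∀ j, |s j| ≤ 1 - x j
  τ_le : ∀ j, |τ j| ≤ 1 - y j
  prod_lt : ∀ j, m * (1 - x j * y j) < prodA (x j) (y j) (s j) (τ j)
  prod_lt' : ∀ j, m * (1 - x j * y j) < prodA (x j) (y j) (-s j) (-τ j)

variable {a t : ℤ → ℤ} {x y s τ : ℤ → ℝ} {R : ℤ} {β δ m : ℝ}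

/-- With one of x, y equal to β and the other at most δ, the threshold is smallest next to R. -/
lemma IsBeta.mu_le (hβ : IsBeta R β δ m) {x y : ℝ} (hx : β ≤ x) (hx' : x ≤ δ) (hy : β ≤ y)
    (hxy : x = β ∨ y = β) (hy' : y ≤ δ) :
    (1 - 2 * β - β ^ 2) / (1 + β) ≤ m * (1 - x * y) := by
  have h1 := hβ.mu_eq
  have h2 := hβ.pos
  rw [div_le_iff₀ (by linarith), ← h1]
  have h3 : x * y ≤ δ * β := by
    rcases hxy with rfl | rfl <;> nlinarith
  have h4 := hβ.m_pos
  have : m * (1 - δ * β) ≤ m * (1 - x * y) := by nlinarith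
  exact mul_le_mul_of_nonneg_right this (by linarith)

lemma IsBeta.range_ineq (hβ : IsBeta R β δ m) {x y M : ℝ} (hx : 0 < x)
    (hx' : x ≤ β + 5 / 4 * β ^ 4)
    (hy : β ≤ y) (hM : (1 - 2 * β - β ^ 2) / (1 + β) ≤ M) : x * (4 - 4 * y - M) < M := by
  have h2 := hβ.pos
  have h3 := hβ.le
  have hq : β ^ 4 ≤ 0.00506 * β := by
    have : β ^ 3 ≤ 0.1716 ^ 3 := pow_le_pow_left₀ h2.le h3 3
    have := mul_le_mul_of_nonneg_right this h2.le
    calc β ^ 4 = β ^ 3 * β := by ring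
      _ ≤ _ := this
      _ ≤ _ := by nlinarith
  have hx2 : x ≤ 1.0064 * β := by linarith
  have hM' : 1 - 2 * β - β ^ 2 ≤ M * (1 + β) := by rwa [div_le_iff₀ (by linarith)] at hM
  have a1 : x * (4 - 4 * y) ≤ x * (4 - 4 * β) := mul_le_mul_of_nonneg_left (by linarith) hx.le
  have a2 : x * (4 * (1 - β ^ 2) - (1 - 2 * β - β ^ 2)) ≤
      1.0064 * β * (4 * (1 - β ^ 2) - (1 - 2 * β - β ^ 2)) :=
    mul_le_mul_of_nonneg_right hx2 (by nlinarith)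
  have a3 : 1.0064 * β * (4 * (1 - β ^ 2) - (1 - 2 * β - β ^ 2)) < 1 - 2 * β - β ^ 2 := by
    nlinarith [mul_pos h2 h2]
  have a4 := mul_le_mul_of_nonneg_right hM' (by linarith : 0 ≤ 1 + x)
  have a5 : x * (4 - 4 * β) * (1 + β) < M * (1 + β) * (1 + x) := by linarith
  have a6 : x * (4 - 4 * β) < M * (1 + x) := by
    refine lt_of_mul_lt_mul_right ?_ (by linarith : 0 ≤ 1 + β)
    linarith
  linarith

lemma SingleSystem.s_le_aux (hβ : IsBeta R β δ m) (h : SingleSystem R a t x y s τ)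
    (hs1 : ∀ j, -(1 - x j) ≤ s j) (hs2 : ∀ j, s j ≤ 1 + x j)
    (hτ1 : ∀ j, -(1 - y j) ≤ τ j) (hτ2 : ∀ j, τ j ≤ 1 + y j)
    (hA : ∀ j, m * (1 - x j * y j) < |prodA (x j) (y j) (s j) (τ j)|)
    (hB : ∀ j, m * (1 - x j * y j) < |prodA (x j) (y j) (-s j) (-τ j)|) {j : ℤ} (hj : j ≠ 1) :
    |s j| ≤ 1 - x j := by
  have hx := h.x_bounds hβ j
  have hy := h.y_bounds hβ j
  have h2 := hβ.pos
  have h3 := hβ.le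
  have h4 := hβ.delta_le
  have h5 := hβ.m_pos
  have h6 := hβ.m_lt_one_sub
  have hxy : x j = β ∨ y j = β := by
    rcases le_or_gt j 0 with hj | hj
    · exact Or.inl (h.x_eq_beta hβ hj)
    · exact Or.inr (h.y_eq_beta hβ (by omega))
  refine abs_le_of_prodA (by linarith) ?_ (hs1 j) (hs2 j) (hτ1 j) (hτ2 j)
    (by linarith) (by linarith) (hA j) (hB j) ?_
  · have : 0 ≤ x j * y j := mul_nonneg (by linarith) (by linarith)
    nlinarith
  · exact hβ.range_ineq (by linarith) (h.x_near' hβ hj).2 hy.1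
      (hβ.mu_le hx.1 hx.2 hy.1 hxy hy.2)

lemma IsBeta.two_beta_lt (hβ : IsBeta R β δ m) : 2 * β < (1 - 2 * β - β ^ 2) / (1 + β) := by
  have h2 := hβ.pos
  have h3 := hβ.le
  rw [lt_div_iff₀ (by linarith)]
  nlinarith

/-- At cell 1 the value x = δ is too large for the preceding argument, so the digit t_0 is used. It
has the parity of R and is below R + 2; if it is at most R - 2, the bound on s_0 gives the claim. -/
lemma SingleSystem.s_one_le (hβ : IsBeta R β δ m) (h : SingleSystem R a t x y s τ)
    (hs1 : ∀ j, -(1 - x j) ≤ s j) (hs2 : ∀ j, s j ≤ 1 + x j)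
    (hs0 : |s 0| ≤ 1 - β) (hτ1 : |τ 1| ≤ 1 - β)
    (hB : ∀ j, m * (1 - x j * y j) < |prodA (x j) (y j) (-s j) (-τ j)|) :
    |s 1| ≤ 1 - x 1 := by
  have h2 := hβ.pos
  have h3 := hβ.le
  have h4 := hβ.delta_le
  have h5 := hβ.beta_lt_delta
  have hδ := hβ.delta_mul
  rw [abs_le]
  refine ⟨hs1 1, ?_⟩
  have hr := h.s_rec 0
  have hrτ := h.τ_rec 0
  rw [zero_add, h.x_one hβ] at hr
  rw [h.y_zero hβ, zero_add] at hrτ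
  rw [h.x_one hβ]
  obtain ⟨s01, s02⟩ := abs_le.1 hs0
  obtain ⟨t01, t02⟩ := abs_le.1 hτ1
  have hs2' := hs2 1
  rw [h.x_one hβ, hr] at hs2'
  have htR : (t 0 : ℝ) < R + 2 := by
    by_contra hc
    push Not at hc
    nlinarith
  have htR' : t 0 < R + 2 := by exact_mod_cast htR
  obtain ⟨b, hb⟩ := h.parity 0
  rw [h.a_zero] at hb
  rcases (show t 0 ≤ R - 2 ∨ t 0 = R by omega) with ht | ht
  · have ht' : (t 0 : ℝ) ≤ R - 2 := by exact_mod_cast ht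
    rw [hr]
    nlinarith
  -- If t_0 = R, one factor at each of the cells 0 and 1 becomes δ times a factor of the
  -- neighbouring cell. The two products add up to at most 4δ(1 - β) = 4β, although each exceeds 2β.
  · exfalso
    rw [ht] at hr hrτ
    have b0 := hB 0
    have b1 := hB 1
    rw [h.x_eq_beta hβ le_rfl, h.y_zero hβ] at b0
    rw [h.x_one hβ, h.y_eq_beta hβ le_rfl] at b1
    unfold prodA at b0 b1
    have e0 : 1 - δ + -τ 0 = -(δ * (1 + β + τ 1)) := by rw [hrτ]; linear_combination -hδ
    have e1 : 1 - δ + -s 1 = -(δ * (1 + β + s 0)) := by rw [hr]; linear_combination -hδ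
    have hμ0 := hβ.mu_le (x := β) (y := δ) le_rfl h5.le h5.le (Or.inl rfl) le_rfl
    have hμ1 := hβ.mu_le (x := δ) (y := β) h5.le le_rfl le_rfl (Or.inr rfl) h5.le
    have hμ := hβ.two_beta_lt
    rw [e0, mul_neg, abs_neg, abs_of_nonneg
      (mul_nonneg (by linarith) (mul_nonneg (by linarith) (by linarith)))] at b0
    rw [e1, neg_mul, abs_neg, abs_of_nonneg
      (mul_nonneg (mul_nonneg (by linarith) (by linarith)) (by linarith))] at b1
    have hd := hβ.delta_eq
    have c0 : 2 * β < δ * ((1 - β + -s 0) * (1 + β + τ 1)) := by linarith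
    have c1 : 2 * β < δ * ((1 + β + s 0) * (1 - β + -τ 1)) := by linarith
    have c2 : (1 - β + -s 0) * (1 + β + τ 1) + (1 + β + s 0) * (1 - β + -τ 1) ≤ 4 * (1 - β) := by
      have g1 := mul_nonneg (by linarith : 0 ≤ 1 - β + s 0) (by linarith : 0 ≤ 1 - β + τ 1)
      have g2 := mul_nonneg (by linarith : 0 ≤ 1 - 2 * β)
        (mul_nonneg (sub_nonneg.2 s02) (sub_nonneg.2 t02))
      refine le_of_mul_le_mul_right ?_ (by linarith : 0 < 1 - β)
      linarith
    have c3 := mul_le_mul_of_nonneg_left c2 (by linarith : 0 ≤ δ)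
    nlinarith

/-- Once all cells are divided, the factors of `prodA` are nonnegative and the absolute values can
be dropped. The bounds for τ come from those for s by reflection. -/
lemma SingleSystem.cellSystem (hβ : IsBeta R β δ m) (h : SingleSystem R a t x y s τ)
    (hs1 : ∀ j, -(1 - x j) ≤ s j) (hs2 : ∀ j, s j ≤ 1 + x j)
    (hτ1 : ∀ j, -(1 - y j) ≤ τ j) (hτ2 : ∀ j, τ j ≤ 1 + y j)
    (hA : ∀ j, m * (1 - x j * y j) < |prodA (x j) (y j) (s j) (τ j)|)
    (hB : ∀ j, m * (1 - x j * y j) < |prodA (x j) (y j) (-s j) (-τ j)|) :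
    CellSystem R m a t x y s τ := by
  have hA' : ∀ j, m * (1 - y (1 - j) * x (1 - j)) <
      |prodA (y (1 - j)) (x (1 - j)) (τ (1 - j)) (s (1 - j))| := by
    intro j
    have := hA (1 - j)
    rwa [mul_comm (x _), ← prodA_swap] at this
  have hB' : ∀ j, m * (1 - y (1 - j) * x (1 - j)) <
      |prodA (y (1 - j)) (x (1 - j)) (-τ (1 - j)) (-s (1 - j))| := by
    intro j
    have := hB (1 - j)
    rwa [mul_comm (x _), ← prodA_swap] at this
  have f1 : ∀ j, j ≠ 1 → |s j| ≤ 1 - x j := fun j hj => h.s_le_aux hβ hs1 hs2 hτ1 hτ2 hA hB hj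
  have f2 : ∀ j, j ≠ 0 → |τ j| ≤ 1 - y j := by
    intro j hj
    have := h.reflect.s_le_aux hβ (fun j => hτ1 (1 - j)) (fun j => hτ2 (1 - j))
      (fun j => hs1 (1 - j)) (fun j => hs2 (1 - j)) hA' hB' (j := 1 - j) (by omega)
    simpa using this
  have g1 := f1 0 (by norm_num)
  have g2 := f2 1 (by norm_num)
  rw [h.x_eq_beta hβ le_rfl] at g1
  rw [h.y_eq_beta hβ le_rfl] at g2
  have f3 := h.s_one_le hβ hs1 hs2 g1 g2 hB
  have f4 := h.reflect.s_one_le hβ (fun j => hτ1 (1 - j)) (fun j => hτ2 (1 - j))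
    (by simpa using g2) (by simpa using g1) hB'
  have f5 : ∀ j, |s j| ≤ 1 - x j := by
    intro j
    by_cases hj : j = 1
    · subst hj; exact f3
    · exact f1 j hj
  have f6 : ∀ j, |τ j| ≤ 1 - y j := by
    intro j
    by_cases hj : j = 0
    · subst hj; simpa using f4
    · exact f2 j hj
  refine ⟨h, f5, f6, fun j => ?_, fun j => ?_⟩
  · have := hA j
    obtain ⟨u1, u2⟩ := abs_le.1 (f5 j)
    obtain ⟨v1, v2⟩ := abs_le.1 (f6 j)
    rwa [abs_of_nonneg (mul_nonneg (by linarith) (by linarith))] at this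
  · have := hB j
    obtain ⟨u1, u2⟩ := abs_le.1 (f5 j)
    obtain ⟨v1, v2⟩ := abs_le.1 (f6 j)
    rwa [abs_of_nonneg (mul_nonneg (by linarith) (by linarith))] at this

namespace CellSystem

lemma reflect (h : CellSystem R m a t x y s τ) :
    CellSystem R m (fun j => a (-j)) (fun j => t (-j)) (fun j => y (1 - j)) (fun j => x (1 - j))
      (fun j => τ (1 - j)) (fun j => s (1 - j)) where
  toSingleSystem := h.toSingleSystem.reflect
  s_le j := h.τ_le _
  τ_le j := h.s_le _
  prod_lt j := by rw [prodA_swap, mul_comm (y _)]; exact h.prod_lt _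
  prod_lt' j := by rw [prodA_swap, mul_comm (y _)]; exact h.prod_lt' _

lemma neg (h : CellSystem R m a t x y s τ) :
    CellSystem R m a (fun j => -t j) x y (fun j => -s j) (fun j => -τ j) where
  toSingleSystem := h.toSingleSystem.neg
  s_le j := by rw [abs_neg]; exact h.s_le j
  τ_le j := by rw [abs_neg]; exact h.τ_le j
  prod_lt := h.prod_lt'
  prod_lt' j := by rw [neg_neg, neg_neg]; exact h.prod_lt j

lemma abs_add_le (hβ : IsBeta R β δ m) (h : CellSystem R m a t x y s τ) (j : ℤ) :
    |s j + τ j| ≤ 9 / 8 * β := by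
  have hx := h.x_bounds hβ j
  have hy := h.y_bounds hβ j
  have h3 := hβ.le
  have h4 := hβ.delta_le
  exact abs_add_le_of_prodA (hβ.amgm_bound hx.1 hy.1 (by linarith) (by linarith)) (by linarith)
    (h.s_le j) (h.τ_le j) (h.prod_lt j) (h.prod_lt' j)

/-- The sums s + τ at three consecutive cells nearly determine t_j + t_{j+1}. Being small, they give
|t_j + t_{j+1}| < 2, and the sum is even because both partial quotients are R + 1. Starting at j = 1
keeps the exceptional value x_1 = δ out of the error terms. -/
lemma digit_alternates (hβ : IsBeta R β δ m) (h : CellSystem R m a t x y s τ) {j : ℤ}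
    (hj : 1 ≤ j) : t j + t (j + 1) = 0 := by
  have h2 := hβ.pos
  have h3 := hβ.le
  have n0 := h.abs_add_le hβ j
  have n1 := h.abs_add_le hβ (j + 1)
  have n2 := h.abs_add_le hβ (j + 1 + 1)
  have r1 := h.s_rec j
  have r2 := h.s_rec (j + 1)
  have r3 := h.τ_rec j
  have r4 := h.τ_rec (j + 1)
  rw [h.y_eq_beta hβ hj] at r3
  rw [h.y_eq_beta hβ (by omega)] at r4
  have x1 := h.x_near' hβ (j := j + 1) (by omega)
  have x2 := h.x_near' hβ (j := j + 1 + 1) (by omega)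
  have b1 := h.s_le (j + 1)
  have b2 := h.s_le (j + 1 + 1)
  set e := x (j + 1) - β with he
  set e' := x (j + 1 + 1) - β with he'
  have E1 : |e * (t j + s j)| ≤ 5 / 4 * β ^ 3 := by
    have : x (j + 1) * |t j + s j| ≤ 1 := by
      rw [← abs_of_pos (by linarith : 0 < x (j + 1)), ← abs_mul, ← r1]; linarith
    have h5 : β * |t j + s j| ≤ 1 := by nlinarith [abs_nonneg ((t j : ℝ) + s j)]
    rw [abs_mul, abs_of_nonneg (by linarith : 0 ≤ e)]
    calc e * |t j + s j| ≤ 5 / 4 * β ^ 4 * |t j + s j| :=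
          mul_le_mul_of_nonneg_right (by linarith) (abs_nonneg _)
      _ = 5 / 4 * β ^ 3 * (β * |t j + s j|) := by ring
      _ ≤ 5 / 4 * β ^ 3 * 1 := mul_le_mul_of_nonneg_left h5 (by positivity)
      _ = _ := by ring
  have E2 : |β * e' * (t (j + 1) + s (j + 1))| ≤ 5 / 4 * β ^ 4 := by
    have : x (j + 1 + 1) * |t (j + 1) + s (j + 1)| ≤ 1 := by
      rw [← abs_of_pos (by linarith : 0 < x (j + 1 + 1)), ← abs_mul, ← r2]; linarith
    have h5 : β * |t (j + 1) + s (j + 1)| ≤ 1 := by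
      nlinarith [abs_nonneg ((t (j + 1) : ℝ) + s (j + 1))]
    rw [abs_mul, abs_of_nonneg (mul_nonneg h2.le (by linarith : 0 ≤ e'))]
    calc β * e' * |t (j + 1) + s (j + 1)| = e' * (β * |t (j + 1) + s (j + 1)|) := by ring
      _ ≤ 5 / 4 * β ^ 4 * 1 := mul_le_mul (by linarith) h5 (by positivity) (by positivity)
      _ = _ := by ring
  -- Eliminating s and τ between the three cells is exact for x = β; e and e' carry the remaining
  -- deviation.
  have key : β * (1 - β) * ((t j : ℝ) + t (j + 1)) = (s (j + 1) + τ (j + 1)) * (1 + β ^ 2)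
      - β * (s j + τ j) - β * (s (j + 1 + 1) + τ (j + 1 + 1)) - e * (t j + s j)
      + β * e' * (t (j + 1) + s (j + 1)) := by
    rw [he, he']
    linear_combination (-1) * r1 + β * r2 + β * r3 - r4
  rw [abs_le] at n0 n1 n2 E1 E2
  have hpoly : 9 / 8 * β * (1 + β ^ 2) + 2 * (9 / 8 * β * β) + 5 / 4 * β ^ 3 + 5 / 4 * β ^ 4 <
      2 * (β * (1 - β)) := by
    have : 0 < β * (0.875 - 4.25 * β - 2.375 * β ^ 2 - 1.25 * β ^ 3) := by
      apply mul_pos h2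
      have p2 : β ^ 2 ≤ 0.1716 ^ 2 := pow_le_pow_left₀ h2.le h3 2
      have p3 : β ^ 3 ≤ 0.1716 ^ 3 := pow_le_pow_left₀ h2.le h3 3
      norm_num at p2 p3
      linarith
    linarith
  have hq : 0 < β * (1 - β) := mul_pos h2 (by linarith)
  have g1 := mul_le_mul_of_nonneg_left n0.1 h2.le
  have g2 := mul_le_mul_of_nonneg_left n0.2 h2.le
  have g3 := mul_le_mul_of_nonneg_left n2.1 h2.le
  have g4 := mul_le_mul_of_nonneg_left n2.2 h2.le
  have g5 := mul_le_mul_of_nonneg_right n1.1 (by positivity : 0 ≤ 1 + β ^ 2)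
  have g6 := mul_le_mul_of_nonneg_right n1.2 (by positivity : 0 ≤ 1 + β ^ 2)
  have u1 : ((t j : ℝ) + t (j + 1)) < 2 := by
    refine lt_of_mul_lt_mul_left ?_ hq.le
    linarith
  have u2 : -2 < ((t j : ℝ) + t (j + 1)) := by
    refine lt_of_mul_lt_mul_left ?_ hq.le
    linarith
  have u1' : t j + t (j + 1) < 2 := by exact_mod_cast u1
  have u2' : -2 < t j + t (j + 1) := by exact_mod_cast u2
  obtain ⟨p, hp⟩ := h.parity j
  obtain ⟨q, hq⟩ := h.parity (j + 1)
  rw [h.a_ne j (by omega)] at hp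
  rw [h.a_ne (j + 1) (by omega)] at hq
  omega

lemma digit_alternates' (hβ : IsBeta R β δ m) (h : CellSystem R m a t x y s τ) {j : ℤ}
    (hj : j < -1) : t j + t (j + 1) = 0 := by
  have := h.reflect.digit_alternates hβ (j := -(j + 1)) (by omega)
  simp only [neg_neg] at this
  rw [show -(-(j + 1) + 1) = j by ring] at this
  omega

lemma τ_one_eq (hβ : IsBeta R β δ m) (h : CellSystem R m a t x y s τ) :
    τ 1 = t 1 * (β / (1 + β)) :=
  h.toLimitSystem.τ_eq hβ (fun i hi => h.a_ne i (by omega))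
    (fun _ hi => h.digit_alternates hβ hi)

lemma s_zero_eq (hβ : IsBeta R β δ m) (h : CellSystem R m a t x y s τ) :
    s 0 = t (-1) * (β / (1 + β)) :=
  h.toLimitSystem.s_eq hβ (fun i hi => h.a_ne i (by omega))
    (fun _ hi => h.digit_alternates' hβ (by omega))

end CellSystem

end

/-! ### Upper bound in the limit: excluding every digit pattern at R. -/

section

variable {a t : ℤ → ℤ} {x y s τ : ℤ → ℝ} {R : ℤ} {β δ m : ℝ}

namespace CellSystem

/-- The vertex inequality at cell 0, with s_0 and τ_0 now explicit, cleared of denominators and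
divided by β. The other vertices next to R follow by `neg` and `reflect`. -/
lemma vertex_poly (hβ : IsBeta R β δ m) (h : CellSystem R m a t x y s τ) :
    0 < (1 - β) * (1 - β ^ 2) + (1 - β ^ 2) * ((1 + β) * t 0 + t 1 * β)
      + t (-1) * (1 - 2 * β) * (1 + β) + t (-1) * β * ((1 + β) * t 0 + t 1 * β) := by
  have h2 := hβ.pos
  have h3 := hβ.le
  have hb : β / (1 + β) * (1 + β) = β := by field_simp
  have hp := h.prod_lt 0
  have hs := h.s_zero_eq hβ
  have ht := h.τ_one_eq hβ
  have hr := h.τ_rec 0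
  rw [h.y_zero hβ, zero_add] at hr
  rw [h.x_eq_beta hβ le_rfl, h.y_zero hβ] at hp
  have hμ := hβ.mu_eq
  have hd := hβ.delta_eq
  unfold prodA at hp
  have e1 : (1 - β + s 0) * (1 + β) = 1 - β ^ 2 + t (-1) * β := by
    rw [hs]; linear_combination (t (-1)) * hb
  have e2 : (1 - δ + τ 0) * ((1 - β) * (1 + β)) =
      (1 - 2 * β) * (1 + β) + β * ((1 + β) * t 0 + t 1 * β) := by
    rw [hr, ht]
    linear_combination (-(1 + β) + (t 0 + t 1 * (β / (1 + β))) * (1 + β)) * hd + β * t 1 * hb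
  have hpos : 0 < (1 + β) * ((1 - β) * (1 + β)) := by
    apply mul_pos (by linarith) (mul_pos (by linarith) (by linarith))
  have h5 := mul_lt_mul_of_pos_right hp hpos
  have e3 : (1 - β + s 0) * (1 - δ + τ 0) * ((1 + β) * ((1 - β) * (1 + β))) =
    (1 - β ^ 2 + t (-1) * β) * ((1 - 2 * β) * (1 + β) + β * ((1 + β) * t 0 + t 1 * β)) := by
    rw [← e1, ← e2]; ring
  have e4 : m * (1 - β * δ) * ((1 + β) * ((1 - β) * (1 + β))) =
    (1 - 2 * β - β ^ 2) * ((1 - β) * (1 + β)) := by rw [← hμ]; ring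
  rw [e3, e4] at h5
  refine pos_of_mul_pos_right (a := β) ?_ h2.le
  linarith

/-- The AM-GM bound on s_0 + τ_0 in terms of the digits; together with its reflection it confines
t_{±1} + t_0. -/
lemma sum_bound (hβ : IsBeta R β δ m) (h : CellSystem R m a t x y s τ) :
    |t (-1) * (1 - β) + (1 + β) * t 0 + t 1 * β| ≤ 9 / 8 * (1 - β ^ 2) := by
  have h2 := hβ.pos
  have h3 := hβ.le
  have hb : β / (1 + β) * (1 + β) = β := by field_simp
  have hp := h.abs_add_le hβ 0
  have hs := h.s_zero_eq hβ
  have ht := h.τ_one_eq hβ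
  have hr := h.τ_rec 0
  rw [h.y_zero hβ, zero_add] at hr
  have hd := hβ.delta_eq
  have e : (s 0 + τ 0) * ((1 - β) * (1 + β)) =
      β * (t (-1) * (1 - β) + (1 + β) * t 0 + t 1 * β) := by
    rw [hs, hr, ht]
    linear_combination (t 0 + t 1 * (β / (1 + β))) * (1 + β) * hd +
      (t (-1) * (1 - β) + t 1 * β) * hb
  have hpos : 0 < (1 - β) * (1 + β) := mul_pos (by linarith) (by linarith)
  have h5 := mul_le_mul_of_nonneg_right hp hpos.le
  rw [← abs_of_pos hpos, ← abs_mul, abs_of_pos hpos, e, abs_mul, abs_of_pos h2] at h5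
  refine le_of_mul_le_mul_left ?_ h2
  linarith

lemma digit_zero_le (hβ : IsBeta R β δ m) (h : CellSystem R m a t x y s τ) : t 0 * β < 1 := by
  have h2 := hβ.pos
  have h3 := hβ.le
  have hd := hβ.delta_eq
  have hδ := hβ.beta_lt_delta
  have hr := h.τ_rec 0
  rw [h.y_zero hβ, zero_add] at hr
  have h0 := (abs_le.1 (h.τ_le 0)).2
  have h1 := (abs_le.1 (h.τ_le 1)).1
  rw [h.y_zero hβ] at h0
  rw [h.y_eq_beta hβ le_rfl] at h1
  rw [hr] at h0
  by_contra hc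
  push Not at hc
  nlinarith

end CellSystem

/-- The inequalities at a digit `R` with signed digits `p' - e, e, p - e` around it fail. -/
lemma digit_cases {β e p p' : ℝ} (h2 : 0 < β) (h3 : β ≤ 0.1716) (he : 1 ≤ e)
    (h : (p = 1 ∧ p' = 1) ∨ (p = 1 ∧ p' = -1))
    (hm : 0 < (1 - β) * (1 - β ^ 2) - (1 - β ^ 2) * ((1 + β) * e + (p' - e) * β)
      - (p - e) * (1 - 2 * β) * (1 + β) + (p - e) * β * ((1 + β) * e + (p' - e) * β)) : False := by
  rcases h with ⟨rfl, rfl⟩ | ⟨rfl, rfl⟩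
  · have a1 : 0 ≤ (e - 1) * β * (e + β) :=
      mul_nonneg (mul_nonneg (by linarith) h2.le) (by linarith)
    have a2 : 0 < β * (1 + β) * (e + 1 - 2 * β) :=
      mul_pos (mul_pos h2 (by linarith)) (by linarith)
    nlinarith
  -- With e = 1 this is the extremal pattern 0, 1, -2 and the polynomial vanishes, so only the
  -- strictness of the hypothesis excludes it.
  · have a1 : 0 ≤ (e - 1) * β * (e - β) :=
      mul_nonneg (mul_nonneg (by linarith) h2.le) (by linarith)
    have a2 : 0 ≤ β * (1 + β) * (e - 1) :=
      mul_nonneg (mul_pos h2 (by linarith)).le (by linarith)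
    nlinarith

/-- For p = -1 with p' = -1 or -3 the opposite vertex, without the change of sign, is the one that
is too small. -/
lemma digit_cases' {β e p p' : ℝ} (h2 : 0 < β) (h3 : β ≤ 0.1716) (he : 1 ≤ e)
    (h : (p = -1 ∧ p' = -1) ∨ (p = -1 ∧ p' = -3))
    (hm : 0 < (1 - β) * (1 - β ^ 2) + (1 - β ^ 2) * ((1 + β) * e + (p' - e) * β)
      + (p - e) * (1 - 2 * β) * (1 + β) + (p - e) * β * ((1 + β) * e + (p' - e) * β)) : False := by
  rcases h with ⟨rfl, rfl⟩ | ⟨rfl, rfl⟩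
  · have a1 : 0 < β * ((e + 1) * (e - β) - (e - 1 + 2 * β) * (1 + β)) := by
      apply mul_pos h2
      nlinarith
    nlinarith
  · have a1 : 0 < β * ((e + 1) * (e - 3 * β) - (e - 3 + 4 * β) * (1 + β)) := by
      apply mul_pos h2
      nlinarith
    nlinarith

/-- By parity p = t_{-1} + t_0 and p' = t_1 + t_0 are odd. The bounds on s + τ at cells 0 and 1 give
|p - p'| < 4 and -5 < p + p' < 3, the lower bound also using t_0 β < 1. Six pairs remain, and a
vertex inequality refutes each, up to reflection. -/
lemma CellSystem.false_of_pos (hβ : IsBeta R β δ m) (h : CellSystem R m a t x y s τ)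
    (h0 : 0 < t 0) : False := by
  have h2 := hβ.pos
  have h3 := hβ.le
  have v1 := h.vertex_poly hβ
  have v2 := h.neg.vertex_poly hβ
  have v3 := h.reflect.vertex_poly hβ
  have v4 := h.reflect.neg.vertex_poly hβ
  have b1 := h.sum_bound hβ
  have b2 := h.reflect.sum_bound hβ
  have hd := h.digit_zero_le hβ
  simp only [neg_neg, neg_zero] at v2 v3 v4 b2
  push_cast at v2 v4
  obtain ⟨k, hk⟩ := h.parity 0
  obtain ⟨k1, hk1⟩ := h.parity (-1)
  obtain ⟨k2, hk2⟩ := h.parity 1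
  rw [h.a_zero] at hk
  rw [h.a_ne _ (by norm_num)] at hk1 hk2
  obtain ⟨p, hp⟩ : ∃ p, t (-1) = p - t 0 := ⟨t (-1) + t 0, by ring⟩
  obtain ⟨p', hp'⟩ : ∃ p', t 1 = p' - t 0 := ⟨t 1 + t 0, by ring⟩
  rw [hp] at hk1
  rw [hp'] at hk2
  rw [hp, hp'] at v1 v2 v3 v4 b1 b2
  have he : (1 : ℝ) ≤ t 0 := by exact_mod_cast h0
  push_cast at v1 v2 v3 v4 b1 b2
  rw [abs_le] at b1 b2
  have heβ : 0 < t 0 * β := by positivity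
  have hβ2 : 0 ≤ β ^ 2 := by positivity
  have c1 : ((p : ℝ) - p') * (1 - 2 * β) ≤ 9 / 4 := by linarith
  have c2 : -(9 / 4) ≤ ((p : ℝ) - p') * (1 - 2 * β) := by linarith
  have d1 : (p : ℝ) - p' < 4 := by
    by_contra hc
    push Not at hc
    nlinarith
  have d2 : (-4 : ℝ) < p - p' := by
    by_contra hc
    push Not at hc
    nlinarith
  have d3 : (p : ℝ) + p' < 3 := by linarith
  have d4 : (-5 : ℝ) < p + p' := by linarith
  have d1' : p - p' < 4 := by exact_mod_cast d1
  have d2' : -4 < p - p' := by exact_mod_cast d2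
  have d3' : p + p' < 3 := by exact_mod_cast d3
  have d4' : -5 < p + p' := by exact_mod_cast d4
  have cases : (p = 1 ∧ p' = 1) ∨ (p = 1 ∧ p' = -1) ∨ (p' = 1 ∧ p = -1) ∨ (p = -1 ∧ p' = -1) ∨
    (p = -1 ∧ p' = -3) ∨ (p' = -1 ∧ p = -3) := by omega
  rcases cases with ⟨rfl, rfl⟩ | ⟨rfl, rfl⟩ | ⟨rfl, rfl⟩ | ⟨rfl, rfl⟩ | ⟨rfl, rfl⟩ | ⟨rfl, rfl⟩
  · exact digit_cases (p := 1) (p' := 1) h2 h3 he (Or.inl ⟨rfl, rfl⟩) (by push_cast at v2; linarith)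
  · exact digit_cases (p := 1) (p' := -1) h2 h3 he (Or.inr ⟨rfl, rfl⟩)
      (by push_cast at v2; linarith)
  · exact digit_cases (p := 1) (p' := -1) h2 h3 he (Or.inr ⟨rfl, rfl⟩)
      (by push_cast at v4; linarith)
  · exact digit_cases' (p := -1) (p' := -1) h2 h3 he (Or.inl ⟨rfl, rfl⟩)
      (by push_cast at v1; linarith)
  · exact digit_cases' (p := -1) (p' := -3) h2 h3 he (Or.inr ⟨rfl, rfl⟩)
      (by push_cast at v1; linarith)
  · exact digit_cases' (p := -1) (p' := -3) h2 h3 he (Or.inr ⟨rfl, rfl⟩)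
      (by push_cast at v3; linarith)

/-- The limit form of the upper bound for `ρ`. -/
lemma CellSystem.false (hβ : IsBeta R β δ m) (h : CellSystem R m a t x y s τ) (hR : Odd R) :
    False := by
  have hne : t 0 ≠ 0 := by
    intro h0
    have := h.parity 0
    rw [h.a_zero, h0, sub_zero] at this
    exact (Int.not_even_iff_odd.2 hR) this
  rcases lt_or_gt_of_ne hne with h0 | h0
  · exact h.neg.false_of_pos hβ (by simpa using h0)
  · exact h.false_of_pos hβ h0

end

/-! ### Lower bound in the limit: the extremal digit pattern. -/

section

variable {a t : ℤ → ℤ} {x y s τ : ℤ → ℝ} {R : ℤ} {β δ m : ℝ}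

/-- All four vertex products of a cell are at least `m (1 - x y)`. -/
structure GoodCell (m x y s τ : ℝ) : Prop where
  A : m * (1 - x * y) ≤ prodA x y s τ
  A' : m * (1 - x * y) ≤ prodA x y (-s) (-τ)
  B : m * (1 - x * y) ≤ prodB x y s τ
  B' : m * (1 - x * y) ≤ prodB x y (-s) (-τ)

lemma GoodCell.neg {m x y s τ : ℝ} (h : GoodCell m x y s τ) : GoodCell m x y (-s) (-τ) where
  A := h.A'
  A' := by rw [neg_neg, neg_neg]; exact h.A
  B := h.B'
  B' := by rw [neg_neg, neg_neg]; exact h.B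

lemma GoodCell.swap {m x y s τ : ℝ} (h : GoodCell m x y s τ) : GoodCell m y x τ s where
  A := by rw [mul_comm y, prodA_swap]; exact h.A
  A' := by rw [mul_comm y, prodA_swap]; exact h.A'
  B := by rw [mul_comm y, prodB_swap]; exact h.B'
  B' := by rw [mul_comm y, prodB_swap, neg_neg, neg_neg]; exact h.B

lemma IsBeta.delta_sub (hβ : IsBeta R β δ m) : δ ≤ β + 1.21 * β ^ 2 := by
  have h2 := hβ.pos
  have h3 := hβ.le
  have := hβ.delta_eq
  nlinarith [pow_pos h2 2]

lemma IsBeta.m_upper (hβ : IsBeta R β δ m) {x : ℝ} (hx : β ≤ x) :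
    m * (1 + β) * (1 - x * β) ≤ 1 - 2 * β - β ^ 2 + 1.21 * β ^ 3 := by
  have h2 := hβ.pos
  have h3 := hβ.le
  have h5 := hβ.m_pos
  have h6 := hβ.m_lt_one_sub
  have hμ := hβ.mu_eq
  have hK : m * (1 + β) ≤ 1 := by nlinarith
  have hd := hβ.delta_sub
  have e : m * (1 + β) * (1 - x * β) = 1 - 2 * β - β ^ 2 + m * (1 + β) * (β * (δ - x)) := by
    rw [← hμ]; ring
  rw [e]
  have h7 : m * (1 + β) * (β * (δ - x)) ≤ m * (1 + β) * (1.21 * β ^ 3) := by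
    apply mul_le_mul_of_nonneg_left _ (by positivity)
    nlinarith
  have h8 : m * (1 + β) * (1.21 * β ^ 3) ≤ 1 * (1.21 * β ^ 3) :=
    mul_le_mul_of_nonneg_right hK (by positivity)
  linarith

/-- Cells infinitely far from every R, where alternation gives τ = -s and there is room to spare. -/
lemma goodCell_uniform (hβ : IsBeta R β δ m) {s : ℝ}
    (hs : |s| ≤ 2 * (β / (1 + β))) : GoodCell m β β s (-s) := by
  have h2 := hβ.pos
  have h3 := hβ.le
  have hu := hβ.m_upper (le_refl β)
  have hb : β / (1 + β) * (1 + β) = β := by field_simp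
  have hs2 : s ^ 2 * (1 + β) ^ 2 ≤ 4 * β ^ 2 := by
    have : |s| * (1 + β) ≤ 2 * β := by nlinarith
    have h0 : 0 ≤ |s| * (1 + β) := by positivity
    calc s ^ 2 * (1 + β) ^ 2 = (|s| * (1 + β)) ^ 2 := by rw [mul_pow, sq_abs]
      _ ≤ (2 * β) ^ 2 := pow_le_pow_left₀ h0 this 2
      _ = _ := by ring
  have hp : 0 < (1 + β) ^ 2 := by positivity
  have key : m * (1 - β * β) ≤ (1 - β) ^ 2 - s ^ 2 := by
    refine le_of_mul_le_mul_right ?_ hp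
    have h4 := mul_le_mul_of_nonneg_right hu (by linarith : 0 ≤ 1 + β)
    have h5 : (1 - 2 * β - β ^ 2 + 1.21 * β ^ 3) * (1 + β) ≤ (1 - β) ^ 2 * (1 + β) ^ 2 - 4 * β ^ 2 := by
      have : 0 ≤ β * (1 - 3 * β - 0.21 * β ^ 2 - 0.21 * β ^ 3) := by
        apply mul_nonneg h2.le
        have p2 : β ^ 2 ≤ 0.1716 ^ 2 := pow_le_pow_left₀ h2.le h3 2
        have p3 : β ^ 3 ≤ 0.1716 ^ 3 := pow_le_pow_left₀ h2.le h3 3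
        norm_num at p2 p3
        linarith
      linarith
    linarith
  have hsl : |s| ≤ 2 * β := by
    refine hs.trans ?_
    have : β / (1 + β) ≤ β := div_le_self h2.le (by linarith)
    linarith
  obtain ⟨s1, s2⟩ := abs_le.1 hsl
  refine ⟨?_, ?_, ?_, ?_⟩ <;> simp only [prodA, prodB] <;> nlinarith [sq_nonneg s]

/-- Cells on the side with zero digits. The worst one is at R itself, with y = δ and the largest τ;
equality there is the defining formula of C₁. -/
lemma goodCell_left (hβ : IsBeta R β δ m) {y τ : ℝ} (hy : 0 ≤ y) (hy' : y ≤ δ) (hτ : 0 ≤ τ)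
    (hτ' : τ ≤ δ * (1 - 2 * (β / (1 + β)))) : GoodCell m β y 0 τ := by
  have h2 := hβ.pos
  have h3 := hβ.le
  have h4 := hβ.delta_le
  have h5 := hβ.m_pos
  have h6 := hβ.m_lt_one_sub
  have hd := hβ.delta_eq
  have hμ := hβ.mu_eq
  have hb : β / (1 + β) * (1 + β) = β := by field_simp
  have hb0 : 0 ≤ β / (1 + β) := by positivity
  have key : m * (1 - β * y) ≤ (1 - β) * (1 - y - τ) := by
    have e : m * (1 - β * δ) = (1 - β) * (1 - δ - δ * (1 - 2 * (β / (1 + β)))) := by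
      refine mul_right_cancel₀ (by linarith : 1 + β ≠ 0) ?_
      rw [mul_comm β δ, hμ]
      linear_combination (2 * (1 + β) - 2 * (β / (1 + β)) * (1 + β)) * hd - 2 * β * hb
    have h7 : m * β ≤ 1 - β := by nlinarith
    nlinarith [mul_nonneg (sub_nonneg.2 hy') (sub_nonneg.2 h7),
      mul_nonneg (sub_nonneg.2 hτ') (by linarith : 0 ≤ 1 - β)]
  have hτ2 : τ ≤ 1 / 4 := by nlinarith
  refine ⟨?_, ?_, ?_, ?_⟩ <;> simp only [prodA, prodB] <;> nlinarith

/-- The cell just past R towards the digits ±2; here s = δ = x cancels in one factor, and that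
vertex also attains equality. -/
lemma goodCell_one (hβ : IsBeta R β δ m) :
    GoodCell m δ β δ (-(2 * (β / (1 + β)))) := by
  have h2 := hβ.pos
  have h3 := hβ.le
  have hb : β / (1 + β) * (1 + β) = β := by field_simp
  have h4 := hβ.beta_lt_delta
  have hd := hβ.delta_eq
  have hμ := hβ.mu_eq
  have hp : 0 < 1 + β := by linarith
  refine ⟨?_, ?_, ?_, ?_⟩ <;> refine le_of_mul_le_mul_right ?_ hp <;> rw [hμ] <;>
    simp only [prodA, prodB]
  · apply le_of_eq; linear_combination 2 * hb
  · refine le_of_mul_le_mul_right ?_ (by linarith : 0 < 1 - β)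
    have e : (1 - δ + -δ) * (1 - β + - -(2 * (β / (1 + β)))) * (1 + β) * (1 - β) =
      (1 - 3 * β) * (1 + 2 * β - β ^ 2) := by
      linear_combination (-2) * (1 - β ^ 2 + 2 * (β / (1 + β)) * (1 + β)) * hd +
        2 * (1 - 3 * β) * hb
    rw [e]
    nlinarith
  · have e : (1 + δ + δ) * (1 + β - -(2 * (β / (1 + β)))) * (1 + β) =
      (1 + 2 * δ) * ((1 + β) ^ 2 + 2 * β) := by linear_combination 2 * (1 + 2 * δ) * hb
    rw [e]
    nlinarith
  · have e : (1 + δ + -δ) * (1 + β - - -(2 * (β / (1 + β)))) * (1 + β) =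
      1 + β ^ 2 := by linear_combination (-2) * hb
    rw [e]
    nlinarith

/-- Cells further along the digits ±2, up to sign. The value u stays between x(2 - 2δ) and x(2 - β),
and this leaves enough room to absorb the O(β³) error in the threshold. -/
lemma goodCell_right (hβ : IsBeta R β δ m) {x u : ℝ} (hx : β ≤ x) (hx' : x ≤ β + 5 / 4 * β ^ 4)
    (hu : x * (2 - 2 * δ) ≤ u) (hu' : u ≤ x * (2 - β)) :
    GoodCell m x β u (-(2 * (β / (1 + β)))) := by
  have h2 := hβ.pos
  have h3 := hβ.le
  have hb : β / (1 + β) * (1 + β) = β := by field_simp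
  have h4 := hβ.beta_lt_delta
  have h4' := hβ.delta_le
  have hm := hβ.m_upper hx
  have hp : 0 < 1 + β := by linarith
  have hq : β ^ 4 ≤ 0.00506 * β := by
    have : β ^ 3 ≤ 0.1716 ^ 3 := pow_le_pow_left₀ h2.le h3 3
    have := mul_le_mul_of_nonneg_right this h2.le
    calc β ^ 4 = β ^ 3 * β := by ring
      _ ≤ _ := this
      _ ≤ _ := by nlinarith
  have hx2 : x ≤ 1.0064 * β := by linarith
  have p2 : β ^ 2 ≤ 0.1716 * β := by nlinarith
  have p3 : 0 < β ^ 3 := by positivity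
  have p3' : β ^ 3 ≤ 0.1716 * β ^ 2 := by nlinarith [pow_pos h2 2]
  have hμ0 : 0 < 1 - 2 * β - β ^ 2 := by nlinarith
  refine ⟨?_, ?_, ?_, ?_⟩ <;> refine le_of_mul_le_mul_right ?_ hp <;> simp only [prodA, prodB] <;>
    rw [mul_right_comm]
  · refine hm.trans ?_
    have e : (1 - x + u) * (1 - β + -(2 * (β / (1 + β)))) * (1 + β) =
      (1 - x + u) * (1 - 2 * β - β ^ 2) := by linear_combination (-2) * (1 - x + u) * hb
    rw [e]
    have h5 : 0.5 * β ≤ u - x := by nlinarith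
    have := mul_le_mul_of_nonneg_right h5 hμ0.le
    nlinarith
  · refine hm.trans ?_
    have e : (1 - x + -u) * (1 - β + - -(2 * (β / (1 + β)))) * (1 + β) =
      (1 - x - u) * (1 + 2 * β - β ^ 2) := by linear_combination 2 * (1 - x - u) * hb
    rw [e]
    have h5 : 1 - 3.0192 * β + β ^ 2 ≤ 1 - x - u := by nlinarith
    have := mul_le_mul_of_nonneg_right h5 (by nlinarith : 0 ≤ 1 + 2 * β - β ^ 2)
    nlinarith
  · refine hm.trans ?_
    have e : (1 + x + u) * (1 + β - -(2 * (β / (1 + β)))) * (1 + β) =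
      (1 + x + u) * ((1 + β) ^ 2 + 2 * β) := by linear_combination 2 * (1 + x + u) * hb
    rw [e]
    have h5 : 0 ≤ x + u := by nlinarith
    nlinarith
  · refine hm.trans ?_
    have e : (1 + x + -u) * (1 + β - - -(2 * (β / (1 + β)))) * (1 + β) =
      (1 + x - u) * (1 + β ^ 2) := by linear_combination (-2) * (1 + x - u) * hb
    rw [e]
    have h5 : 1 - 1.0064 * β ≤ 1 + x - u := by nlinarith
    have := mul_le_mul_of_nonneg_right h5 (by nlinarith : 0 ≤ 1 + β ^ 2)
    nlinarith

/-- The limit system with digits `…, 0, 0, 1, -2, 2, -2, …`. -/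
lemma SingleSystem.goodCell (hβ : IsBeta R β δ m) (h : SingleSystem R a t x y s τ)
    (h0 : t 0 = 1) (hneg : t (-1) = 0) (hpos : t 1 = -2)
    (hr : ∀ j, 1 ≤ j → t j + t (j + 1) = 0) (hl : ∀ j, j < -1 → t j + t (j + 1) = 0) (j : ℤ) :
    GoodCell m (x j) (y j) (s j) (τ j) := by
  have h2 := hβ.pos
  have h3 := hβ.le
  have hb0 : 0 < β / (1 + β) := by positivity
  have hbb : β / (1 + β) ≤ β := div_le_self h2.le (by linarith)
  have hδ := hβ.beta_lt_delta
  have hδ' := hβ.delta_le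
  have hs0 : ∀ j, j ≤ 0 → s j = t (j - 1) * (β / (1 + β)) := fun j hj =>
    h.toLimitSystem.s_eq hβ (fun i hi => h.a_ne i (by omega)) (fun i hi => hl i (by omega))
  have hτ1 : ∀ j, 1 ≤ j → τ j = t j * (β / (1 + β)) := fun j hj =>
    h.toLimitSystem.τ_eq hβ (fun i hi => h.a_ne i (by omega)) (fun i hi => hr i (by omega))
  have ht0 : ∀ n : ℕ, t (-1 - n) = 0 := by
    intro n
    induction n with
    | zero => simpa using hneg
    | succ n ih =>
      have := hl (-1 - (n + 1)) (by omega)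
      rw [show -1 - ((n : ℤ) + 1) + 1 = -1 - n by ring, ih] at this
      push_cast
      omega
  have hτ0 : τ 0 = δ * (1 - 2 * (β / (1 + β))) := by
    rw [h.τ_rec 0, h.y_zero hβ, h0, zero_add, hτ1 1 le_rfl, hpos]
    push_cast; ring
  have hτneg : ∀ n : ℕ, 0 ≤ τ (-n) ∧ τ (-n) ≤ δ * (1 - 2 * (β / (1 + β))) := by
    intro n
    induction n with
    | zero =>
      simp only [Nat.cast_zero, neg_zero, hτ0, le_refl, and_true]
      apply mul_nonneg <;> linarith
    | succ n ih =>
      have h4 := h.τ_rec (-1 - n)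
      rw [ht0, show -1 - (n : ℤ) + 1 = -n by ring] at h4
      have h5 := h.y_bounds hβ (-1 - n)
      push_cast
      rw [show -((n : ℤ) + 1) = -1 - n by ring, h4]
      simp only [Int.cast_zero, zero_add]
      refine ⟨mul_nonneg (by linarith) ih.1, ?_⟩
      nlinarith [ih.1, ih.2]
  have hs1 : s 1 = δ := by
    have := h.s_rec 0
    rw [hs0 0 le_rfl, h0, zero_add, h.x_one hβ, zero_sub, hneg] at this
    simpa using this
  -- After normalising the sign, u_n = s_{2+n} t_{1+n}/2 satisfies u_{n+1} = x_{3+n}(2 - u_n), and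
  -- the bounds amount to β ≤ u_n ≤ 2δ fed back into this recurrence.
  have hu : ∀ n : ℕ, (t (1 + n) = 2 ∨ t (1 + n) = -2) ∧
      x (2 + n) * (2 - 2 * δ) ≤ s (2 + n) * (t (1 + n) / 2) ∧
      s (2 + n) * (t (1 + n) / 2) ≤ x (2 + n) * (2 - β) := by
    intro n
    induction n with
    | zero =>
      have h4 := h.s_rec 1
      have h5 := h.x_pos 2
      rw [hpos, hs1] at h4
      simp only [Nat.cast_zero, add_zero, hpos]
      rw [show (1 + 1 : ℤ) = 2 from rfl] at h4
      rw [h4]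
      push_cast
      refine ⟨Or.inr trivial, ?_, ?_⟩ <;> nlinarith
    | succ n ih =>
      obtain ⟨i1, i2, i3⟩ := ih
      have h4 := h.s_rec (2 + n)
      have h5 := hr (1 + n) (by omega)
      have h6 := h.x_bounds hβ (2 + n)
      have h7 := h.x_pos (2 + n + 1)
      rw [show (1 : ℤ) + n + 1 = 2 + n by ring] at h5
      push_cast
      rw [show (2 : ℤ) + (n + 1) = 2 + n + 1 by ring, show (1 : ℤ) + (n + 1) = 2 + n by ring]
      have h8 : t (2 + n) = -t (1 + n) := by omega
      have l1 : β ≤ s (2 + n) * (t (1 + n) / 2) := by nlinarith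
      have l2 : s (2 + n) * (t (1 + n) / 2) ≤ 2 * δ := by nlinarith
      have e : s (2 + n + 1) * (t (2 + n) / 2) =
          x (2 + n + 1) * (2 - s (2 + n) * (t (1 + n) / 2)) := by
        rw [h4, h8]
        rcases i1 with i1 | i1 <;> rw [i1] <;> push_cast <;> ring
      rw [e]
      refine ⟨by omega, ?_, ?_⟩ <;> apply mul_le_mul_of_nonneg_left _ h7.le <;> linarith
  rcases le_or_gt j 0 with hj | hj
  · obtain ⟨n, hn⟩ : ∃ n : ℕ, j = -n := ⟨(-j).toNat, by omega⟩
    have e1 : s j = 0 := by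
      rw [hs0 j hj, hn, show -(n : ℤ) - 1 = -1 - n by ring, ht0]; simp
    have hy := h.y_bounds hβ j
    rw [h.x_eq_beta hβ hj, e1]
    rw [hn] at *
    exact goodCell_left hβ (by linarith) hy.2 (hτneg n).1 (hτneg n).2
  · rcases (show j = 1 ∨ 2 ≤ j by omega) with rfl | hj2
    · rw [h.x_one hβ, h.y_eq_beta hβ le_rfl, hs1, hτ1 1 le_rfl, hpos]
      have := goodCell_one hβ
      push_cast
      rwa [neg_mul]
    · obtain ⟨n, hn⟩ : ∃ n : ℕ, j = 2 + n := ⟨(j - 2).toNat, by omega⟩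
      obtain ⟨i1, i2, i3⟩ := hu n
      have h5 := hr (1 + n) (by omega)
      rw [show (1 : ℤ) + n + 1 = 2 + n by ring] at h5
      have hx := h.x_near hβ n
      rw [h.y_eq_beta hβ (by omega), hτ1 j (by omega), hn]
      rcases i1 with i1 | i1
      · have h6 : t (2 + n) = -2 := by omega
        rw [i1] at i2 i3
        rw [h6]
        have := goodCell_right hβ hx.1 hx.2 (u := s (2 + n)) (by simpa using i2) (by simpa using i3)
        push_cast
        rwa [neg_mul]
      · have h6 : t (2 + n) = 2 := by omega
        rw [i1] at i2 i3
        rw [h6]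
        push_cast at i2 i3
        have := (goodCell_right hβ hx.1 hx.2 (u := -s (2 + n)) (by linarith) (by linarith)).neg
        rw [neg_neg, neg_neg] at this
        push_cast
        exact this

/-- The local rules for the digits of the nearly optimal `γ`. -/
structure OptimalRules (R : ℤ) (a t : ℤ → ℤ) : Prop where
  a_mem : ∀ j, a j = R ∨ a j = R + 1
  unique : ∀ i j, a i = R → a j = R → i = j
  even_rule : ∀ j, a j = R + 1 → a (j + 1) = R + 1 → t j + t (j + 1) = 0
  even_mem : ∀ j, a j = R + 1 → |t j| ≤ 2
  odd_rule : ∀ j, a j = R → (t j = 1 ∨ t j = -1) ∧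
    (t (j - 1) = 0 ∧ t (j + 1) = -2 * t j ∨ t (j - 1) = -2 * t j ∧ t (j + 1) = 0)

/-- The limit form of the lower bound for `ρ`. -/
lemma LimitSystem.goodCell (hβ : IsBeta R β δ m) (h : LimitSystem a t x y s τ)
    (hr : OptimalRules R a t) (j : ℤ) : GoodCell m (x j) (y j) (s j) (τ j) := by
  have h2 := hβ.pos
  by_cases hex : ∃ p, a p = R
  · obtain ⟨p, hp⟩ := hex
    have hne : ∀ i, i ≠ p → a i = R + 1 := fun i hi =>
      (hr.a_mem i).resolve_left fun hc => hi (hr.unique i p hc hp)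
    have hS : SingleSystem R (fun j => a (j + p)) (fun j => t (j + p)) (fun j => x (j + p))
        (fun j => y (j + p)) (fun j => s (j + p)) (fun j => τ (j + p)) :=
      ⟨h.shift p, by simpa using hp, fun i hi => hne _ (by omega)⟩
    have hrr : ∀ i, 1 ≤ i → t (i + p) + t (i + 1 + p) = 0 := fun i hi => by
      rw [show i + 1 + p = i + p + 1 by ring]
      exact hr.even_rule _ (hne _ (by omega)) (hne _ (by omega))
    have hll : ∀ i, i < -1 → t (i + p) + t (i + 1 + p) = 0 := fun i hi => by
      rw [show i + 1 + p = i + p + 1 by ring]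
      exact hr.even_rule _ (hne _ (by omega)) (hne _ (by omega))
    obtain ⟨c0, c1⟩ := hr.odd_rule p hp
    rw [show p - 1 = -1 + p by ring, show p + 1 = 1 + p by ring] at c1
    have d1 : ∀ i, 1 ≤ i → t (-i + p) + t (-(i + 1) + p) = 0 ∨ i = 0 := fun i hi => by
      have := hll (-(i + 1)) (by omega)
      rw [show -(i + 1) + 1 + p = -i + p by ring] at this
      omega
    -- The sign of the digit at R and the side carrying zeros give four cases, which `neg` and
    -- `reflect` reduce to one.
    rcases c0 with c0 | c0 <;> rcases c1 with ⟨c1, c2⟩ | ⟨c1, c2⟩ <;>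
      simp only [c0] at c1 c2
    · have := hS.goodCell hβ (by simpa using c0) c1 c2 hrr hll (j - p)
      simpa using this
    · have := hS.reflect.goodCell hβ (by simpa using c0) (by simpa using c2) (by simpa using c1)
        (fun i hi => by have := d1 i hi; omega)
        (fun i hi => by
          have := hrr (-(i + 1)) (by omega)
          rw [show -(i + 1) + 1 + p = -i + p by ring] at this
          omega) (1 - (j - p))
      simpa using this.swap
    · have := hS.neg.goodCell hβ (by simp [c0]) (by simp [c1]) (by simp [c2])
        (fun i hi => by have := hrr i hi; omega) (fun i hi => by have := hll i hi; omega) (j - p)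
      simpa using this.neg
    · have := hS.reflect.neg.goodCell hβ (by simp [c0]) (by simp [c2]) (by simp [c1])
        (fun i hi => by have := d1 i hi; omega)
        (fun i hi => by
          have := hrr (-(i + 1)) (by omega)
          rw [show -(i + 1) + 1 + p = -i + p by ring] at this
          omega) (1 - (j - p))
      simpa using this.neg.swap
  · push Not at hex
    have hall : ∀ i, a i = R + 1 := fun i => (hr.a_mem i).resolve_left (hex i)
    have ht : ∀ i, t i + t (i + 1) = 0 := fun i => hr.even_rule i (hall _) (hall _)
    have hx : x j = β := h.x_eq_beta hβ fun i _ => hall i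
    have hy : y j = β := h.y_eq_beta hβ fun i _ => hall i
    have hs : s j = t (j - 1) * (β / (1 + β)) := h.s_eq hβ (fun i _ => hall i) fun i _ => ht i
    have hτ : τ j = t j * (β / (1 + β)) := h.τ_eq hβ (fun i _ => hall i) fun i _ => ht i
    have e : τ j = -s j := by
      have := ht (j - 1)
      rw [sub_add_cancel] at this
      have : (t (j - 1) : ℝ) + t j = 0 := by exact_mod_cast this
      rw [hs, hτ]
      linear_combination (β / (1 + β)) * this
    rw [hx, hy, e]
    apply goodCell_uniform hβ
    have h5 : |(t (j - 1) : ℝ)| ≤ 2 := by exact_mod_cast hr.even_mem (j - 1) (hall _)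
    rw [hs, abs_mul, abs_of_pos (by positivity : 0 < β / (1 + β))]
    exact mul_le_mul_of_nonneg_right h5 (by positivity)

end

/-! ### Passage to limit systems along an ultrafilter. -/

section

lemma exists_tendsto_of_isCompact {X : Type*} [TopologicalSpace X] {K : Set X} (hK : IsCompact K)
    (U : Ultrafilter ℕ) {f : ℕ → X} (h : ∀ᶠ l in (U : Filter ℕ), f l ∈ K) :
    ∃ x ∈ K, Tendsto f U (𝓝 x) :=
  hK.ultrafilter_le_nhds' (U.map f) h

lemma exists_eventually_eq (U : Ultrafilter ℕ) {f : ℕ → ℤ} (B : ℤ)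
    (h : ∀ᶠ l in (U : Filter ℕ), |f l| ≤ B) : ∃ a, ∀ᶠ l in (U : Filter ℕ), f l = a := by
  obtain ⟨a, -, ha⟩ := exists_tendsto_of_isCompact (K := Set.Icc (-B) B)
    (Set.finite_Icc _ _).isCompact U (f := f) (h.mono fun l hl => abs_le.1 hl)
  rw [nhds_discrete, tendsto_pure] at ha
  exact ⟨a, ha⟩

lemma exists_ultrafilter_of_frequently {p : ℕ → Prop} (h : ∃ᶠ l in atTop, p l) :
    ∃ U : Ultrafilter ℕ, (U : Filter ℕ) ≤ atTop ∧ ∀ᶠ l in (U : Filter ℕ), p l := by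
  have := Filter.frequently_iff_neBot.1 h
  refine ⟨Ultrafilter.of (atTop ⊓ 𝓟 {l | p l}), (Ultrafilter.of_le _).trans inf_le_left, ?_⟩
  exact (Ultrafilter.of_le _).trans inf_le_right (mem_principal_self _)

namespace BoundedChain

variable {α : ℝ} {t : ℕ → ℤ} {S T : ℕ → ℝ}

lemma nS_ge (hα : Irrational α) (h : BoundedChain α t S T) (k : ℕ) :
    -(1 - cfX α k) ≤ nS α S k := by
  have hq := cfQ_succ_pos hα k
  rw [nS, le_div_iff₀ hq]
  linarith [h.S_ge k, cfX_mul_cfQ hα k]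

lemma nS_le (hα : Irrational α) (h : BoundedChain α t S T) (k : ℕ) :
    nS α S k ≤ 1 + cfX α k := by
  have hq := cfQ_succ_pos hα k
  rw [nS, div_le_iff₀ hq]
  linarith [h.S_le k, cfX_mul_cfQ hα k]

lemma nT_ge (hα : Irrational α) (h : BoundedChain α t S T) (k : ℕ) :
    -(1 - negCFRem α k) ≤ nT α T k := by
  have hq := cfE_pos hα k
  rw [nT, le_div_iff₀ hq]
  linarith [h.T_ge k, cfE_succ α k]

lemma nT_le (hα : Irrational α) (h : BoundedChain α t S T) (k : ℕ) :
    nT α T k ≤ 1 + negCFRem α k := by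
  have hq := cfE_pos hα k
  rw [nT, div_le_iff₀ hq]
  linarith [h.T_le k, cfE_succ α k]

lemma nS_succ (hα : Irrational α) (h : BoundedChain α t S T) (k : ℕ) :
    nS α S (k + 1) = cfX α (k + 1) * (t k + nS α S k) := by
  have h1 := (cfQ_succ_pos hα k).ne'
  have h2 := (cfQ_succ_pos hα (k + 1)).ne'
  rw [nS, nS, cfX, h.S_succ]
  field_simp
  ring

lemma nT_eq (hα : Irrational α) (h : BoundedChain α t S T) (k : ℕ) :
    nT α T k = negCFRem α k * (t k + nT α T (k + 1)) := by
  have h1 := (cfE_pos hα k).ne'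
  have h2 := (negCFRem_pos hα k).ne'
  rw [nT, nT, h.T_succ, cfE_succ]
  field_simp

end BoundedChain

/-- The index at distance `j` from `k`. -/
def relIndex (k : ℕ → ℕ) (l : ℕ) (j : ℤ) : ℕ := (k l + j).toNat

/-- `toNat` truncates negative indices, so the shift is correct only once k exceeds |j|. -/
lemma relIndex_succ {k : ℕ → ℕ} {U : Ultrafilter ℕ}
    (hk : ∀ n : ℕ, ∀ᶠ l in (U : Filter ℕ), n ≤ k l) (j : ℤ) :
    ∀ᶠ l in (U : Filter ℕ), relIndex k l (j + 1) = relIndex k l j + 1 := by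
  filter_upwards [hk j.natAbs] with l hl
  unfold relIndex
  omega

/-- Limit systems exist along an ultrafilter. -/
lemma exists_limitSystem {R : ℤ} {α : ℕ → ℝ} {t : ℕ → ℕ → ℤ} {S T : ℕ → ℕ → ℝ} {k : ℕ → ℕ}
    {U : Ultrafilter ℕ} (hα : ∀ l, Irrational (α l))
    (hc : ∀ᶠ l in (U : Filter ℕ), BoundedChain (α l) (t l) (S l) (T l))
    (hk : ∀ n : ℕ, ∀ᶠ l in (U : Filter ℕ), n ≤ k l)
    (ha : ∀ j, ∀ᶠ l in (U : Filter ℕ), negCFDigit (α l) (relIndex k l j) = R ∨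
      negCFDigit (α l) (relIndex k l j) = R + 1) :
    ∃ (a t' : ℤ → ℤ) (x y s τ : ℤ → ℝ), LimitSystem a t' x y s τ ∧
      (∀ j, ∀ᶠ l in (U : Filter ℕ), negCFDigit (α l) (relIndex k l j) = a j) ∧
      (∀ j, ∀ᶠ l in (U : Filter ℕ), t l (relIndex k l j) = t' j) ∧
      (∀ j, Tendsto (fun l => cfX (α l) (relIndex k l j)) U (𝓝 (x j))) ∧
      (∀ j, Tendsto (fun l => negCFRem (α l) (relIndex k l j)) U (𝓝 (y j))) ∧
      (∀ j, Tendsto (fun l => nS (α l) (S l) (relIndex k l j)) U (𝓝 (s j))) ∧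
      (∀ j, Tendsto (fun l => nT (α l) (T l) (relIndex k l j)) U (𝓝 (τ j))) := by
  have hx01 : ∀ l n, cfX (α l) n ∈ Set.Icc (0 : ℝ) 1 := fun l n =>
    ⟨cfX_nonneg (hα l) n, (cfX_lt_one (hα l) n).le⟩
  have hy01 : ∀ l n, negCFRem (α l) n ∈ Set.Icc (0 : ℝ) 1 := fun l n =>
    ⟨(negCFRem_pos (hα l) n).le, (negCFRem_lt_one (hα l) n).le⟩
  have Ha : ∀ j, ∃ b, ∀ᶠ l in (U : Filter ℕ), negCFDigit (α l) (relIndex k l j) = b := by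
    intro j
    apply exists_eventually_eq U (|R| + |R + 1|)
    filter_upwards [ha j] with l hl
    rcases hl with hl | hl <;> rw [hl]
    · linarith [abs_nonneg (R + 1)]
    · linarith [abs_nonneg R]
  have Ht : ∀ j, ∃ b, ∀ᶠ l in (U : Filter ℕ), t l (relIndex k l j) = b := by
    intro j
    apply exists_eventually_eq U (|R| + |R + 1|)
    filter_upwards [ha j, hc] with l hl hcl
    refine (hcl.t_le _).trans ?_
    rcases hl with hl | hl <;> rw [hl]
    · linarith [abs_nonneg (R + 1), le_abs_self R]
    · linarith [abs_nonneg R, le_abs_self (R + 1)]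
  have Hx : ∀ j, ∃ b ∈ Set.Icc (0 : ℝ) 1,
      Tendsto (fun l => cfX (α l) (relIndex k l j)) U (𝓝 b) := fun j =>
    exists_tendsto_of_isCompact isCompact_Icc U (Eventually.of_forall fun l => hx01 l _)
  have Hy : ∀ j, ∃ b ∈ Set.Icc (0 : ℝ) 1,
      Tendsto (fun l => negCFRem (α l) (relIndex k l j)) U (𝓝 b) := fun j =>
    exists_tendsto_of_isCompact isCompact_Icc U (Eventually.of_forall fun l => hy01 l _)
  have Hs : ∀ j, ∃ b ∈ Set.Icc (-2 : ℝ) 2,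
      Tendsto (fun l => nS (α l) (S l) (relIndex k l j)) U (𝓝 b) := fun j =>
    exists_tendsto_of_isCompact isCompact_Icc U (hc.mono fun l hl =>
      ⟨by linarith [hl.nS_ge (hα l) (relIndex k l j), (hx01 l (relIndex k l j)).1],
       by linarith [hl.nS_le (hα l) (relIndex k l j), (hx01 l (relIndex k l j)).2]⟩)
  have Hτ : ∀ j, ∃ b ∈ Set.Icc (-2 : ℝ) 2,
      Tendsto (fun l => nT (α l) (T l) (relIndex k l j)) U (𝓝 b) := fun j =>
    exists_tendsto_of_isCompact isCompact_Icc U (hc.mono fun l hl =>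
      ⟨by linarith [hl.nT_ge (hα l) (relIndex k l j), (hy01 l (relIndex k l j)).1],
       by linarith [hl.nT_le (hα l) (relIndex k l j), (hy01 l (relIndex k l j)).2]⟩)
  choose a ha' using Ha
  choose t' ht' using Ht
  choose x hx hx' using Hx
  choose y hy hy' using Hy
  choose s hs hs' using Hs
  choose τ hτ hτ' using Hτ
  have La : ∀ j, Tendsto (fun l => (negCFDigit (α l) (relIndex k l j) : ℝ)) U (𝓝 (a j)) :=
    fun j => tendsto_const_nhds.congr' ((ha' j).mono fun l hl => by simp only [hl])
  have Lt : ∀ j, Tendsto (fun l => (t l (relIndex k l j) : ℝ)) U (𝓝 (t' j)) :=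
    fun j => tendsto_const_nhds.congr' ((ht' j).mono fun l hl => by simp only [hl])
  refine ⟨a, t', x, y, s, τ, ⟨?_, ?_, ?_, ?_, ?_, hx, hy, fun j => abs_le.2 (hs j),
    fun j => abs_le.2 (hτ j)⟩, ha', ht', hx', hy', hs', hτ'⟩
  · intro j
    refine tendsto_nhds_unique_of_eventuallyEq ((hx' (j + 1)).mul ((La j).sub (hx' j)))
      tendsto_const_nhds ?_
    filter_upwards [relIndex_succ hk j] with l hl
    rw [hl]
    exact cfX_mul (hα l) _
  · intro j
    refine tendsto_nhds_unique_of_eventuallyEq ((hy' j).mul ((La j).sub (hy' (j + 1))))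
      tendsto_const_nhds ?_
    filter_upwards [relIndex_succ hk j] with l hl
    rw [hl]
    exact negCFRem_mul (hα l) _
  · intro j
    refine tendsto_nhds_unique_of_eventuallyEq (hs' (j + 1))
      ((hx' (j + 1)).mul ((Lt j).add (hs' j))) ?_
    filter_upwards [relIndex_succ hk j, hc] with l hl hcl
    rw [hl]
    exact hcl.nS_succ (hα l) _
  · intro j
    refine tendsto_nhds_unique_of_eventuallyEq (hτ' j)
      ((hy' j).mul ((Lt j).add (hτ' (j + 1)))) ?_
    filter_upwards [relIndex_succ hk j, hc] with l hl hcl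
    rw [hl]
    exact hcl.nT_eq (hα l) _
  · intro j
    obtain ⟨l, h1, h2, h3⟩ := ((ha' j).and ((ht' j).and hc)).exists
    rw [← h1, ← h2]
    exact h3.parity _

lemma HasNegCFPeriod.eventually_three_le {R l : ℕ} {α : ℝ} (h : HasNegCFPeriod R l α)
    (hR : 5 ≤ R) : ∀ᶠ k in atTop, 3 ≤ negCFDigit α k := by
  obtain ⟨N, hN⟩ := h
  filter_upwards [eventually_ge_atTop N] with k hk
  obtain ⟨i, rfl⟩ := Nat.exists_eq_add_of_le hk
  rw [hN]
  split_ifs <;> omega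

lemma digit_near {R l N : ℕ} {α : ℝ}
    (hN : ∀ i : ℕ, negCFDigit α (N + i) = if (l + 1) ∣ i then (R : ℤ) else (R : ℤ) + 1)
    {b : ℕ} (hb : 1 ≤ b) {j : ℤ} (hj : j.natAbs ≤ l) :
    negCFDigit α (((N + (l + 1) * b : ℕ) : ℤ) + j).toNat =
      if j = 0 then (R : ℤ) else (R : ℤ) + 1 := by
  have h1 : l + 1 ≤ (l + 1) * b := Nat.le_mul_of_pos_right _ hb
  have e : (((N + (l + 1) * b : ℕ) : ℤ) + j).toNat =
      N + ((((l + 1) * b : ℕ) : ℤ) + j).toNat := by omega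
  rw [e, hN]
  have h2 : (((((l + 1) * b : ℕ) : ℤ) + j).toNat : ℤ) = (l + 1) * b + j := by
    rw [Int.toNat_of_nonneg (by omega)]; push_cast; ring
  have h3 : (l + 1) ∣ ((((l + 1) * b : ℕ) : ℤ) + j).toNat ↔ j = 0 := by
    rw [← Int.natCast_dvd_natCast, h2]
    push_cast
    rw [Int.dvd_add_right (Dvd.intro _ rfl)]
    constructor
    · intro hd
      refine Int.eq_zero_of_abs_lt_dvd hd ?_
      rw [Int.abs_eq_natAbs]
      omega
    · rintro rfl; exact dvd_zero _
  simp only [h3]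

/-- If `c < M(α_l, γ_l)` for arbitrarily large `l`, there is a limit system around a digit `R` with
large vertex products. -/
lemma exists_singleSystem {R : ℕ} (hR : 5 ≤ R) {α : ℕ → ℝ} (hα : ∀ l, Irrational (α l))
    (hper : ∀ l, HasNegCFPeriod R l (α l)) {p : ℕ → Prop} (hp : ∃ᶠ l in atTop, p l) {γ : ℕ → ℝ}
    {t : ℕ → ℕ → ℤ} {S T : ℕ → ℕ → ℝ} (hc : ∀ l, BoundedChain (α l) (t l) (S l) (T l))
    (hr : ∀ l, Represents (α l) (γ l) (S l) (T l)) {c : ℝ}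
    (hγ : ∀ l, p l → (¬ ∃ m n : ℤ, γ l = m + n * α l) ∧ (c : EReal) < M (α l) (γ l)) :
    ∃ (a t' : ℤ → ℤ) (x y s τ : ℤ → ℝ), SingleSystem R a t' x y s τ ∧
      (∀ j, ∃ l k, t' j = t l k) ∧
      (∀ j, -(1 - x j) ≤ s j) ∧ (∀ j, s j ≤ 1 + x j) ∧
      (∀ j, -(1 - y j) ≤ τ j) ∧ (∀ j, τ j ≤ 1 + y j) ∧
      (∀ j, 4 * c * (1 - x j * y j) ≤ |prodA (x j) (y j) (s j) (τ j)|) ∧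
      (∀ j, 4 * c * (1 - x j * y j) ≤ |prodA (x j) (y j) (-s j) (-τ j)|) := by
  obtain ⟨U, hU, hpU⟩ := exists_ultrafilter_of_frequently hp
  have hK : ∀ l, ∃ K, p l → ∀ k, K ≤ k →
      4 * c * (1 - cfX (α l) k * negCFRem (α l) k) <
        |prodA (cfX (α l) k) (negCFRem (α l) k) (nS (α l) (S l) k) (nT (α l) (T l) k)| ∧
      4 * c * (1 - cfX (α l) k * negCFRem (α l) k) <
        |prodA (cfX (α l) k) (negCFRem (α l) k) (-nS (α l) (S l) k) (-nT (α l) (T l) k)| := by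
    intro l
    by_cases hl : p l
    · obtain ⟨K, hK⟩ := eventually_atTop.1 (eventually_lt_prodA (hα l)
        ((hper l).eventually_three_le hR) (hc l).toCellChain (hr l)
        (fun k => abs_le.2 ⟨by
          have := (hc l).T_ge k
          have := cfE_pos (hα l) (k + 1)
          linarith, (hc l).T_le k⟩) (hγ l hl).1 (hγ l hl).2)
      exact ⟨K, fun _ => hK⟩
    · exact ⟨0, fun h => (hl h).elim⟩
  choose K hK using hK
  choose N hN using hper
  -- A place of a digit R, in a block so late that the whole window of radius l around it lies in
  -- the periodic part and beyond the threshold K.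
  set k : ℕ → ℕ := fun l => N l + (l + 1) * (K l + l + 1) with hkdef
  have hkl : ∀ l, K l + l ≤ k l := by
    intro l
    have : K l + l + 1 ≤ (l + 1) * (K l + l + 1) := Nat.le_mul_of_pos_left _ (by omega)
    simp only [hkdef]; omega
  have hlarge : ∀ n : ℕ, ∀ᶠ l in (U : Filter ℕ), n ≤ l := fun n => hU (eventually_ge_atTop n)
  have hdig : ∀ j, ∀ᶠ l in (U : Filter ℕ), negCFDigit (α l) (relIndex k l j) =
      if j = 0 then (R : ℤ) else (R : ℤ) + 1 := by
    intro j
    filter_upwards [hlarge j.natAbs] with l hl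
    exact digit_near (hN l) (by omega) hl
  obtain ⟨a, t', x, y, s, τ, hsys, ha, ht, hx, hy, hs, hτ⟩ :=
    exists_limitSystem (R := R) (k := k) (U := U) hα (Eventually.of_forall hc)
    (fun n => (hlarge n).mono fun l hl => by have := hkl l; omega) (fun j => by
      filter_upwards [hdig j] with l hl
      rw [hl]; split_ifs <;> simp)
  have hav : ∀ j, a j = if j = 0 then (R : ℤ) else (R : ℤ) + 1 := by
    intro j
    obtain ⟨l, h1, h2⟩ := ((ha j).and (hdig j)).exists
    rw [← h1, h2]
  have hprod : ∀ j, ∀ᶠ l in (U : Filter ℕ), p l ∧ K l ≤ relIndex k l j := by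
    intro j
    filter_upwards [hpU, hlarge j.natAbs] with l h1 h2
    refine ⟨h1, ?_⟩
    have := hkl l
    unfold relIndex
    omega
  refine ⟨a, t', x, y, s, τ, ⟨hsys, by simp [hav], fun j hj => by simp [hav, hj]⟩, ?_, ?_, ?_, ?_,
    ?_, ?_, ?_⟩
  · intro j
    obtain ⟨l, h1⟩ := (ht j).exists
    exact ⟨l, _, h1.symm⟩
  · intro j
    exact le_of_tendsto_of_tendsto' ((hx j).const_sub 1).neg (hs j) fun l => (hc l).nS_ge (hα l) _
  · intro j
    exact le_of_tendsto_of_tendsto' (hs j) ((hx j).const_add 1) fun l => (hc l).nS_le (hα l) _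
  · intro j
    exact le_of_tendsto_of_tendsto' ((hy j).const_sub 1).neg (hτ j) fun l => (hc l).nT_ge (hα l) _
  · intro j
    exact le_of_tendsto_of_tendsto' (hτ j) ((hy j).const_add 1) fun l => (hc l).nT_le (hα l) _
  · intro j
    refine le_of_tendsto_of_tendsto ((((hx j).mul (hy j)).const_sub 1).const_mul (4 * c))
      ((((hx j).const_sub 1).add (hs j)).mul (((hy j).const_sub 1).add (hτ j))).abs ?_
    filter_upwards [hprod j] with l hl
    exact (hK l hl.1 _ hl.2).1.le
  · intro j
    refine le_of_tendsto_of_tendsto ((((hx j).mul (hy j)).const_sub 1).const_mul (4 * c))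
      ((((hx j).const_sub 1).add (hs j).neg).mul (((hy j).const_sub 1).add (hτ j).neg)).abs ?_
    filter_upwards [hprod j] with l hl
    exact (hK l hl.1 _ hl.2).2.le

end

/-! ### The upper bound for ρ, and γ*. -/

section

lemma beta_mul {R : ℕ} (hR : 5 ≤ R) : beta R * (R + 1 - beta R) = 1 := by
  have h5 : (5 : ℝ) ≤ R := by exact_mod_cast hR
  have h := Real.sq_sqrt (show (0 : ℝ) ≤ ((R : ℝ) + 1) ^ 2 - 4 by nlinarith)
  unfold beta
  linear_combination (-1 / 4) * h

lemma isBeta {R : ℕ} (hR : 5 ≤ R) : IsBeta R (beta R) (delta R) (4 * limitValue R) := by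
  have h5 : (5 : ℝ) ≤ R := by exact_mod_cast hR
  have hb := beta_mul hR
  have hlt : beta R < 1 := by
    have h : (R - 1 : ℝ) < √(((R : ℝ) + 1) ^ 2 - 4) := by
      apply Real.lt_sqrt_of_sq_lt
      nlinarith
    unfold beta
    linarith
  have hpos : 0 < beta R := by
    by_contra hc
    push Not at hc
    nlinarith
  have hle : beta R ≤ 0.1716 := by
    by_contra hc
    push Not at hc
    nlinarith
  have hd : delta R * (1 - beta R) = beta R := by
    have : (R - beta R : ℝ) ≠ 0 := by linarith
    unfold delta
    field_simp
    linarith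
  refine ⟨hpos, hle, by exact_mod_cast hb, hd, ?_⟩
  have hμ : (1 - delta R * beta R) * (1 - beta R) = 1 - beta R - beta R ^ 2 := by
    linear_combination (-beta R) * hd
  have h1 : 1 - delta R * beta R ≠ 0 := by
    intro h0
    rw [h0, zero_mul] at hμ
    nlinarith
  have h2 : 1 + beta R ≠ 0 := by linarith
  rw [← hμ]
  unfold limitValue
  field_simp
  linear_combination (-2 * (1 - beta R)) * hd

/-- `limitValue R` dominates the value of a cell with vanishing centre at a digit `R`. -/
lemma IsBeta.center_lt {R : ℤ} {β δ m : ℝ} (hβ : IsBeta R β δ m) :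
    (1 - β) * (1 - 2 * δ) < m * (1 - β * δ) := by
  have h2 := hβ.pos
  have h3 := hβ.le
  have hd := hβ.delta_eq
  have hμ := hβ.mu_eq
  refine lt_of_mul_lt_mul_right ?_ (by linarith : 0 ≤ 1 + β)
  rw [mul_comm β δ, hμ]
  nlinarith

/-- Eventually `ρ(α_l) ≤ c` for every `c` above the limit value. -/
lemma eventually_rho_le {R : ℕ} (hR : 5 ≤ R) (hodd : Odd R) {α : ℕ → ℝ}
    (hα : ∀ l, Irrational (α l)) (hper : ∀ l, HasNegCFPeriod R l (α l)) {c : ℝ}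
    (hc : limitValue R < c) : ∀ᶠ l in atTop, rho (α l) ≤ c := by
  by_contra hcon
  have hcon' : ∃ᶠ l in atTop, (c : EReal) < rho (α l) := by
    refine Filter.Frequently.mono (not_eventually.1 hcon) fun l hl => ?_
    exact not_le.1 hl
  have hγ : ∀ l, ∃ γ : ℝ, (c : EReal) < rho (α l) →
      (¬ ∃ m n : ℤ, γ = m + n * α l) ∧ (c : EReal) < M (α l) γ := by
    intro l
    by_cases hl : (c : EReal) < rho (α l)
    · obtain ⟨v, ⟨γ, h1, rfl⟩, h2⟩ := lt_sSup_iff.1 hl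
      exact ⟨γ, fun _ => ⟨h1, h2⟩⟩
    · exact ⟨0, fun h => (hl h).elim⟩
  choose γ hγ using hγ
  choose t S T hch hrep using fun l => exists_boundedChain (hα l) (γ l)
  obtain ⟨a, t', x, y, s, τ, hs, -, h1, h2, h3, h4, h5, h6⟩ :=
    exists_singleSystem hR hα hper hcon' hch hrep hγ
  have hβ := isBeta hR
  have hpos : ∀ j, 0 < 1 - x j * y j := by
    intro j
    have hx := hs.x_bounds hβ j
    have hy := hs.y_bounds hβ j
    have := hβ.pos
    have := hβ.delta_le
    nlinarith
  -- Limits preserve only ≤; the gap between c and `limitValue R` restores the strict inequalities.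
  have hcell := hs.cellSystem hβ h1 h2 h3 h4
    (fun j => lt_of_lt_of_le (mul_lt_mul_of_pos_right (by linarith) (hpos j)) (h5 j))
    (fun j => lt_of_lt_of_le (mul_lt_mul_of_pos_right (by linarith) (hpos j)) (h6 j))
  exact hcell.false hβ (by exact_mod_cast hodd)

/-- Eventually `M(α_l, γ*) ≤ c` for a `c` below the limit value. -/
lemma exists_eventually_M_gammaStar_le {R : ℕ} (hR : 5 ≤ R) (hodd : Odd R) {α : ℕ → ℝ}
    (hα : ∀ l, Irrational (α l)) (hper : ∀ l, HasNegCFPeriod R l (α l)) :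
    ∃ c < limitValue R, ∀ᶠ l in atTop, M (α l) (gammaStar (α l)) ≤ (c : ℝ) := by
  have hβ := isBeta hR
  have hb0 := hβ.pos
  have hb1 := hβ.le
  have hd0 := hβ.beta_lt_delta
  have hd1 := hβ.delta_le
  have hcl := hβ.center_lt
  set β := beta R
  set δ := delta R
  have hp : 0 < 1 - β * δ := by nlinarith
  -- Any value strictly between the normalised vertex product of γ* at R and 4C₁ works.
  obtain ⟨c4, hc1, hc2⟩ := exists_between ((div_lt_iff₀ hp).2 hcl)
  rw [div_lt_iff₀ hp] at hc1
  refine ⟨c4 / 4, by linarith, ?_⟩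
  by_contra hcon
  have hcon' : ∃ᶠ l in atTop, ((c4 / 4 : ℝ) : EReal) < M (α l) (gammaStar (α l)) := by
    refine Filter.Frequently.mono (not_eventually.1 hcon) fun l hl => ?_
    exact not_le.1 hl
  have h3 := fun l => (hper l).eventually_three_le hR
  have ht : ∀ l k, |tStar (α l) k| ≤ negCFDigit (α l) k - 2 := fun l k =>
    abs_le_sub_two_of_parity (two_le_negCFDigit (hα l) k) (abs_tStar_le _ k) (even_sub_tStar _ k)
  have ht' : ∀ l, ∀ᶠ k in atTop, |tStar (α l) k| < negCFDigit (α l) k - 2 := by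
    intro l
    obtain ⟨N, hN⟩ := hper l
    filter_upwards [eventually_ge_atTop N] with k hk
    obtain ⟨i, rfl⟩ := Nat.exists_eq_add_of_le hk
    refine (abs_tStar_le _ _).trans_lt ?_
    rw [hN]
    split_ifs <;> omega
  have hdiv := fun l => dividedChain_of_digits (hα l) (h3 l) (ht l) (ht' l) (even_sub_tStar (α l))
  have hrep : ∀ l, Represents (α l) (gammaStar (α l)) (headSum (α l) (tStar (α l)))
      (tailSum (α l) (tStar (α l))) := by
    intro l
    rw [gammaStar_eq (hα l) (h3 l)]
    exact represents_of_digits _ _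
  obtain ⟨a, t', x, y, s, τ, hs, htt, -, -, -, -, h5, h6⟩ :=
    exists_singleSystem hR hα hper hcon' (fun l => (hdiv l).boundedChain (hα l)) hrep
      (fun l hl => ⟨(hdiv l).not_lattice (hα l) (h3 l) (hrep l), hl⟩)
  have ht1 : ∀ j, |t' j| ≤ 1 := by
    intro j
    obtain ⟨l, k, hlk⟩ := htt j
    rw [hlk]; exact abs_tStar_le _ _
  -- Digits of size at most 1 and even parity vanish, so s_0 = τ_1 = 0 and only t_0 = ±1 remains.
  have hz : ∀ j, j ≠ 0 → t' j = 0 := by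
    intro j hj
    obtain ⟨b, hb⟩ := hs.parity j
    rw [hs.a_ne j hj] at hb
    have := abs_le.1 (ht1 j)
    obtain ⟨r, hr⟩ := hodd
    omega
  have h0 : t' 0 = 1 ∨ t' 0 = -1 := by
    obtain ⟨b, hb⟩ := hs.parity 0
    rw [hs.a_zero] at hb
    have := abs_le.1 (ht1 0)
    obtain ⟨r, hr⟩ := hodd
    omega
  have hs0 : s 0 = 0 := by
    rw [hs.toLimitSystem.s_eq hβ (fun i hi => hs.a_ne i (by omega))
      (fun i hi => by rw [hz i (by omega), hz (i + 1) (by omega)]; rfl), hz _ (by norm_num)]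
    simp
  have hτ1 : τ 1 = 0 := by
    rw [hs.toLimitSystem.τ_eq hβ (j := 1) (fun i hi => hs.a_ne i (by omega))
      (fun i hi => by rw [hz i (by omega), hz (i + 1) (by omega)]; rfl), hz _ (by norm_num)]
    simp
  have hτ0 : τ 0 = δ * t' 0 := by
    rw [hs.τ_rec 0, hs.y_zero hβ, zero_add, hτ1, add_zero]
  have a5 := h5 0
  have a6 := h6 0
  rw [hs.x_eq_beta hβ le_rfl, hs.y_zero hβ, hs0, hτ0] at a5 a6
  unfold prodA at a5 a6
  have hnn : 0 ≤ (1 - β) * (1 - 2 * δ) := mul_nonneg (by linarith) (by linarith)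
  rcases h0 with h0 | h0 <;> rw [h0] at a5 a6
  · rw [show (1 - β + -0) * (1 - δ + -(δ * ((1 : ℤ) : ℝ))) = (1 - β) * (1 - 2 * δ) by
      push_cast; ring, abs_of_nonneg hnn] at a6
    linarith
  · rw [show (1 - β + 0) * (1 - δ + δ * ((-1 : ℤ) : ℝ)) = (1 - β) * (1 - 2 * δ) by
      push_cast; ring, abs_of_nonneg hnn] at a5
    linarith

/-! ### Construction of nearly optimal γ, and the limit of ρ. -/

/-- The digits of a nearly optimal `γ` in a block: `b` is the number of the block, and `p` is the
place in it. -/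
def blockDigit (l b p : ℕ) : ℤ :=
  if Odd b then (if p = 0 then 1 else 2 * (-1) ^ p) else (if p = 0 then (-1) ^ (l + 1) else 0)

/-- The digits of a nearly optimal `γ`. -/
def optDigit (l N : ℕ) (a : ℕ → ℤ) (k : ℕ) : ℤ :=
  if k < N then a k % 2 else blockDigit l ((k - N) / (l + 1)) ((k - N) % (l + 1))

lemma optDigit_add (l N : ℕ) (a : ℕ → ℤ) {b p : ℕ} (hp : p < l + 1) :
    optDigit l N a (N + ((l + 1) * b + p)) = blockDigit l b p := by
  unfold optDigit
  rw [if_neg (by omega), Nat.add_sub_cancel_left, Nat.mul_add_div (by omega),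
    Nat.div_eq_of_lt hp, Nat.mul_add_mod, Nat.mod_eq_of_lt hp, add_zero]

lemma blockDigit_zero (l b : ℕ) : blockDigit l b 0 = 1 ∨ blockDigit l b 0 = -1 := by
  unfold blockDigit
  rw [if_pos rfl, if_pos rfl]
  split_ifs
  · exact Or.inl rfl
  · exact neg_one_pow_eq_or ℤ _

lemma blockDigit_pos (l b : ℕ) {p : ℕ} (hp : p ≠ 0) :
    Even (blockDigit l b p) ∧ |blockDigit l b p| ≤ 2 := by
  unfold blockDigit
  rw [if_neg hp, if_neg hp]
  split_ifs <;> simp [abs_mul, abs_pow]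

lemma blockDigit_succ (l b : ℕ) {p : ℕ} (hp : p ≠ 0) :
    blockDigit l b p + blockDigit l b (p + 1) = 0 := by
  unfold blockDigit
  rw [if_neg hp, if_neg hp, if_neg p.succ_ne_zero, if_neg p.succ_ne_zero, pow_succ]
  split_ifs <;> ring

/-- Odd-numbered blocks carry ±2 and even-numbered ones carry 0, so each R has zeros on exactly one
side. An odd block ends with 2(-1)^l, which dictates the sign (-1)^(l+1) at the start of the next
block. -/
lemma blockDigit_neighbours {l : ℕ} (b : ℕ) (hl : 1 ≤ l) :
    blockDigit l b l = 0 ∧ blockDigit l (b + 1) 1 = -2 * blockDigit l (b + 1) 0 ∨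
    blockDigit l b l = -2 * blockDigit l (b + 1) 0 ∧ blockDigit l (b + 1) 1 = 0 := by
  have hl' : l ≠ 0 := by omega
  unfold blockDigit
  by_cases hb : Odd b
  · right
    have : ¬ Odd (b + 1) := by rw [Nat.not_odd_iff_even]; exact hb.add_one
    simp [hb, this, hl', pow_succ]
  · left
    have : Odd (b + 1) := (Nat.not_odd_iff_even.1 hb).add_one
    simp [hb, this, hl']

lemma exists_block (l i : ℕ) : ∃ b p, p < l + 1 ∧ i = (l + 1) * b + p :=
  ⟨i / (l + 1), i % (l + 1), Nat.mod_lt _ (by omega), (Nat.div_add_mod i (l + 1)).symm⟩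

lemma dvd_block {l b p : ℕ} (hp : p < l + 1) : (l + 1) ∣ (l + 1) * b + p ↔ p = 0 := by
  rw [Nat.dvd_add_right (Dvd.intro _ rfl)]
  constructor
  · intro h; exact Nat.eq_zero_of_dvd_of_lt h hp
  · rintro rfl; exact dvd_zero _

section OptDigit

variable {R l N : ℕ} {a : ℕ → ℤ}

lemma digit_block (ha : ∀ i : ℕ, a (N + i) = if (l + 1) ∣ i then (R : ℤ) else (R : ℤ) + 1)
    {b p : ℕ} (hp : p < l + 1) :
    a (N + ((l + 1) * b + p)) = if p = 0 then (R : ℤ) else (R : ℤ) + 1 := by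
  rw [ha]; simp only [dvd_block hp]

lemma optDigit_basic (ha : ∀ i : ℕ, a (N + i) = if (l + 1) ∣ i then (R : ℤ) else (R : ℤ) + 1)
    (hR : 5 ≤ R) (hodd : Odd R) {k : ℕ} (hk : N ≤ k) :
    Even (a k - optDigit l N a k) ∧ |optDigit l N a k| < a k - 2 ∧ |optDigit l N a k| ≤ 2 := by
  obtain ⟨i, rfl⟩ := Nat.exists_eq_add_of_le hk
  obtain ⟨b, p, hp, rfl⟩ := exists_block l i
  rw [optDigit_add l N a hp, digit_block ha hp]
  obtain ⟨r, hr⟩ := hodd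
  by_cases h0 : p = 0
  · subst h0
    rw [if_pos rfl]
    rcases blockDigit_zero l b with h | h <;> rw [h]
    · exact ⟨⟨r, by omega⟩, by simp; omega, by simp⟩
    · exact ⟨⟨r + 1, by omega⟩, by simp; omega, by simp⟩
  · rw [if_neg h0]
    obtain ⟨⟨e, he⟩, h2⟩ := blockDigit_pos l b h0
    exact ⟨⟨r + 1 - e, by omega⟩, by omega, h2⟩

/-- Before the period only admissibility matters, as the vertex bounds are needed from some cell on;
the residue mod 2 always qualifies. -/
lemma optDigit_early {k : ℕ} (hk : k < N) (ha2 : 2 ≤ a k) :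
    Even (a k - optDigit l N a k) ∧ |optDigit l N a k| ≤ a k - 2 := by
  have e : optDigit l N a k = a k % 2 := if_pos hk
  rw [e]
  have h1 : Even (a k - a k % 2) := ⟨a k / 2, by omega⟩
  refine ⟨h1, abs_le_sub_two_of_parity ha2 ?_ h1⟩
  rw [abs_le]
  omega

lemma optDigit_even_rule
    (ha : ∀ i : ℕ, a (N + i) = if (l + 1) ∣ i then (R : ℤ) else (R : ℤ) + 1) {k : ℕ} (hk : N ≤ k)
    (h1 : a k = R + 1) (h2 : a (k + 1) = R + 1) :
    optDigit l N a k + optDigit l N a (k + 1) = 0 := by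
  obtain ⟨i, rfl⟩ := Nat.exists_eq_add_of_le hk
  obtain ⟨b, p, hp, rfl⟩ := exists_block l i
  rw [digit_block ha hp] at h1
  have h0 : p ≠ 0 := by
    rintro rfl
    simp at h1
  have hp1 : p + 1 < l + 1 := by
    by_contra hc
    have : p + 1 = l + 1 := by omega
    rw [show N + ((l + 1) * b + p) + 1 = N + ((l + 1) * (b + 1) + 0) by
      rw [mul_add]; omega, digit_block ha (Nat.succ_pos l)] at h2
    simp at h2
  rw [show N + ((l + 1) * b + p) + 1 = N + ((l + 1) * b + (p + 1)) by ring,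
    optDigit_add l N a hp, optDigit_add l N a hp1]
  exact blockDigit_succ l b h0

lemma optDigit_odd_rule
    (ha : ∀ i : ℕ, a (N + i) = if (l + 1) ∣ i then (R : ℤ) else (R : ℤ) + 1) (hl : 1 ≤ l)
    {k : ℕ} (hk : N ≤ k) (h1 : a (k + 1) = R) :
    (optDigit l N a (k + 1) = 1 ∨ optDigit l N a (k + 1) = -1) ∧
    (optDigit l N a k = 0 ∧ optDigit l N a (k + 1 + 1) = -2 * optDigit l N a (k + 1) ∨
      optDigit l N a k = -2 * optDigit l N a (k + 1) ∧ optDigit l N a (k + 1 + 1) = 0) := by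
  obtain ⟨i, rfl⟩ := Nat.exists_eq_add_of_le hk
  obtain ⟨b, p, hp, rfl⟩ := exists_block l i
  have hpl : p = l := by
    by_contra hc
    have hp1 : p + 1 < l + 1 := by omega
    rw [show N + ((l + 1) * b + p) + 1 = N + ((l + 1) * b + (p + 1)) by ring,
      digit_block ha hp1] at h1
    simp at h1
  subst hpl
  rw [show N + ((p + 1) * b + p) + 1 = N + ((p + 1) * (b + 1) + 0) by ring,
    show N + ((p + 1) * (b + 1) + 0) + 1 = N + ((p + 1) * (b + 1) + 1) by ring,
    optDigit_add p N a hp, optDigit_add p N a (Nat.succ_pos p),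
    optDigit_add p N a (by omega : 1 < p + 1)]
  exact ⟨blockDigit_zero _ _, blockDigit_neighbours b hl⟩

end OptDigit

lemma optDigit_dividedChain {R l N : ℕ} {α : ℝ} (hα : Irrational α) (hR : 5 ≤ R) (hodd : Odd R)
    (hN : ∀ i : ℕ, negCFDigit α (N + i) = if (l + 1) ∣ i then (R : ℤ) else (R : ℤ) + 1) :
    DividedChain α (optDigit l N (negCFDigit α)) (headSum α (optDigit l N (negCFDigit α)))
      (tailSum α (optDigit l N (negCFDigit α))) := by
  refine dividedChain_of_digits hα (HasNegCFPeriod.eventually_three_le ⟨N, hN⟩ hR) ?_ ?_ ?_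
  · intro k
    rcases lt_or_ge k N with hk | hk
    · exact (optDigit_early hk (two_le_negCFDigit hα k)).2
    · exact (optDigit_basic hN hR hodd hk).2.1.le
  · filter_upwards [eventually_ge_atTop N] with k hk
    exact (optDigit_basic hN hR hodd hk).2.1
  · intro k
    rcases lt_or_ge k N with hk | hk
    · exact (optDigit_early hk (two_le_negCFDigit hα k)).1
    · exact (optDigit_basic hN hR hodd hk).1

/-- Eventually `c ≤ ρ(α_l)` for every `c` below the limit value. -/
lemma eventually_le_rho {R : ℕ} (hR : 5 ≤ R) (hodd : Odd R) {α : ℕ → ℝ}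
    (hα : ∀ l, Irrational (α l)) (hper : ∀ l, HasNegCFPeriod R l (α l)) {c : ℝ}
    (hc : c < limitValue R) : ∀ᶠ l in atTop, (c : EReal) ≤ rho (α l) := by
  by_contra hcon
  obtain ⟨U, hU, hpU⟩ := exists_ultrafilter_of_frequently (not_eventually.1 hcon)
  have h3 := fun l => (hper l).eventually_three_le hR
  choose N hN using hper
  set t : ℕ → ℕ → ℤ := fun l => optDigit l (N l) (negCFDigit (α l)) with htdef
  have hdiv : ∀ l, DividedChain (α l) (t l) (headSum (α l) (t l)) (tailSum (α l) (t l)) :=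
    fun l => optDigit_dividedChain (hα l) hR hodd (hN l)
  have hrep := fun l => represents_of_digits (α l) (t l)
  -- If ρ(α_l) < c, some cell beyond any prescribed place violates a vertex inequality. Starting at
  -- N + l + 1 puts the window of radius l around it inside the periodic part.
  have hbad : ∀ l, ∃ k, N l + l + 1 ≤ k ∧ (¬ (c : EReal) ≤ rho (α l) →
      ¬ ((4 * c * (1 - cfX (α l) k * negCFRem (α l) k) ≤ prodA (cfX (α l) k) (negCFRem (α l) k)
          (nS (α l) (headSum (α l) (t l)) k) (nT (α l) (tailSum (α l) (t l)) k) ∧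
        4 * c * (1 - cfX (α l) k * negCFRem (α l) k) ≤ prodB (cfX (α l) k) (negCFRem (α l) k)
          (nS (α l) (headSum (α l) (t l)) k) (nT (α l) (tailSum (α l) (t l)) k)) ∧
        4 * c * (1 - cfX (α l) k * negCFRem (α l) k) ≤ prodA (cfX (α l) k) (negCFRem (α l) k)
          (-nS (α l) (headSum (α l) (t l)) k) (-nT (α l) (tailSum (α l) (t l)) k) ∧
        4 * c * (1 - cfX (α l) k * negCFRem (α l) k) ≤ prodB (cfX (α l) k) (negCFRem (α l) k)
          (-nS (α l) (headSum (α l) (t l)) k) (-nT (α l) (tailSum (α l) (t l)) k))) := by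
    intro l
    by_cases hl : (c : EReal) ≤ rho (α l)
    · exact ⟨_, le_rfl, fun h => (h hl).elim⟩
    · by_contra hall
      push Not at hall
      apply hl
      have hM := (hdiv l).le_M (hα l) (hrep l) (c := c) (K := N l + l + 1)
        (fun k hk => ((hall k hk).2).1) (fun k hk => by
          rw [nS_neg, nT_neg]; exact ((hall k hk).2).2)
      exact hM.trans (le_sSup ⟨_, (hdiv l).not_lattice (hα l) (h3 l) (hrep l), rfl⟩)
  choose k hk hbad using hbad
  have hlarge : ∀ n : ℕ, ∀ᶠ l in (U : Filter ℕ), n ≤ l := fun n => hU (eventually_ge_atTop n)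
  have hidx : ∀ j, ∀ᶠ l in (U : Filter ℕ), N l ≤ relIndex k l j ∧ relIndex k l j = k l + j := by
    intro j
    filter_upwards [hlarge j.natAbs] with l hl
    have := hk l
    unfold relIndex
    omega
  have hdig : ∀ j, ∀ᶠ l in (U : Filter ℕ), negCFDigit (α l) (relIndex k l j) = (R : ℤ) ∨
      negCFDigit (α l) (relIndex k l j) = (R : ℤ) + 1 := by
    intro j
    filter_upwards [hidx j] with l hl
    obtain ⟨i, hi⟩ := Nat.exists_eq_add_of_le hl.1
    rw [hi, hN]
    split_ifs <;> simp
  have hkn : ∀ n : ℕ, ∀ᶠ l in (U : Filter ℕ), n ≤ k l := fun n =>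
    (hlarge n).mono fun l hl => by have := hk l; omega
  obtain ⟨a, t', x, y, s, τ, hsys, ha, ht, hx, hy, hs, hτ⟩ :=
    exists_limitSystem (R := R) (k := k) (U := U) hα
      (Eventually.of_forall fun l => (hdiv l).boundedChain (hα l)) hkn hdig
  have hrules : OptimalRules R a t' := by
    refine ⟨fun j => ?_, fun i j hi hj => ?_, fun j h1 h2 => ?_, fun j h1 => ?_, fun j h1 => ?_⟩
    · obtain ⟨l, h1, h2⟩ := ((ha j).and (hdig j)).exists
      rwa [h1] at h2
    · obtain ⟨l, h1, h2, h3, h4, h5⟩ := ((ha i).and ((ha j).and ((hidx i).and ((hidx j).and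
        (hlarge (i - j).natAbs))))).exists
      rw [hi] at h1
      rw [hj] at h2
      obtain ⟨u, hu⟩ := Nat.exists_eq_add_of_le h3.1
      obtain ⟨v, hv⟩ := Nat.exists_eq_add_of_le h4.1
      rw [hu, hN] at h1
      rw [hv, hN] at h2
      have d1 : (l + 1) ∣ u := by by_contra hd; rw [if_neg hd] at h1; omega
      have d2 : (l + 1) ∣ v := by by_contra hd; rw [if_neg hd] at h2; omega
      have d3 : ((l + 1 : ℕ) : ℤ) ∣ i - j := by
        have := dvd_sub (Int.natCast_dvd_natCast.2 d1) (Int.natCast_dvd_natCast.2 d2)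
        rwa [show (u : ℤ) - v = i - j by omega] at this
      have := Int.eq_zero_of_abs_lt_dvd d3 (by rw [Int.abs_eq_natAbs]; omega)
      omega
    · obtain ⟨l, g1, g2, g3, g4, g5, g6⟩ := ((ha j).and ((ha (j + 1)).and ((ht j).and
        ((ht (j + 1)).and ((hidx j).and (relIndex_succ hkn j)))))).exists
      rw [← g3, ← g4, g6]
      rw [h1] at g1
      rw [g6, h2] at g2
      exact optDigit_even_rule (hN l) g5.1 g1 g2
    · obtain ⟨l, g1, g2⟩ := ((ht j).and (hidx j)).exists
      rw [← g1]
      exact (optDigit_basic (hN l) hR hodd g2.1).2.2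
    · obtain ⟨l, g1, g2, g3, g4, g5, g6, g7, g8⟩ := ((ha j).and ((ht (j - 1)).and ((ht j).and
        ((ht (j + 1)).and ((hidx (j - 1)).and ((relIndex_succ hkn j).and
        ((relIndex_succ hkn (j - 1)).and (hlarge 1)))))))).exists
      rw [sub_add_cancel] at g7
      rw [← g2, ← g3, ← g4, g6, g7]
      rw [h1, g7] at g1
      exact optDigit_odd_rule (hN l) g8 g5.1 g1
  have hβ := isBeta hR
  have hgood := hsys.goodCell hβ hrules 0
  have hx4 : x 0 ≤ 1 / 4 := hsys.x_le 0 (by rcases hrules.a_mem (0 - 1) with h | h <;> omega)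
  have hy4 : y 0 ≤ 1 / 4 := hsys.y_le 0 (by rcases hrules.a_mem 0 with h | h <;> omega)
  have hxp := hsys.x_pos 0
  have hyp := hsys.y_pos 0
  have hstrict : 4 * c * (1 - x 0 * y 0) < 4 * limitValue R * (1 - x 0 * y 0) :=
    mul_lt_mul_of_pos_right (by linarith) (by nlinarith)
  have hk0 : ∀ l, relIndex k l 0 = k l := fun l => by simp [relIndex]
  have X := hx 0
  have Y := hy 0
  have Z := hs 0
  have W := hτ 0
  simp only [hk0] at X Y Z W
  -- In the limit the violated inequalities hold strictly at cell 0, because c lies below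
  -- `limitValue R`; hence they already hold for some l.
  have L := ((X.mul Y).const_sub 1).const_mul (4 * c)
  have e1 := L.eventually_lt (((X.const_sub 1).add Z).mul ((Y.const_sub 1).add W))
    (hstrict.trans_le hgood.A)
  have e2 := L.eventually_lt (((X.const_sub 1).add Z.neg).mul ((Y.const_sub 1).add W.neg))
    (hstrict.trans_le hgood.A')
  have e3 := L.eventually_lt (((X.const_add 1).add Z).mul ((Y.const_add 1).sub W))
    (hstrict.trans_le hgood.B)
  have e4 := L.eventually_lt (((X.const_add 1).add Z.neg).mul ((Y.const_add 1).sub W.neg))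
    (hstrict.trans_le hgood.B')
  obtain ⟨l, f0, f1, f2, f3, f4⟩ := (hpU.and (e1.and (e2.and (e3.and e4)))).exists
  exact hbad l f0 ⟨⟨f1.le, f3.le⟩, f2.le, f4.le⟩

lemma tendsto_rho {R : ℕ} (hR : 5 ≤ R) (hodd : Odd R) {α : ℕ → ℝ}
    (hα : ∀ l, Irrational (α l)) (hper : ∀ l, HasNegCFPeriod R l (α l)) :
    Tendsto (fun l => rho (α l)) atTop (𝓝 ((limitValue R : ℝ) : EReal)) := by
  rw [tendsto_order]
  constructor
  · intro b hb
    obtain ⟨c, h1, h2⟩ := EReal.lt_iff_exists_real_btwn.1 hb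
    filter_upwards [eventually_le_rho hR hodd hα hper (EReal.coe_lt_coe_iff.1 h2)] with l hl
    exact h1.trans_le hl
  · intro b hb
    obtain ⟨c, h1, h2⟩ := EReal.lt_iff_exists_real_btwn.1 hb
    filter_upwards [eventually_rho_le hR hodd hα hper (EReal.coe_lt_coe_iff.1 h1)] with l hl
    exact hl.trans_lt h2

/-! ### The expansion of C₁(R) in powers of 1/R. -/

lemma abs_limitValue_sub_le {R : ℕ} (hR : 5 ≤ R) :
    |limitValue R - (1 / 4) * (1 - 3 / (R : ℝ) + 6 / (R : ℝ) ^ 2)| ≤ 100 / (R : ℝ) ^ 3 := by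
  have hβ := isBeta hR
  have h2 := hβ.pos
  have h3 := hβ.le
  have hm := hβ.m_eq
  have hb := hβ.beta_eq
  set β := beta R
  have h5 : (5 : ℝ) ≤ R := by exact_mod_cast hR
  have hR0 : (0 : ℝ) < R := by linarith
  have hRβ : (R : ℝ) * β = 1 - β + β ^ 2 := by push_cast at hb; linarith
  have hP : 1 / 2 < 1 - 2 * β ^ 2 - β ^ 3 := by nlinarith [pow_pos h2 2, pow_pos h2 3]
  have hR : (R : ℝ) = (1 - β + β ^ 2) / β := by field_simp; linarith
  have hC : limitValue R = (1 - 3 * β + β ^ 2 + β ^ 3) / (4 * (1 - 2 * β ^ 2 - β ^ 3)) := by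
    rw [eq_div_iff (by linarith)]
    linear_combination hm
  have hD : 0 < 1 - β + β ^ 2 := by nlinarith
  -- In terms of β, with R = (1 - β + β²)/β, the error times R³ is a rational function without pole
  -- at β = 0. The bounds 20 for its polynomial factor and 1/2 for 1 - 2β² - β³ leave ample room
  -- under 100.
  have key : (limitValue R - (1 / 4) * (1 - 3 / (R : ℝ) + 6 / (R : ℝ) ^ 2)) * (R : ℝ) ^ 3 =
      (-16 + 26 * β - 4 * β ^ 3 + 2 * β ^ 4) * (1 - β + β ^ 2) /
        (4 * (1 - 2 * β ^ 2 - β ^ 3)) := by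
    rw [hC, hR]
    generalize hPe : 1 - 2 * β ^ 2 - β ^ 3 = P at hP ⊢
    have hP' : P ≠ 0 := by linarith
    have hD' : 1 - β + β ^ 2 ≠ 0 := hD.ne'
    field_simp
    subst hPe
    ring
  rw [le_div_iff₀ (by positivity), ← abs_of_pos (pow_pos hR0 3), ← abs_mul, key, abs_div,
    abs_of_pos (by linarith : 0 < 4 * (1 - 2 * β ^ 2 - β ^ 3)),
    div_le_iff₀ (by linarith), abs_mul, abs_of_pos hD]
  have hg : |-16 + 26 * β - 4 * β ^ 3 + 2 * β ^ 4| ≤ 20 := by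
    have h1 : β ≤ 1 := by linarith
    have := pow_le_one₀ (n := 3) h2.le h1
    have := pow_le_one₀ (n := 4) h2.le h1
    have := pow_pos h2 3
    have := pow_pos h2 4
    rw [abs_le]
    constructor <;> linarith
  calc _ ≤ 20 * (1 : ℝ) := mul_le_mul hg (by nlinarith) hD.le (by norm_num)
    _ ≤ _ := by linarith

end

end InhomApprox

end

theorem mainTheorem4 :
    (∀ R : ℕ, 5 ≤ R → Odd R → ∀ α : ℕ → ℝ,
      (∀ l, Irrational (α l)) → (∀ l, InhomApprox.HasNegCFPeriod R l (α l)) →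
        Tendsto (fun l => InhomApprox.rho (α l)) atTop
            (𝓝 ((InhomApprox.limitValue R : ℝ) : EReal)) ∧
          limsup (fun l => InhomApprox.M (α l) (InhomApprox.gammaStar (α l))) atTop
            < ((InhomApprox.limitValue R : ℝ) : EReal) ∧
          ∀ᶠ l in atTop,
            InhomApprox.M (α l) (InhomApprox.gammaStar (α l)) < InhomApprox.rho (α l)) ∧
    ∃ K : ℝ, ∀ R : ℕ, 5 ≤ R → Odd R →
      |InhomApprox.limitValue R - (1 / 4) * (1 - 3 / (R : ℝ) + 6 / (R : ℝ) ^ 2)|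
        ≤ K / (R : ℝ) ^ 3 := by
  refine ⟨fun R hR hodd α hα hper => ?_, 100, fun R hR _ => InhomApprox.abs_limitValue_sub_le hR⟩
  have hlim := InhomApprox.tendsto_rho hR hodd hα hper
  obtain ⟨c, hc, hev⟩ := InhomApprox.exists_eventually_M_gammaStar_le hR hodd hα hper
  have hc' : (c : EReal) < (InhomApprox.limitValue R : ℝ) := EReal.coe_lt_coe_iff.2 hc
  refine ⟨hlim, (limsup_le_of_le (by isBoundedDefault) hev).trans_lt hc', ?_⟩
  filter_upwards [hev, hlim.eventually (lt_mem_nhds hc')] with l h1 h2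
  exact h1.trans_lt h2
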